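/- **Kernels.** Let $V$ be a finite-dimensional real Hilbert space. An *$l$-Calderón–Zygmund kernel* on $V$ is a tempered distribution $K$ on $V$ that agrees with a (locally integrable) function on $V\setminus\{0\}$ and whose Fourier transform (with $\widehat f(\xi)=\int e^{-2\pi i\xi\cdot x}f(x)\,dx$) is a function $\widehat K$ with $|\widehat K|\le 1$, of class $C^l$ on $V\setminus\{0\}$, such that for every orthonormal basis the corresponding partial derivatives satisfy $|\partial^\alpha\widehat K(\xi)|\le|\xi|^{-|\alpha|}$ for all $\xi\neq0$, $|\alpha|\le l$. (If $\dim V=0$, then $K$ is a number with $|K|\le1$.) **Data and forms.** A *singular Brascamp–Lieb datum* $\mathbf H=(H;H_0,H_1,H_2,H_3;\Pi_0,\Pi_1,\Pi_2,\Pi_3)$ consists of finite-dimensional real Hilbert spaces $H,H_i$ and surjective linear maps $\Pi_i:H\to H_i$. For a kernel $K$ on $H_0$ and complex-valued Schwartz functions $f_i\in\mathcal S(H_i)$, the form is $$\Lambda_{\mathbf H}(K,f_1,f_2,f_3)=\int_H f_1(\Pi_1x)f_2(\Pi_2x)f_3(\Pi_3x)K(\Pi_0x)\,dx,$$ that is,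 $K$ applied to the Schwartz function $\varphi$ on $H_0$ determined by $\int_H f_1(\Pi_1x)f_2(\Pi_2x)f_3(\Pi_3x)\,g(\Pi_0x)\,dx=\int_{H_0}\varphi g$ for all $g\in\mathcal S(H_0)$; the form is said to be defined when the product $f_1(\Pi_1x)f_2(\Pi_2x)f_3(\Pi_3x)$ is integrable on $H$ and such a $\varphi$ exists. For $\mathbf p=(p_1,p_2,p_3)$, $\mathbf H$ is *$\mathbf p$-bounded* if there are $l\in\mathbb N$ and $C<\infty$ such that for all $l$-Calderón–Zygmund kernels $K$ on $H_0$ and all Schwartz functions $f_i\in\mathcal S(H_i)$ the form is defined and $|\Lambda_{\mathbf H}(K,f_1,f_2,f_3)|\le C\|f_1\|_{p_1}\|f_2\|_{p_2}\|f_3\|_{p_3}$. **Modules.** A *module* $\mathbf M=(M;M_0,M_1,M_2,M_3)$ is a finite-dimensional real vector space with four subspaces. Two modules are isomorphic if a linear isomorphism $M\to M'$ maps each $M_i$ onto $M_i'$; direct sums are taken componentwise. The module of $\mathbf H$ is $\mathbf M_{\mathbf H}=(H^*;\Pi_0^*H_0^*,\Pi_1^*H_1^*,\Pi_2^*H_2^*,\Pi_3^*H_3^*)$.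 With $e_1,e_2,\dots$ the standard basis and $\langle\cdot\rangle$ the linear span, let * $\mathbf P^{(1)}=(\mathbb R;0,0,\mathbb R,\mathbb R)$, $\mathbf P^{(2)}=(\mathbb R;0,\mathbb R,0,\mathbb R)$, $\mathbf P^{(3)}=(\mathbb R;0,\mathbb R,\mathbb R,0)$; * $\mathbf K^{(1)}=(\mathbb R^2;\langle e_1\rangle,0,\langle e_2\rangle,\langle e_1+e_2\rangle)$, $\mathbf K^{(2)}=(\mathbb R^2;\langle e_1\rangle,\langle e_2\rangle,0,\langle e_1+e_2\rangle)$, $\mathbf K^{(3)}=(\mathbb R^2;\langle e_1\rangle,\langle e_2\rangle,\langle e_1+e_2\rangle,0)$; * $\mathbf Y=(\mathbb R^2;0,\langle e_1\rangle,\langle e_2\rangle,\langle e_1+e_2\rangle)$; * $\mathbf Z=(\mathbb R^3;\langle e_1\rangle,\langle e_2\rangle,\langle e_2+e_3\rangle,\langle e_1+e_3\rangle)$; * $\mathbf L=(\mathbb R^4;\langle e_2+e_3\rangle,\langle e_1,e_2\rangle,\langle e_3,e_4\rangle,\langle e_1+e_3,e_2+e_4\rangle)$; * $\mathbf B=(\mathbb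 R^5;\langle e_1,e_2\rangle,\langle e_3,e_4\rangle,\langle e_3+e_5,e_1+e_4\rangle,\langle e_1+e_5,e_2+e_3\rangle)$. **Theorem.** Let $\mathbf H$ be a singular Brascamp–Lieb datum and let $1\le p_1,p_2,p_3<\infty$. Suppose that one of the following holds. i) There are $\{i,j,k\}=\{1,2,3\}$ with $\frac1{p_j}=\frac1{p_k}=1-\frac1{p_i}$ and $n_1,n_2,n_3,n_4\ge0$ with $$\mathbf M_{\mathbf H}\cong(\mathbf P^{(j)})^{\oplus n_1}\oplus(\mathbf K^{(j)})^{\oplus n_2}\oplus(\mathbf P^{(k)})^{\oplus n_3}\oplus(\mathbf K^{(k)})^{\oplus n_4}.$$ ii) $\frac1{p_1}+\frac1{p_2}+\frac1{p_3}=2$, and: if $p_1,p_2,p_3\ne1$, there are $n_1,n_2\ge0$ with $\mathbf M_{\mathbf H}\cong\mathbf Y^{\oplus n_1}\oplus\mathbf Z^{\oplus n_2}$; if $p_i=1$ for some $i$, there are $n_1,\dots,n_4\ge0$ with $\mathbf M_{\mathbf H}\cong\mathbf Y^{\oplus n_1}\oplus\mathbf Z^{\oplus n_2}\oplus(\mathbf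 P^{(i)})^{\oplus n_3}\oplus(\mathbf K^{(i)})^{\oplus n_4}$. iii) $p_1=p_2=p_3=2$, and there are $n_1,n_2\ge0$ and a finite list $\mathbf M_1,\dots,\mathbf M_k$ of modules from $\{\mathbf P^{(1)},\mathbf P^{(2)},\mathbf P^{(3)},\mathbf K^{(1)},\mathbf K^{(2)},\mathbf K^{(3)}\}$ with $$\mathbf M_{\mathbf H}\cong\mathbf L^{\oplus n_1}\oplus\mathbf B^{\oplus n_2}\oplus\mathbf M_1\oplus\dots\oplus\mathbf M_k.$$ Then $\mathbf H$ is $\mathbf p$-bounded. -/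

import Mathlib

open MeasureTheory SchwartzMap FourierTransform
open scoped ENNReal NNReal

/-! ### Calderón-Zygmund kernels -/

section Kernels

variable {V : Type*} [NormedAddCommGroup V] [InnerProductSpace ℝ V] [FiniteDimensional ℝ V]
  [MeasurableSpace V] [BorelSpace V]

/-- The tempered distribution `K` agrees with a function `k`, locally integrable on `V \ {0}`, away
from the origin. -/
def AgreesWithFunctionAwayFromZero (K : 𝓢'(V, ℂ)) : Prop :=
  ∃ k : V → ℂ, LocallyIntegrableOn k {0}ᶜ volume ∧
    ∀ φ : 𝓢(V, ℂ), HasCompactSupport φ → (0 : V) ∉ tsupport φ → K φ = ∫ x, φ x * k x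

/-- `K` is an `l`-Calderón-Zygmund kernel. Its Fourier transform is a function `m`, bounded by `1`
and of class `C^l` away from the origin, such that for every orthonormal basis `b` and every
`k ≤ l` each partial derivative `∂_{b (j 1)} ⋯ ∂_{b (j k)} m` is at most `|ξ|^{-k}` for `ξ ≠ 0`.

In positive dimension the value `m 0` plays no role, since `{0}` is a null set, and the bound
`|m| ≤ 1` is the case `k = 0` of the derivative bounds. On the zero-dimensional space the bound
`|m 0| ≤ 1` is what normalizes the kernel, which is then just a number. -/
def IsCZKernel (l : ℕ) (K : 𝓢'(V, ℂ)) : Prop :=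
  AgreesWithFunctionAwayFromZero K ∧
  ∃ m : V → ℂ,
    (∀ φ : 𝓢(V, ℂ), (𝓕 K) φ = ∫ ξ, φ ξ * m ξ) ∧
    (∀ ξ, ‖m ξ‖ ≤ 1) ∧
    ContDiffOn ℝ l m {0}ᶜ ∧
    ∀ b : OrthonormalBasis (Fin (Module.finrank ℝ V)) ℝ V, ∀ k ≤ l,
      ∀ (j : Fin k → Fin (Module.finrank ℝ V)) (ξ : V), ξ ≠ 0 →
        ‖iteratedFDeriv ℝ k m ξ (fun s => b (j s))‖ ≤ (‖ξ‖ ^ k)⁻¹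

end Kernels

/-! ### Singular Brascamp-Lieb data, forms and boundedness -/

/-- A (trilinear) singular Brascamp-Lieb datum: four surjective linear maps `Π_i : H → H_i`,
`i = 0, 1, 2, 3`, between finite-dimensional real Hilbert spaces. The function with index
`i : Fin 3` lives on `H_{i+1}`, which is `E i.succ`; the kernel lives on `H_0`, which is `E 0`. -/
structure SBLDatum (H : Type*) (E : Fin 4 → Type*)
    [NormedAddCommGroup H] [InnerProductSpace ℝ H] [FiniteDimensional ℝ H]
    [∀ i, NormedAddCommGroup (E i)] [∀ i, InnerProductSpace ℝ (E i)]
    [∀ i, FiniteDimensional ℝ (E i)] where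
  proj : ∀ i, H →ₗ[ℝ] E i
  surj : ∀ i, Function.Surjective (proj i)

namespace SBLDatum

variable {H : Type*} {E : Fin 4 → Type*}
  [NormedAddCommGroup H] [InnerProductSpace ℝ H] [FiniteDimensional ℝ H]
  [∀ i, NormedAddCommGroup (E i)] [∀ i, InnerProductSpace ℝ (E i)]
  [∀ i, FiniteDimensional ℝ (E i)]

/-- The product `x ↦ f₁ (Π₁ x) f₂ (Π₂ x) f₃ (Π₃ x)`. -/
noncomputable def integrand (D : SBLDatum H E) (f : ∀ i : Fin 3, 𝓢(E i.succ, ℂ)) (x : H) : ℂ :=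
  ∏ i : Fin 3, f i (D.proj i.succ x)

variable [MeasurableSpace H] [BorelSpace H] [∀ i, MeasurableSpace (E i)] [∀ i, BorelSpace (E i)]

/-- The Schwartz function `φ` on `H_0` is the density of the image under `Π₀` of the measure
`F dx`, where `F = f₁(Π₁ x) f₂(Π₂ x) f₃(Π₃ x)`: up to the Jacobian factor, `φ u` is the integral
of `F` over the fibre `Π₀ x = u`. -/
def IsFiberDensity (D : SBLDatum H E) (f : ∀ i : Fin 3, 𝓢(E i.succ, ℂ)) (φ : 𝓢(E 0, ℂ)) : Prop :=
  Integrable (D.integrand f) ∧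
    ∀ g : 𝓢(E 0, ℂ), ∫ x, D.integrand f x * g (D.proj 0 x) = ∫ u, φ u * g u

/-- The fibre integral is unique, so the value of the form is unique. -/
theorem IsFiberDensity.unique {D : SBLDatum H E} {f : ∀ i : Fin 3, 𝓢(E i.succ, ℂ)}
    {φ ψ : 𝓢(E 0, ℂ)} (h : D.IsFiberDensity f φ) (h' : D.IsFiberDensity f ψ) : φ = ψ := by
  have key : ∀ g : 𝓢(E 0, ℂ), ∫ u, φ u * g u = ∫ u, ψ u * g u :=
    fun g => (h.2 g).symm.trans (h'.2 g)
  have hae : (φ : E 0 → ℂ) =ᵐ[volume] ψ := by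
    refine ae_eq_of_integral_contDiff_smul_eq φ.integrable.locallyIntegrable
      ψ.integrable.locallyIntegrable ?_
    intro g hg hc
    have hg' : ContDiff ℝ (⊤ : ℕ∞) (fun x => (g x : ℂ)) := Complex.ofRealCLM.contDiff.comp hg
    have hc' : HasCompactSupport (fun x => (g x : ℂ)) :=
      hc.comp_left (g := fun r : ℝ => (r : ℂ)) (by simp)
    simpa [mul_comm] using key (hc'.toSchwartzMap hg')
  exact DFunLike.coe_injective ((φ.continuous.ae_eq_iff_eq _ ψ.continuous).1 hae)

/-- The singular Brascamp-Lieb form `∫ f₁(Π₁ x) f₂(Π₂ x) f₃(Π₃ x) K(Π₀ x) dx` is defined and its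
value is `v`. The integral against the distribution `K ∘ Π₀` means, as always for the pull-back of
a distribution under a surjective linear map, that `K` is applied to the integral of
`f₁(Π₁ x) f₂(Π₂ x) f₃(Π₃ x)` over the fibres of `Π₀`. -/
def HasForm (D : SBLDatum H E) (K : 𝓢'(E 0, ℂ)) (f : ∀ i : Fin 3, 𝓢(E i.succ, ℂ)) (v : ℂ) : Prop :=
  ∃ φ : 𝓢(E 0, ℂ), D.IsFiberDensity f φ ∧ K φ = v

/-- `𝐩`-boundedness: for some `l` there is a constant `C` such that for all `l`-Calderón-Zygmund
kernels `K` and all Schwartz functions the form is defined and is at most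
`C ‖f₁‖_{p₁} ‖f₂‖_{p₂} ‖f₃‖_{p₃}` in absolute value. -/
def IsPBounded (D : SBLDatum H E) (p : Fin 3 → ℝ≥0∞) : Prop :=
  ∃ (l : ℕ) (C : ℝ≥0), ∀ K : 𝓢'(E 0, ℂ), IsCZKernel l K →
    ∀ f : ∀ i : Fin 3, 𝓢(E i.succ, ℂ),
      ∃ v : ℂ, D.HasForm K f v ∧ ‖v‖ₑ ≤ C * ∏ i : Fin 3, eLpNorm (f i) (p i) volume

end SBLDatum

/-! ### Modules: representations of the four subspace quiver -/

/-- A module: a finite-dimensional real vector space with four subspaces `M_0, M_1, M_2, M_3`. -/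
structure FSModule where
  carrier : Type*
  [instAddCommGroup : AddCommGroup carrier]
  [instModule : Module ℝ carrier]
  [instFiniteDimensional : FiniteDimensional ℝ carrier]
  sub : Fin 4 → Submodule ℝ carrier

attribute [instance] FSModule.instAddCommGroup FSModule.instModule FSModule.instFiniteDimensional

namespace FSModule

/-- Isomorphism of modules. -/
def Iso (M N : FSModule) : Prop :=
  ∃ ψ : M.carrier ≃ₗ[ℝ] N.carrier, ∀ i, (M.sub i).map ψ.toLinearMap = N.sub i

/-- The direct sum of two modules. -/
def oplus (M N : FSModule) : FSModule where
  carrier := M.carrier × N.carrier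
  sub i := (M.sub i).prod (N.sub i)

/-- The direct sum of finitely many modules. -/
def directSum {k : ℕ} (M : Fin k → FSModule) : FSModule where
  carrier := ∀ s, (M s).carrier
  sub i := Submodule.pi Set.univ fun s => (M s).sub i

/-- The direct sum of `n` copies of `M`. -/
def power (M : FSModule) (n : ℕ) : FSModule :=
  directSum fun _ : Fin n => M

/-- The module `ℝⁿ` with the four subspaces given by the column spaces of four matrices with `n`
rows (the block columns of a block matrix). -/
noncomputable def ofColumns {n d₀ d₁ d₂ d₃ : ℕ}
    (A₀ : Matrix (Fin n) (Fin d₀) ℝ) (A₁ : Matrix (Fin n) (Fin d₁) ℝ)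
    (A₂ : Matrix (Fin n) (Fin d₂) ℝ) (A₃ : Matrix (Fin n) (Fin d₃) ℝ) : FSModule where
  carrier := Fin n → ℝ
  sub := ![LinearMap.range A₀.mulVecLin, LinearMap.range A₁.mulVecLin,
    LinearMap.range A₂.mulVecLin, LinearMap.range A₃.mulVecLin]

/-- The modules `𝐏⁽¹⁾, 𝐏⁽²⁾, 𝐏⁽³⁾` (Hölder's inequality), indexed by `0, 1, 2`. -/
noncomputable def modP : Fin 3 → FSModule
  | 0 => ofColumns (0 : Matrix (Fin 1) (Fin 0) ℝ) (0 : Matrix (Fin 1) (Fin 0) ℝ) !![1] !![1]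
  | 1 => ofColumns (0 : Matrix (Fin 1) (Fin 0) ℝ) !![1] (0 : Matrix (Fin 1) (Fin 0) ℝ) !![1]
  | 2 => ofColumns (0 : Matrix (Fin 1) (Fin 0) ℝ) !![1] !![1] (0 : Matrix (Fin 1) (Fin 0) ℝ)

/-- The modules `𝐊⁽¹⁾, 𝐊⁽²⁾, 𝐊⁽³⁾` (Hölder's inequality combined with a linear singular integral
operator), indexed by `0, 1, 2`. -/
noncomputable def modK : Fin 3 → FSModule
  | 0 => ofColumns !![1; 0] (0 : Matrix (Fin 2) (Fin 0) ℝ) !![0; 1] !![1; 1]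
  | 1 => ofColumns !![1; 0] !![0; 1] (0 : Matrix (Fin 2) (Fin 0) ℝ) !![1; 1]
  | 2 => ofColumns !![1; 0] !![0; 1] !![1; 1] (0 : Matrix (Fin 2) (Fin 0) ℝ)

/-- The module `𝐘`. -/
noncomputable def modY : FSModule :=
  ofColumns (0 : Matrix (Fin 2) (Fin 0) ℝ) !![1; 0] !![0; 1] !![1; 1]

/-- The module `𝐙`. -/
noncomputable def modZ : FSModule :=
  ofColumns !![1; 0; 0] !![0; 1; 0] !![0; 1; 1] !![1; 0; 1]

/-- The module `𝐋`. -/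
noncomputable def modL : FSModule :=
  ofColumns
    !![0; 1; 1; 0]
    !![1, 0; 0, 1; 0, 0; 0, 0]
    !![0, 0; 0, 0; 1, 0; 0, 1]
    !![1, 0; 0, 1; 1, 0; 0, 1]

/-- The module `𝐁`; the nilpotent Jordan block is `J₂(0) = (0 1; 0 0)`. -/
noncomputable def modB : FSModule :=
  ofColumns
    !![1, 0; 0, 1; 0, 0; 0, 0; 0, 0]
    !![0, 0; 0, 0; 1, 0; 0, 1; 0, 0]
    !![0, 1; 0, 0; 1, 0; 0, 1; 1, 0]
    !![1, 0; 0, 1; 0, 1; 0, 0; 1, 0]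

/-- Bilinear Hölder type: `{i, j, k} = {1, 2, 3}`, `1/p_j = 1/p_k = 1 - 1/p_i`, and
`M ≅ (𝐏⁽ʲ⁾)^{n₁} ⊕ (𝐊⁽ʲ⁾)^{n₂} ⊕ (𝐏⁽ᵏ⁾)^{n₃} ⊕ (𝐊⁽ᵏ⁾)^{n₄}`. -/
def BilinearHolderType (M : FSModule) (p : Fin 3 → ℝ≥0∞) : Prop :=
  ∃ i j k : Fin 3, i ≠ j ∧ j ≠ k ∧ i ≠ k ∧
    (p j)⁻¹ = (p k)⁻¹ ∧ (p k)⁻¹ = 1 - (p i)⁻¹ ∧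
    ∃ n₁ n₂ n₃ n₄ : ℕ,
      M.Iso ((((modP j).power n₁).oplus ((modK j).power n₂)).oplus
        (((modP k).power n₃).oplus ((modK k).power n₄)))

/-- Young type: `1/p₁ + 1/p₂ + 1/p₃ = 2`; if no exponent is `1` then `M ≅ 𝐘^{n₁} ⊕ 𝐙^{n₂}`, and if
`p_i = 1` then `M ≅ 𝐘^{n₁} ⊕ 𝐙^{n₂} ⊕ (𝐏⁽ⁱ⁾)^{n₃} ⊕ (𝐊⁽ⁱ⁾)^{n₄}`. -/
def YoungType (M : FSModule) (p : Fin 3 → ℝ≥0∞) : Prop :=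
  (p 0)⁻¹ + (p 1)⁻¹ + (p 2)⁻¹ = 2 ∧
    ((∀ i, p i ≠ 1) → ∃ n₁ n₂ : ℕ, M.Iso ((modY.power n₁).oplus (modZ.power n₂))) ∧
    (∀ i, p i = 1 → ∃ n₁ n₂ n₃ n₄ : ℕ,
      M.Iso (((modY.power n₁).oplus (modZ.power n₂)).oplus
        (((modP i).power n₃).oplus ((modK i).power n₄))))

/-- Loomis-Whitney type: `𝐩 = (2, 2, 2)` and `M ≅ 𝐋^{n₁} ⊕ 𝐁^{n₂} ⊕ M_1 ⊕ ⋯ ⊕ M_k`, where each `M_s`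
is one of `𝐏⁽¹⁾, 𝐏⁽²⁾, 𝐏⁽³⁾, 𝐊⁽¹⁾, 𝐊⁽²⁾, 𝐊⁽³⁾`. -/
def LoomisWhitneyType (M : FSModule) (p : Fin 3 → ℝ≥0∞) : Prop :=
  (∀ i, p i = 2) ∧
    ∃ (n₁ n₂ k : ℕ) (N : Fin k → FSModule),
      (∀ s, N s ∈ Set.range modP ∪ Set.range modK) ∧
      M.Iso (((modL.power n₁).oplus (modB.power n₂)).oplus (directSum N))

end FSModule

/-- The module `𝐌_𝐇 = (H^*; Π₀^* H_0^*, Π₁^* H_1^*, Π₂^* H_2^*, Π₃^* H_3^*)` of a datum. -/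
noncomputable def SBLDatum.module {H : Type*} {E : Fin 4 → Type*}
    [NormedAddCommGroup H] [InnerProductSpace ℝ H] [FiniteDimensional ℝ H]
    [∀ i, NormedAddCommGroup (E i)] [∀ i, InnerProductSpace ℝ (E i)]
    [∀ i, FiniteDimensional ℝ (E i)] (D : SBLDatum H E) : FSModule where
  carrier := Module.Dual ℝ H
  sub i := LinearMap.range (D.proj i).dualMap

/-! In all three cases the subspaces with indices 1, 2, 3 span the module, so the joint map (Π₁, Π₂,
Π₃) is injective on H. The product of the three Schwartz functions is then itself a Schwartz
function F on H, and integrating it over the fibres of Π₀ gives a Schwartz function φ with 𝓕 φ = 𝓕 F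
∘ Π₀^* (`exists_isFiberDensity`). The form is K φ, and only the estimate remains.

The Hölder and Young cases use a single linear singular integral. By `isPBounded_of_isConvBounded`
the kernel may be taken to be a bounded integrable function k whose convolution operator is bounded
on L^q, q > 1, with a uniform constant. In suitable coordinates (t, x) on H with t = Π₀, the
integrand has the form a(x) G(ℓ x + C t) with C injective. Integrating in t convolves G with k along
the range of C, which is bounded on L^q by slicing (`IsConvBounded.lintegral_kernelTranslate_le`).
What is left is Hölder's inequality with G = f_j ⊗ f_k, or Young's inequality with G = f_k for an
index k with p_k ≠ 1.

The uniform L^q bounds are classical Calderón–Zygmund theory. The multiplier is cut into dyadic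
annuli; each piece, rescaled to the unit annulus, has a kernel with good decay, and the pieces sum
to a kernel satisfying Hörmander's condition uniformly in the truncation
(`exists_isHormanderKernel_fourier_truncMultiplier`). The Calderón–Zygmund decomposition gives a
distributional inequality (`IsHormanderKernel.volume_lt_kernelConv_le`); integrated over heights it
yields the exponents between 1 and 2, and duality yields those above 2.

The Loomis–Whitney case needs no cancellation, only |𝓕 K| ≤ 1. Writing f_a as the Fourier transform
of 𝓕⁻ f_a turns 𝓕 F(Π₀^* ξ) into an integral over the tuples (e₁, e₂, e₃) with ∑ Π_a^* e_a = -Π₀^*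
ξ. Integrating also in ξ gives an integral of ∏ |𝓕⁻ f_a(e_a)| over the space of all relations ∑
Π_i^* e_i = 0, i = 0, …, 3. This space is the direct sum X ⊕ Y ⊕ Z of the relations that avoid index
1, 2, 3 respectively, so e₁, e₂, e₃ are linear coordinates on Y ⊕ Z, X ⊕ Z, X ⊕ Y
(`exists_coordinates_relationSpace`). The Loomis–Whitney inequality and Plancherel finish the proof.

The modules enter only through a few properties (`Spans`, `Indep`, `RelationsSurj`, `RelationsSpan`,
`RelationsIndep`) that pass to isomorphic modules and direct sums, and so need checking only on the
listed summands. By duality, `Spans` and `Indep` say that the corresponding joint projection from H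
is injective, respectively surjective. -/

/-! ### Dyadic cubes and the Calderón-Zygmund stopping cubes -/

section Dyadic

variable {V : Type*} [NormedAddCommGroup V] [InnerProductSpace ℝ V] [FiniteDimensional ℝ V]

/-- The index of the dyadic cube of side length `2 ^ (-k)` that contains `x`. -/
noncomputable def dyadicIndex (k : ℤ) (x : V) : Fin (Module.finrank ℝ V) → ℤ :=
  fun i => ⌊(2 : ℝ) ^ k * (stdOrthonormalBasis ℝ V).repr x i⌋

/-- The dyadic cube of side length `2 ^ (-k)` with index `n`. -/
def dyadicCube (k : ℤ) (n : Fin (Module.finrank ℝ V) → ℤ) : Set V :=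
  {x | dyadicIndex k x = n}

/-- The lower left corner of a dyadic cube. -/
noncomputable def dyadicCorner (k : ℤ) (n : Fin (Module.finrank ℝ V) → ℤ) : V :=
  (stdOrthonormalBasis ℝ V).repr.symm (WithLp.toLp 2 fun i => ((2 : ℝ) ^ k)⁻¹ * n i)

theorem dyadicIndex_corner (k : ℤ) (n : Fin (Module.finrank ℝ V) → ℤ) :
    dyadicIndex k (dyadicCorner k n : V) = n := by
  funext i
  have : (0 : ℝ) < 2 ^ k := by positivity
  simp [dyadicIndex, dyadicCorner, this.ne']

theorem dyadicIndex_eq_of_succ {k : ℤ} {x y : V} (h : dyadicIndex (k + 1) x = dyadicIndex (k + 1) y) :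
    dyadicIndex k x = dyadicIndex k y := by
  -- The index at one scale is the integer half of the index at the next finer scale, so dyadic
  -- cubes are nested.
  have key : ∀ a : ℝ, ⌊a⌋ = ⌊2 * a⌋ / 2 := by
    intro a
    have h1 := Int.floor_le a
    have h2 := Int.lt_floor_add_one a
    have h3 := Int.floor_le (2 * a)
    have h4 := Int.lt_floor_add_one (2 * a)
    have h5 : 2 * ⌊a⌋ ≤ ⌊2 * a⌋ := Int.le_floor.2 (by push_cast; linarith)
    have h6 : ⌊2 * a⌋ < 2 * ⌊a⌋ + 2 := by
      have : ((⌊2 * a⌋ : ℤ) : ℝ) < ((2 * ⌊a⌋ + 2 : ℤ) : ℝ) := by push_cast; linarith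
      exact_mod_cast this
    omega
  funext i
  have hi := congrFun h i
  simp only [dyadicIndex, zpow_add_one₀ (two_ne_zero : (2 : ℝ) ≠ 0)] at hi ⊢
  rw [key, key ((2 : ℝ) ^ k * _), ← mul_assoc, ← mul_assoc, mul_comm (2 : ℝ), hi]

theorem dyadicIndex_eq_of_le {j k : ℤ} (hjk : j ≤ k) {x y : V}
    (h : dyadicIndex k x = dyadicIndex k y) : dyadicIndex j x = dyadicIndex j y := by
  obtain ⟨n, rfl⟩ := Int.le.dest hjk
  induction n with
  | zero => simpa using h
  | succ n ih =>
    refine ih (by omega) (dyadicIndex_eq_of_succ ?_)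
    convert h using 2 <;> push_cast <;> ring

theorem norm_sub_le_of_dyadicIndex_eq {k : ℤ} {x y : V} (h : dyadicIndex k x = dyadicIndex k y) :
    ‖x - y‖ ≤ Module.finrank ℝ V * ((2 : ℝ) ^ k)⁻¹ := by
  set b := stdOrthonormalBasis ℝ V
  have h2 : (0 : ℝ) < 2 ^ k := by positivity
  rw [← b.sum_repr (x - y)]
  refine (norm_sum_le _ _).trans ?_
  have : ∀ i ∈ Finset.univ, ‖b.repr (x - y) i • b i‖ ≤ ((2 : ℝ) ^ k)⁻¹ := by
    intro i _
    rw [norm_smul, b.norm_eq_one, mul_one, map_sub, Real.norm_eq_abs]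
    have hi := Int.abs_sub_lt_one_of_floor_eq_floor (congrFun h i)
    rw [← mul_sub, abs_mul, abs_of_pos h2] at hi
    rw [← one_div, le_div_iff₀ h2, mul_comm]
    exact hi.le
  refine (Finset.sum_le_sum this).trans ?_
  simp

variable [MeasurableSpace V] [BorelSpace V]

theorem measurable_dyadicIndex (k : ℤ) : Measurable (dyadicIndex k : V → _) := by
  refine measurable_pi_lambda _ fun i => Int.measurable_floor.comp ?_
  have : Continuous fun x : V => (2 : ℝ) ^ k * (stdOrthonormalBasis ℝ V).repr x i := by
    fun_prop
  exact this.measurable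

theorem measurableSet_dyadicCube (k : ℤ) (n : Fin (Module.finrank ℝ V) → ℤ) :
    MeasurableSet (dyadicCube k n : Set V) :=
  measurable_dyadicIndex k (measurableSet_singleton n)

theorem volume_dyadicCube (k : ℤ) (n : Fin (Module.finrank ℝ V) → ℤ) :
    volume (dyadicCube k n : Set V) = (ENNReal.ofReal ((2 : ℝ) ^ k)⁻¹) ^ Module.finrank ℝ V := by
  have h2 : (0 : ℝ) < 2 ^ k := by positivity
  have hmp := (EuclideanSpace.volume_preserving_symm_measurableEquiv_toLp
    (Fin (Module.finrank ℝ V))).comp (stdOrthonormalBasis ℝ V).measurePreserving_repr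
  have hset : (dyadicCube k n : Set V) =
      ((MeasurableEquiv.toLp 2 (Fin (Module.finrank ℝ V) → ℝ)).symm ∘ (stdOrthonormalBasis ℝ V).repr) ⁻¹'
      (Set.pi Set.univ fun i => Set.Ico (((2 : ℝ) ^ k)⁻¹ * n i) (((2 : ℝ) ^ k)⁻¹ * (n i + 1))) := by
    ext x
    simp only [dyadicCube, dyadicIndex, Set.mem_ofPred_eq, funext_iff, Int.floor_eq_iff,
      Set.mem_preimage, Set.mem_pi, Set.mem_univ, true_imp_iff, Set.mem_Ico, Function.comp]
    refine forall_congr' fun i => ?_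
    rw [inv_mul_le_iff₀ h2, lt_inv_mul_iff₀ h2]
    rfl
  rw [hset, hmp.measure_preimage (MeasurableSet.univ_pi fun i => measurableSet_Ico).nullMeasurableSet,
    Real.volume_pi_Ico]
  have : ∀ i, ((2 : ℝ) ^ k)⁻¹ * (n i + 1) - ((2 : ℝ) ^ k)⁻¹ * n i = ((2 : ℝ) ^ k)⁻¹ := fun i => by ring
  simp [this]

theorem volume_dyadicCube_ne_zero (k : ℤ) (n : Fin (Module.finrank ℝ V) → ℤ) :
    volume (dyadicCube k n : Set V) ≠ 0 := by
  rw [volume_dyadicCube]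
  have : (0 : ℝ) < (2 ^ k)⁻¹ := by positivity
  exact pow_ne_zero _ (ENNReal.ofReal_pos.2 this).ne'

theorem volume_dyadicCube_ne_top (k : ℤ) (n : Fin (Module.finrank ℝ V) → ℤ) :
    volume (dyadicCube k n : Set V) ≠ ∞ := by
  rw [volume_dyadicCube]
  exact ENNReal.pow_ne_top ENNReal.ofReal_ne_top

theorem volume_dyadicCube_pred (k : ℤ) (n m : Fin (Module.finrank ℝ V) → ℤ) :
    volume (dyadicCube (k - 1) m : Set V) =
      2 ^ Module.finrank ℝ V * volume (dyadicCube k n : Set V) := by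
  rw [volume_dyadicCube, volume_dyadicCube, ← mul_pow]
  congr 1
  rw [zpow_sub_one₀ two_ne_zero, mul_inv, inv_inv, ENNReal.ofReal_mul (by positivity), mul_comm]
  simp

/-- The Calderón-Zygmund stopping cubes of a continuous integrable function at height `t`. -/
theorem exists_stopping_cubes (hd : 0 < Module.finrank ℝ V) {f : V → ℂ} (hc : Continuous f)
    (hi : Integrable f) {t : ℝ≥0} (ht : 0 < t) :
    ∃ S : Set (ℤ × (Fin (Module.finrank ℝ V) → ℤ)),
      S.PairwiseDisjoint (fun s => (dyadicCube s.1 s.2 : Set V)) ∧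
      (∀ s ∈ S, t * volume (dyadicCube s.1 s.2 : Set V) ≤ ∫⁻ x in dyadicCube s.1 s.2, ‖f x‖ₑ) ∧
      (∀ s ∈ S, ∫⁻ x in dyadicCube s.1 s.2, ‖f x‖ₑ ≤
        2 ^ Module.finrank ℝ V * t * volume (dyadicCube s.1 s.2 : Set V)) ∧
      ∀ x, (∀ s ∈ S, x ∉ dyadicCube s.1 s.2) → ‖f x‖ₑ ≤ t := by
  set sel : ℤ → (Fin (Module.finrank ℝ V) → ℤ) → Prop := fun k n =>
    t * volume (dyadicCube k n : Set V) < ∫⁻ x in dyadicCube k n, ‖f x‖ₑ with hsel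
  -- The stopping cubes are the selected cubes that lie in no selected cube of a coarser scale.
  -- Maximality gives disjointness and, applied to the dyadic parent, the upper bound with the
  -- factor 2^d.
  refine ⟨{s | sel s.1 s.2 ∧ ∀ j < s.1, ∀ m, (dyadicCube s.1 s.2 : Set V) ⊆ dyadicCube j m → ¬ sel j m},
    ?_, fun s hs => hs.1.le, ?_, ?_⟩
  · rintro ⟨k, n⟩ ⟨h1, h1'⟩ ⟨k', n'⟩ ⟨h2, h2'⟩ hne
    refine Set.disjoint_left.2 fun x hx hx' => ?_
    simp only [dyadicCube, Set.mem_ofPred_eq] at hx hx'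
    have aux : ∀ {j k : ℤ}, j ≤ k → (dyadicCube k (dyadicIndex k x) : Set V) ⊆
        dyadicCube j (dyadicIndex j x) := fun hjk y hy => dyadicIndex_eq_of_le hjk hy
    subst hx hx'
    rcases lt_trichotomy k k' with h | h | h
    · exact h2' _ h _ (aux h.le) h1
    · subst h; exact hne rfl
    · exact h1' _ h _ (aux h.le) h2
  · rintro ⟨k, n⟩ ⟨h1, h1'⟩
    have hsub : (dyadicCube k n : Set V) ⊆
        dyadicCube (k - 1) (dyadicIndex (k - 1) (dyadicCorner k n : V)) := by
      intro y hy
      refine dyadicIndex_eq_of_le (sub_one_lt k).le ?_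
      rw [dyadicIndex_corner]; exact hy
    have := not_lt.1 (h1' (k - 1) (sub_one_lt k) _ hsub)
    refine (lintegral_mono_set hsub).trans (this.trans_eq ?_)
    rw [volume_dyadicCube_pred k n]; ring
  · intro x hx
    have hnot : ∀ k, ¬ sel k (dyadicIndex k x) := by
      intro k0 hk0
      -- A selected cube has volume less than ‖f‖₁ / t, so a largest one around x exists. Positive
      -- dimension is needed here: in dimension zero all cubes have volume one.
      obtain ⟨b, hb⟩ : ∃ b : ℤ, ∀ k, sel k (dyadicIndex k x) → b ≤ k := by
        have hfin : (∫⁻ x, ‖f x‖ₑ) / t ≠ ∞ :=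
          ENNReal.div_ne_top hi.2.ne (by simpa using ht.ne')
        obtain ⟨N, hN⟩ := ENNReal.exists_nat_gt hfin
        refine ⟨-N, fun k hk => ?_⟩
        by_contra! hlt
        have h3 : t * volume (dyadicCube k (dyadicIndex k x) : Set V) < ∫⁻ x, ‖f x‖ₑ :=
          lt_of_lt_of_le hk (setLIntegral_le_lintegral _ _)
        rw [mul_comm] at h3
        have h4 := (ENNReal.lt_div_iff_mul_lt (Or.inl (by simpa using ht.ne')) (Or.inl (by simp))).2 h3
        have h5 := h4.trans hN
        rw [volume_dyadicCube, ← zpow_neg] at h5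
        have h6 : (N : ℝ) ≤ 2 ^ (-k) := by
          calc (N : ℝ) ≤ 2 ^ N := by exact_mod_cast Nat.lt_two_pow_self.le
            _ = 2 ^ (N : ℤ) := by simp
            _ ≤ 2 ^ (-k) := zpow_le_zpow_right₀ (by norm_num) (by omega)
        have h7 : (1 : ℝ) ≤ 2 ^ (-k) := one_le_zpow₀ (by norm_num) (by omega)
        refine h5.not_ge ?_
        calc (N : ℝ≥0∞) = ENNReal.ofReal N := by simp
          _ ≤ ENNReal.ofReal (2 ^ (-k)) := ENNReal.ofReal_le_ofReal h6
          _ ≤ _ := le_self_pow₀ (by simpa using h7) hd.ne'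
      obtain ⟨k, hk, hmin⟩ := Int.exists_least_of_bdd ⟨b, hb⟩ ⟨k0, hk0⟩
      refine hx (k, dyadicIndex k x) ⟨hk, fun j hj m hsub hm => ?_⟩ rfl
      have : dyadicIndex j x = m := hsub (rfl : dyadicIndex k x = dyadicIndex k x)
      subst this
      exact (hmin j hm).not_gt hj
    -- Continuity replaces Lebesgue differentiation: if |f(x)| > t, then |f| > r > t on a small
    -- enough cube around x, which is therefore selected.
    by_contra! hlt
    obtain ⟨r, hr1, hr2⟩ := ENNReal.lt_iff_exists_nnreal_btwn.1 hlt
    have hopen : IsOpen {y | (r : ℝ≥0∞) < ‖f y‖ₑ} := isOpen_lt continuous_const hc.enorm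
    obtain ⟨δ, hδ, hball⟩ := Metric.isOpen_iff.1 hopen x hr2
    have hlim : ∃ k : ℤ, Module.finrank ℝ V * ((2 : ℝ) ^ k)⁻¹ < δ := by
      obtain ⟨n, hn⟩ := exists_nat_gt (Module.finrank ℝ V / δ)
      refine ⟨n, ?_⟩
      have : (n : ℝ) < 2 ^ n := by exact_mod_cast Nat.lt_two_pow_self
      rw [zpow_natCast, ← div_eq_mul_inv, div_lt_iff₀ (by positivity)]
      rw [div_lt_iff₀ hδ] at hn
      nlinarith
    obtain ⟨k, hk⟩ := hlim
    refine hnot k ?_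
    calc t * volume (dyadicCube k (dyadicIndex k x) : Set V)
        < r * volume (dyadicCube k (dyadicIndex k x) : Set V) :=
          ENNReal.mul_lt_mul_left (volume_dyadicCube_ne_zero _ _) (volume_dyadicCube_ne_top _ _) hr1
      _ = ∫⁻ y in dyadicCube k (dyadicIndex k x), r := by simp
      _ ≤ _ := by
        refine setLIntegral_mono' (measurableSet_dyadicCube _ _) fun y hy => ?_
        refine (hball ?_).le
        rw [Metric.mem_ball, dist_eq_norm]
        exact (norm_sub_le_of_dyadicIndex_eq hy).trans_lt hk

end Dyadic

/-! ### The Calderón-Zygmund decomposition -/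

section Decomposition

variable {V : Type*} [NormedAddCommGroup V] [InnerProductSpace ℝ V] [FiniteDimensional ℝ V]
  [MeasurableSpace V] [BorelSpace V]

variable (V) in
/-- The ratio of the volume of a dilated ball around a dyadic cube to the volume of the cube. -/
noncomputable def cubeDilationConst : ℝ≥0∞ :=
  ENNReal.ofReal (2 * Module.finrank ℝ V) ^ Module.finrank ℝ V * volume (Metric.ball (0 : V) 1)

theorem volume_closedBall_dyadicCorner (k : ℤ) (n : Fin (Module.finrank ℝ V) → ℤ) :
    volume (Metric.closedBall (dyadicCorner k n : V)
      (2 * (Module.finrank ℝ V * ((2 : ℝ) ^ k)⁻¹))) =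
      cubeDilationConst V * volume (dyadicCube k n : Set V) := by
  rw [Measure.addHaar_closedBall _ _ (by positivity), volume_dyadicCube, cubeDilationConst,
    ← ENNReal.ofReal_pow (by positivity), ← ENNReal.ofReal_pow (by positivity), mul_right_comm, ← ENNReal.ofReal_mul (by positivity),
    ← mul_pow, mul_assoc]

/-- The Calderón-Zygmund decomposition `f = g + (f - g)` at height `t`: the good part `g` agrees
with `f` off `Ω`, and on each of the cubes that make up `Ω` it is the mean of `f`; `c y` is a corner
of the cube of `y`, and `Ω'` is the union of the dilated cubes. -/
theorem exists_cz_decomposition (hd : 0 < Module.finrank ℝ V) {f : V → ℂ} (hc : Continuous f)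
    (hi : Integrable f) {t : ℝ≥0} (ht : 0 < t) :
    ∃ (Ω Ω' : Set V) (g : V → ℂ) (c : V → V),
      MeasurableSet Ω ∧ MeasurableSet Ω' ∧ Measurable g ∧ Measurable c ∧ Integrable g ∧
      (∃ B : ℝ, ∀ x, ‖g x‖ ≤ B) ∧ volume Ω ≠ ∞ ∧
      t * volume Ω ≤ ∫⁻ x in Ω, ‖f x‖ₑ ∧
      volume Ω' ≤ cubeDilationConst V * volume Ω ∧
      ∫⁻ x, ‖g x‖ₑ ^ 2 ≤
        (∫⁻ x in {x | ‖f x‖ₑ ≤ t}, ‖f x‖ₑ ^ 2) + (2 ^ Module.finrank ℝ V * t) ^ 2 * volume Ω ∧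
      ∫⁻ x in Ω, ‖f x - g x‖ₑ ≤ 2 * (2 ^ Module.finrank ℝ V * t) * volume Ω ∧
      (∀ x ∉ Ω, g x = f x) ∧
      (∀ x ∉ Ω', ∀ y ∈ Ω, 2 * ‖y - c y‖ ≤ ‖x - c y‖) ∧
      ∀ k : V → ℂ, Continuous k → (∃ B : ℝ, ∀ x, ‖k x‖ ≤ B) →
        ∫ y in Ω, k (c y) * (f y - g y) = 0 := by
  classical
  obtain ⟨S, hdisj, hlow, hup, hout⟩ := exists_stopping_cubes hd hc hi ht
  set D : ℝ≥0∞ := 2 ^ Module.finrank ℝ V * t with hD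
  have hDtop : D ≠ ∞ := by
    rw [hD]; exact ENNReal.mul_ne_top (by simp) (by simp)
  set Q : ℤ × (Fin (Module.finrank ℝ V) → ℤ) → Set V := fun s => dyadicCube s.1 s.2 with hQ
  have hQm : ∀ s, MeasurableSet (Q s) := fun s => measurableSet_dyadicCube _ _
  set Ω : Set V := ⋃ s : S, Q s with hΩ
  have hΩm : MeasurableSet Ω := MeasurableSet.iUnion fun s => hQm s
  have hdisj' : Pairwise (Function.onFun Disjoint fun s : S => Q s) := fun s s' hs =>
    hdisj s.2 s'.2 (fun h => hs (Subtype.ext h))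
  have hΩmem : ∀ y, y ∈ Ω ↔ ∃ s, s ∈ S ∧ y ∈ Q s := fun y => by simp [hΩ]
  have hvol : volume Ω = ∑' s : S, volume (Q s) := measure_iUnion hdisj' fun s => hQm s
  have hsumf : ∫⁻ x in Ω, ‖f x‖ₑ = ∑' s : S, ∫⁻ x in Q s, ‖f x‖ₑ :=
    lintegral_iUnion (s := fun s : S => Q s) (fun s => hQm s) hdisj' _
  have hΩlow : t * volume Ω ≤ ∫⁻ x in Ω, ‖f x‖ₑ := by
    rw [hvol, hsumf, ← ENNReal.tsum_mul_left]
    exact ENNReal.tsum_le_tsum fun s => hlow s s.2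
  have hΩup : ∫⁻ x in Ω, ‖f x‖ₑ ≤ D * volume Ω := by
    rw [hvol, hsumf, ← ENNReal.tsum_mul_left]
    exact ENNReal.tsum_le_tsum fun s => hup s s.2
  have hΩfin : volume Ω ≠ ∞ := by
    intro h
    have h1 : t * volume Ω < ∞ := (hΩlow.trans (setLIntegral_le_lintegral _ _)).trans_lt hi.2
    rw [h, ENNReal.mul_top (by simpa using ht.ne')] at h1
    exact lt_irrefl _ h1
  -- The stopping cube that contains y. The value off Ω is a dummy; the countable codomain makes
  -- everything that factors through σ measurable.
  set σ : V → ℤ × (Fin (Module.finrank ℝ V) → ℤ) := fun y =>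
    if h : ∃ s, s ∈ S ∧ y ∈ Q s then h.choose else (0, 0) with hσ
  have hσ1 : ∀ y ∈ Ω, σ y ∈ S ∧ y ∈ Q (σ y) := by
    intro y hy
    have h := (hΩmem y).1 hy
    simp only [hσ, dif_pos h]
    exact h.choose_spec
  have hσ2 : ∀ y, ∀ s ∈ S, y ∈ Q s → σ y = s := by
    intro y s hs hy
    have h := hσ1 y ((hΩmem y).2 ⟨s, hs, hy⟩)
    by_contra hne
    exact Set.disjoint_left.1 (hdisj h.1 hs hne) h.2 hy
  have hσm : Measurable σ := by
    refine measurable_to_countable' fun s => ?_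
    have : σ ⁻¹' {s} = (Ω ∩ {y | s ∈ S ∧ y ∈ Q s}) ∪ (Ωᶜ ∩ {_y | s = (0, 0)}) := by
      ext y
      by_cases hy : y ∈ Ω
      · simp only [Set.mem_preimage, Set.mem_singleton_iff, Set.mem_union, Set.mem_inter_iff, hy,
          Set.mem_compl_iff, not_true, false_and, or_false, true_and, Set.mem_ofPred_eq]
        exact ⟨fun h => h ▸ hσ1 y hy, fun h => hσ2 y s h.1 h.2⟩
      · have h : ¬ ∃ s, s ∈ S ∧ y ∈ Q s := fun h => hy ((hΩmem y).2 h)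
        simp only [Set.mem_preimage, Set.mem_singleton_iff, Set.mem_union, Set.mem_inter_iff, hy,
          Set.mem_compl_iff, not_false_iff, false_and, false_or, true_and, Set.mem_ofPred_eq, hσ,
          dif_neg h]
        exact eq_comm
    rw [this]
    refine (hΩm.inter ?_).union (hΩm.compl.inter (MeasurableSet.const _))
    exact (MeasurableSet.const _).inter (hQm s)
  set avg : ℤ × (Fin (Module.finrank ℝ V) → ℤ) → ℂ := fun s => ⨍ x in Q s, f x with havg
  have havg_le : ∀ s ∈ S, ‖avg s‖ₑ ≤ D := by
    intro s hs
    have h0 : volume (Q s) ≠ 0 := volume_dyadicCube_ne_zero _ _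
    have h1 : volume (Q s) ≠ ∞ := volume_dyadicCube_ne_top _ _
    have h2 : ‖avg s‖ₑ ≤ (volume (Q s))⁻¹ * ∫⁻ x in Q s, ‖f x‖ₑ := by
      simp only [havg]
      rw [setAverage_eq, enorm_smul]
      refine mul_le_mul' (le_of_eq ?_) (enorm_integral_le_lintegral_enorm _)
      rw [Real.enorm_eq_ofReal (by positivity), Measure.real, ENNReal.ofReal_inv_of_pos
        (ENNReal.toReal_pos h0 h1), ENNReal.ofReal_toReal h1]
    refine h2.trans ((mul_le_mul' le_rfl (hup s hs)).trans_eq ?_)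
    rw [mul_comm, mul_assoc, ENNReal.mul_inv_cancel h0 h1, mul_one]
  set g : V → ℂ := Ω.piecewise (fun y => avg (σ y)) f with hg
  have hgm : Measurable g :=
    Measurable.piecewise hΩm ((measurable_of_countable avg).comp hσm) hc.measurable
  have hgΩ : ∀ y ∈ Ω, g y = avg (σ y) := fun y hy => Set.piecewise_eq_of_mem _ _ _ hy
  have hgΩc : ∀ y ∉ Ω, g y = f y := fun y hy => Set.piecewise_eq_of_notMem _ _ _ hy
  have hgD : ∀ y ∈ Ω, ‖g y‖ₑ ≤ D := fun y hy => by
    rw [hgΩ y hy]; exact havg_le _ (hσ1 y hy).1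
  have hft : ∀ y ∉ Ω, ‖f y‖ₑ ≤ t := fun y hy =>
    hout y fun s hs hys => hy ((hΩmem y).2 ⟨s, hs, hys⟩)
  have hgB : ∀ x, ‖g x‖ ≤ max D.toReal t := by
    intro x
    by_cases hx : x ∈ Ω
    · refine le_max_of_le_left ?_
      have := ENNReal.toReal_mono hDtop (hgD x hx)
      simpa using this
    · refine le_max_of_le_right ?_
      rw [hgΩc x hx]
      have := ENNReal.toReal_mono (by simp) (hft x hx)
      simpa using this
  have hgi : Integrable g := by
    refine Integrable.piecewise hΩm ?_ hi.integrableOn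
    refine Measure.integrableOn_of_bounded hΩfin
      ((measurable_of_countable avg).comp hσm).aestronglyMeasurable
      (M := max D.toReal t) ?_
    refine (ae_restrict_mem hΩm).mono fun x hx => ?_
    rw [← hgΩ x hx]; exact hgB x
  set c : V → V := fun y => dyadicCorner (σ y).1 (σ y).2 with hcdef
  have hcm : Measurable c :=
    (measurable_of_countable fun s : ℤ × (Fin (Module.finrank ℝ V) → ℤ) =>
      (dyadicCorner s.1 s.2 : V)).comp hσm
  refine ⟨Ω, ⋃ s : S, Metric.closedBall (dyadicCorner s.1.1 s.1.2 : V)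
      (2 * (Module.finrank ℝ V * ((2 : ℝ) ^ s.1.1)⁻¹)), g, c, hΩm,
    MeasurableSet.iUnion fun s => Metric.isClosed_closedBall.measurableSet, hgm, hcm, hgi,
    ⟨_, hgB⟩, hΩfin, hΩlow, ?_, ?_, ?_, hgΩc, ?_, ?_⟩
  · refine (measure_iUnion_le _).trans ?_
    rw [hvol, ← ENNReal.tsum_mul_left]
    exact ENNReal.tsum_le_tsum fun s => (volume_closedBall_dyadicCorner _ _).le
  · rw [← lintegral_add_compl _ hΩm, add_comm]
    refine add_le_add ?_ ?_
    · rw [setLIntegral_congr_fun hΩm.compl (g := fun x => ‖f x‖ₑ ^ 2)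
        fun x hx => by rw [hgΩc x hx]]
      exact lintegral_mono_set fun x hx => hft x hx
    · refine (setLIntegral_mono' hΩm (g := fun _ => D ^ 2) fun x hx =>
        pow_le_pow_left' (hgD x hx) 2).trans ?_
      simp
  · calc ∫⁻ x in Ω, ‖f x - g x‖ₑ ≤ ∫⁻ x in Ω, (‖f x‖ₑ + ‖g x‖ₑ) :=
          lintegral_mono fun x => enorm_sub_le
      _ = (∫⁻ x in Ω, ‖f x‖ₑ) + ∫⁻ x in Ω, ‖g x‖ₑ := lintegral_add_left hc.enorm.measurable _
      _ ≤ D * volume Ω + D * volume Ω := by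
          refine add_le_add hΩup ((setLIntegral_mono' hΩm (g := fun _ => D) hgD).trans ?_)
          simp
      _ = 2 * D * volume Ω := by ring
  -- Ω' contains the ball around the corner of the cube of y whose radius is twice the diameter
  -- bound d · 2^(-k); its complement lies in the region of Hörmander's condition centred at that
  -- corner.
  · intro x hx y hy
    obtain ⟨hs, hyQ⟩ := hσ1 y hy
    have h1 : x ∉ Metric.closedBall (c y) (2 * (Module.finrank ℝ V * ((2 : ℝ) ^ (σ y).1)⁻¹)) :=
      fun h => hx (Set.mem_iUnion.2 ⟨⟨σ y, hs⟩, h⟩)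
    rw [Metric.mem_closedBall, not_le, dist_eq_norm] at h1
    have h2 : ‖y - c y‖ ≤ Module.finrank ℝ V * ((2 : ℝ) ^ (σ y).1)⁻¹ :=
      norm_sub_le_of_dyadicIndex_eq (hyQ.trans (dyadicIndex_corner _ _).symm)
    linarith
  -- On each stopping cube k ∘ c is constant and f - g has mean zero.
  · rintro k hk ⟨B, hB⟩
    have hint : Integrable fun y => k (c y) * (f y - g y) :=
      (hi.sub hgi).bdd_mul (hk.measurable.comp hcm).aestronglyMeasurable
        (Filter.Eventually.of_forall fun y => hB (c y))
    rw [integral_iUnion (fun s : S => hQm s) hdisj' hint.integrableOn]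
    refine (tsum_congr fun s : S => ?_).trans tsum_zero
    have hcong : ∀ y ∈ Q s, k (c y) * (f y - g y) = k (dyadicCorner s.1.1 s.1.2) * (f y - avg s) := by
      intro y hy
      have h1 : σ y = s := hσ2 y s s.2 hy
      rw [hgΩ y ((hΩmem y).2 ⟨s, s.2, hy⟩), hcdef]
      simp only [h1]
    have h0 : volume (Q s) ≠ 0 := volume_dyadicCube_ne_zero _ _
    have h1 : volume (Q s) ≠ ∞ := volume_dyadicCube_ne_top _ _
    rw [setIntegral_congr_fun (hQm s) hcong, integral_const_mul,
      integral_sub hi.integrableOn (integrableOn_const h1), setIntegral_const, havg]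
    simp only [setAverage_eq]
    rw [smul_smul, Measure.real, mul_inv_cancel₀ (ENNReal.toReal_pos h0 h1).ne', one_smul, sub_self, mul_zero]

end Decomposition

/-! ### Calderón-Zygmund convolution operators: the distributional inequality -/

section ConvKernel

variable {V : Type*} [NormedAddCommGroup V] [InnerProductSpace ℝ V] [FiniteDimensional ℝ V]
  [MeasurableSpace V] [BorelSpace V]

/-- Convolution with the kernel `K`. -/
noncomputable def kernelConv (K g : V → ℂ) (x : V) : ℂ := ∫ y, K (x - y) * g y

/-- A nice convolution kernel with quantitative control by `A` of its norm as a convolution operator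
on `L²` and of its Hörmander constant. -/
structure IsHormanderKernel (A : ℝ≥0) (K : V → ℂ) : Prop where
  continuous : Continuous K
  integrable : Integrable K
  bounded : ∃ B : ℝ, ∀ x, ‖K x‖ ≤ B
  lintegral_sq_le : ∀ g : V → ℂ, Measurable g → Integrable g → (∃ B : ℝ, ∀ x, ‖g x‖ ≤ B) →
    ∫⁻ x, ‖kernelConv K g x‖ₑ ^ 2 ≤ A * ∫⁻ x, ‖g x‖ₑ ^ 2
  hormander : ∀ y, ∫⁻ x in {x | 2 * ‖y‖ ≤ ‖x‖}, ‖K (x - y) - K x‖ₑ ≤ A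

theorem integrable_kernel_mul {K g : V → ℂ} (hK : Continuous K) (hKb : ∃ B : ℝ, ∀ x, ‖K x‖ ≤ B)
    (hg : Integrable g) (x : V) : Integrable fun y => K (x - y) * g y := by
  obtain ⟨B, hB⟩ := hKb
  exact hg.bdd_mul (hK.comp (continuous_const.sub continuous_id)).aestronglyMeasurable
    (Filter.Eventually.of_forall fun y => hB (x - y))

theorem continuous_kernelConv {K g : V → ℂ} (hK : Continuous K) (hKb : ∃ B : ℝ, ∀ x, ‖K x‖ ≤ B)
    (hg : Integrable g) : Continuous (kernelConv K g) := by
  obtain ⟨B, hB⟩ := hKb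
  refine continuous_of_dominated (bound := fun y => B * ‖g y‖) (fun x =>
    (integrable_kernel_mul hK ⟨B, hB⟩ hg x).aestronglyMeasurable) (fun x => ?_)
    (hg.norm.const_mul B) ?_
  · refine Filter.Eventually.of_forall fun y => ?_
    rw [norm_mul]
    exact mul_le_mul_of_nonneg_right (hB _) (norm_nonneg _)
  · refine Filter.Eventually.of_forall fun y => ?_
    exact (hK.comp (continuous_id.sub continuous_const)).mul continuous_const

/-- The good part is controlled by the L² bound and Chebyshev, the bad part by cancellation and
Hörmander's condition off the dilated cubes, and the dilated cubes themselves by their measure. The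
right-hand side keeps large and small values of f apart, so that integrating over heights gives the
L^p bound directly, with no interpolation theorem. -/
theorem IsHormanderKernel.volume_lt_kernelConv_le (hd : 0 < Module.finrank ℝ V) {A : ℝ≥0}
    {K : V → ℂ} (hK : IsHormanderKernel A K) {f : V → ℂ} (hc : Continuous f) (hi : Integrable f)
    {t : ℝ≥0} (ht : 0 < t) :
    volume {x | (2 * t : ℝ≥0∞) < ‖kernelConv K f x‖ₑ} ≤
      2 * (cubeDilationConst V + A * (2 ^ Module.finrank ℝ V) ^ 2 + 2 * 2 ^ Module.finrank ℝ V * A) *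
        ((t : ℝ≥0∞)⁻¹ * ∫⁻ x in {x | (t / 2 : ℝ≥0∞) < ‖f x‖ₑ}, ‖f x‖ₑ) +
      A * ((t : ℝ≥0∞)⁻¹ ^ 2 * ∫⁻ x in {x | ‖f x‖ₑ ≤ t}, ‖f x‖ₑ ^ 2) := by
  obtain ⟨Ω, Ω', g, c, hΩ, hΩ', hg, hcm, hgi, hgB, hfin, hlow, hdil, hgood, hbad, hgf, hdist, hcanc⟩ :=
    exists_cz_decomposition hd hc hi ht
  set D : ℝ≥0∞ := 2 ^ Module.finrank ℝ V with hD
  have ht0 : (t : ℝ≥0∞) ≠ 0 := by simpa using ht.ne'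
  have htt : (t : ℝ≥0∞) ≠ ∞ := by simp
  have htt' : (t : ℝ≥0∞)⁻¹ * t = 1 := ENNReal.inv_mul_cancel ht0 htt
  have hKm := hK.continuous.measurable
  -- The part of Ω where |f| ≤ t/2 contributes at most (t/2)|Ω| to the integral of |f|, which is at
  -- least t|Ω|. This half is absorbed on the left, leaving only large values of f.
  have hΩvol : volume Ω ≤ 2 * ((t : ℝ≥0∞)⁻¹ * ∫⁻ x in {x | (t / 2 : ℝ≥0∞) < ‖f x‖ₑ}, ‖f x‖ₑ) := by
    set I := ∫⁻ x in {x | (t / 2 : ℝ≥0∞) < ‖f x‖ₑ}, ‖f x‖ₑ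
    have hm : MeasurableSet {x | (t / 2 : ℝ≥0∞) < ‖f x‖ₑ} :=
      measurableSet_lt measurable_const hc.enorm.measurable
    have h1 : ∫⁻ x in Ω, ‖f x‖ₑ ≤ I + t / 2 * volume Ω := by
      rw [← lintegral_inter_add_sdiff (μ := volume) _ Ω hm]
      refine add_le_add (lintegral_mono_set Set.inter_subset_right) ?_
      refine (setLIntegral_mono' (hΩ.diff hm) (g := fun _ => (t / 2 : ℝ≥0∞))
        fun x hx => not_lt.1 hx.2).trans ?_
      rw [setLIntegral_const]
      exact mul_le_mul' le_rfl (measure_mono Set.sdiff_subset)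
    have h2 : (t / 2 : ℝ≥0∞) * volume Ω + t / 2 * volume Ω ≤ I + t / 2 * volume Ω := by
      rw [← add_mul, ENNReal.add_halves]; exact hlow.trans h1
    have h3 : (t / 2 : ℝ≥0∞) * volume Ω ≤ I :=
      (ENNReal.add_le_add_iff_right (ENNReal.mul_ne_top (ENNReal.div_ne_top htt (by simp)) hfin)).1 h2
    calc volume Ω = 2 * ((t : ℝ≥0∞)⁻¹ * (t / 2 * volume Ω)) := by
          rw [ENNReal.div_eq_inv_mul, mul_comm (2⁻¹ : ℝ≥0∞), ← mul_assoc, ← mul_assoc, ← mul_assoc,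
            mul_assoc 2, htt', mul_one, ENNReal.mul_inv_cancel (by simp) (by simp), one_mul]
      _ ≤ _ := by gcongr
  -- The term with K(x - c y) integrates to zero over Ω by the cancellation on the cubes, so it can
  -- be subtracted at no cost.
  have hsplit : ∀ x, kernelConv K f x = kernelConv K g x +
      ∫ y in Ω, (K (x - y) - K (x - c y)) * (f y - g y) := by
    intro x
    have e1 := integrable_kernel_mul hK.continuous hK.bounded hgi x
    have e2 := integrable_kernel_mul hK.continuous hK.bounded (hi.sub hgi) x
    have e3 : ∫ y in Ω, K (x - c y) * (f y - g y) = 0 :=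
      hcanc (fun z => K (x - z)) (hK.continuous.comp (continuous_const.sub continuous_id))
        (hK.bounded.imp fun B hB z => hB _)
    have e4 : IntegrableOn (fun y => K (x - c y) * (f y - g y)) Ω := by
      obtain ⟨B, hB⟩ := hK.bounded
      exact ((hi.sub hgi).bdd_mul (hKm.comp (measurable_const.sub hcm)).aestronglyMeasurable
        (Filter.Eventually.of_forall fun y => hB (x - c y))).integrableOn
    have e5 : ∫ y in Ω, K (x - y) * (f y - g y) = ∫ y, K (x - y) * (f y - g y) :=
      setIntegral_eq_integral_of_forall_compl_eq_zero fun y hy => by rw [hgf y hy]; simp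
    simp only [sub_mul]
    simp only [Pi.sub_apply] at e2
    rw [integral_sub e2.integrableOn e4, e3, sub_zero]
    rw [e5, kernelConv, kernelConv, ← integral_add e1 e2]
    exact integral_congr_ae (Filter.Eventually.of_forall fun y => by simp only; ring)
  set b : V → ℝ≥0∞ := fun x => ∫⁻ y in Ω, ‖K (x - y) - K (x - c y)‖ₑ * ‖f y - g y‖ₑ with hb
  have hker : Measurable fun z : V × V => ‖K (z.1 - z.2) - K (z.1 - c z.2)‖ₑ * ‖f z.2 - g z.2‖ₑ := by
    have := hc.measurable
    fun_prop
  have hbm : Measurable b := hker.lintegral_prod_right'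
  have hsub : {x | (2 * t : ℝ≥0∞) < ‖kernelConv K f x‖ₑ} ⊆
      ({x | (t : ℝ≥0∞) ≤ ‖kernelConv K g x‖ₑ} ∪ Ω') ∪ {x | (t : ℝ≥0∞) ≤ Ω'ᶜ.indicator b x} := by
    intro x hx
    by_contra hcon
    simp only [Set.mem_union, Set.mem_ofPred_eq, not_or, not_le] at hcon
    obtain ⟨⟨h1, h2⟩, h3⟩ := hcon
    rw [Set.indicator_of_mem h2] at h3
    refine lt_irrefl (2 * t : ℝ≥0∞) (lt_of_lt_of_le hx ?_)
    rw [hsplit x, two_mul]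
    refine (enorm_add_le _ _).trans (add_le_add h1.le (le_trans ?_ h3.le))
    refine (enorm_integral_le_lintegral_enorm _).trans (lintegral_mono fun y => ?_)
    simp only
    rw [enorm_mul]
  -- Chebyshev in L². The L² norm of g sees the values of f up to t, and on Ω the bound 2^d t,
  -- whence the two terms.
  have hTg : volume {x | (t : ℝ≥0∞) ≤ ‖kernelConv K g x‖ₑ} ≤
      A * ((t : ℝ≥0∞)⁻¹ ^ 2 * ∫⁻ x in {x | ‖f x‖ₑ ≤ t}, ‖f x‖ₑ ^ 2) + A * D ^ 2 * volume Ω := by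
    have hset : {x | (t : ℝ≥0∞) ≤ ‖kernelConv K g x‖ₑ} =
        {x | (t : ℝ≥0∞) ^ 2 ≤ ‖kernelConv K g x‖ₑ ^ 2} := by
      ext x; exact (ENNReal.pow_le_pow_left_iff two_ne_zero).symm
    have hmeas : Measurable fun x => ‖kernelConv K g x‖ₑ ^ 2 :=
      (continuous_kernelConv hK.continuous hK.bounded hgi).enorm.measurable.pow_const 2
    have h1 := mul_meas_ge_le_lintegral (μ := volume) hmeas ((t : ℝ≥0∞) ^ 2)
    rw [← hset] at h1
    have h2 := h1.trans ((hK.lintegral_sq_le g hg hgi hgB).trans (mul_le_mul' le_rfl hgood))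
    have h3 : (t : ℝ≥0∞)⁻¹ ^ 2 * t ^ 2 = 1 := by rw [← mul_pow, htt', one_pow]
    calc volume {x | (t : ℝ≥0∞) ≤ ‖kernelConv K g x‖ₑ}
        = (t : ℝ≥0∞)⁻¹ ^ 2 * (t ^ 2 * volume {x | (t : ℝ≥0∞) ≤ ‖kernelConv K g x‖ₑ}) := by
          rw [← mul_assoc, h3, one_mul]
      _ ≤ (t : ℝ≥0∞)⁻¹ ^ 2 * (A * ((∫⁻ x in {x | ‖f x‖ₑ ≤ t}, ‖f x‖ₑ ^ 2) +
            (D * t) ^ 2 * volume Ω)) := by gcongr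
      _ = A * ((t : ℝ≥0∞)⁻¹ ^ 2 * ∫⁻ x in {x | ‖f x‖ₑ ≤ t}, ‖f x‖ₑ ^ 2) +
            ((t : ℝ≥0∞)⁻¹ ^ 2 * t ^ 2) * (A * D ^ 2 * volume Ω) := by ring
      _ = _ := by rw [h3, one_mul]
  -- Chebyshev in L¹ and Tonelli; for each y ∈ Ω the x-integral is Hörmander's integral after
  -- translation by the corner c y.
  have hTb : volume {x | (t : ℝ≥0∞) ≤ Ω'ᶜ.indicator b x} ≤ 2 * D * A * volume Ω := by
    have h1 := mul_meas_ge_le_lintegral (μ := volume) (hbm.indicator hΩ'.compl) (t : ℝ≥0∞)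
    rw [lintegral_indicator hΩ'.compl] at h1
    have h2 : ∫⁻ x in Ω'ᶜ, b x ≤ A * ∫⁻ y in Ω, ‖f y - g y‖ₑ := by
      simp only [hb]
      rw [lintegral_lintegral_swap hker.aemeasurable, ← lintegral_const_mul' _ _ (by simp)]
      refine setLIntegral_mono' hΩ fun y hy => ?_
      rw [lintegral_mul_const' _ _ (by simp)]
      refine mul_le_mul' ?_ le_rfl
      calc ∫⁻ x in Ω'ᶜ, ‖K (x - y) - K (x - c y)‖ₑ
          ≤ ∫⁻ x in {x | 2 * ‖y - c y‖ ≤ ‖x - c y‖}, ‖K (x - y) - K (x - c y)‖ₑ :=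
            lintegral_mono_set fun x hx => hdist x hx y hy
        _ = ∫⁻ x in {x | 2 * ‖y - c y‖ ≤ ‖x‖}, ‖K (x - (y - c y)) - K x‖ₑ := by
            rw [← lintegral_indicator (measurableSet_le (by fun_prop) (by fun_prop)),
              ← lintegral_indicator (measurableSet_le (by fun_prop) (by fun_prop))]
            refine Eq.trans (lintegral_congr fun x => ?_) (lintegral_sub_right_eq_self _ (c y))
            simp only [Set.indicator, Set.mem_ofPred_eq, sub_sub_sub_cancel_right]
        _ ≤ A := hK.hormander _
    have h3 := h1.trans (h2.trans (mul_le_mul' le_rfl hbad))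
    calc volume {x | (t : ℝ≥0∞) ≤ Ω'ᶜ.indicator b x}
        = (t : ℝ≥0∞)⁻¹ * (t * volume {x | (t : ℝ≥0∞) ≤ Ω'ᶜ.indicator b x}) := by
          rw [← mul_assoc, htt', one_mul]
      _ ≤ (t : ℝ≥0∞)⁻¹ * (A * (2 * (D * t) * volume Ω)) := by gcongr
      _ = ((t : ℝ≥0∞)⁻¹ * t) * (2 * D * A * volume Ω) := by ring
      _ = _ := by rw [htt', one_mul]
  set J := (t : ℝ≥0∞)⁻¹ * ∫⁻ x in {x | (t / 2 : ℝ≥0∞) < ‖f x‖ₑ}, ‖f x‖ₑ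
  set G := A * ((t : ℝ≥0∞)⁻¹ ^ 2 * ∫⁻ x in {x | ‖f x‖ₑ ≤ t}, ‖f x‖ₑ ^ 2)
  calc volume {x | (2 * t : ℝ≥0∞) < ‖kernelConv K f x‖ₑ}
      ≤ (G + A * D ^ 2 * volume Ω) + cubeDilationConst V * volume Ω + 2 * D * A * volume Ω := by
        refine (measure_mono hsub).trans ((measure_union_le _ _).trans (add_le_add ?_ hTb))
        exact (measure_union_le _ _).trans (add_le_add hTg hdil)
    _ = (cubeDilationConst V + A * D ^ 2 + 2 * D * A) * volume Ω + G := by ring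
    _ ≤ (cubeDilationConst V + A * D ^ 2 + 2 * D * A) * (2 * J) + G := by gcongr
    _ = _ := by ring

end ConvKernel

/-! ### Calderón-Zygmund convolution operators: `L^p` bounds -/

theorem lintegral_Ioi_indicator_rpow_lt {p : ℝ} (hp : 1 < p) {a : ℝ} (ha : 0 ≤ a) :
    ∫⁻ t in Set.Ioi (0 : ℝ), {t | t < a}.indicator (fun t => ENNReal.ofReal (t ^ (p - 2))) t =
      ENNReal.ofReal (a ^ (p - 1) / (p - 1)) := by
  rw [show {t : ℝ | t < a} = Set.Iio a by ext; simp, lintegral_indicator measurableSet_Iio, Measure.restrict_restrict measurableSet_Iio]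
  have hset : Set.Iio a ∩ Set.Ioi 0 = Set.Ioo 0 a := by ext; simp [and_comm]
  rw [hset, restrict_Ioo_eq_restrict_Ioc,
    ← ofReal_integral_eq_lintegral_ofReal, ← intervalIntegral.integral_of_le ha,
    integral_rpow (Or.inl (by linarith)), show p - 2 + 1 = p - 1 by ring,
    Real.zero_rpow (by linarith), sub_zero]
  · refine (intervalIntegrable_iff_integrableOn_Ioc_of_le ha).1 ?_
    exact intervalIntegral.intervalIntegrable_rpow' (by linarith)
  · exact (ae_restrict_mem measurableSet_Ioc).mono fun t ht => Real.rpow_nonneg ht.1.le _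

theorem lintegral_Ioi_indicator_rpow_ge {p : ℝ} (hp : p < 2) {a : ℝ} (ha : 0 < a) :
    ∫⁻ t in Set.Ioi (0 : ℝ), {t | a ≤ t}.indicator (fun t => ENNReal.ofReal (t ^ (p - 3))) t =
      ENNReal.ofReal (a ^ (p - 2) / (2 - p)) := by
  rw [show {t : ℝ | a ≤ t} = Set.Ici a by ext; simp, lintegral_indicator measurableSet_Ici, Measure.restrict_restrict measurableSet_Ici]
  have hset : Set.Ici a ∩ Set.Ioi 0 = Set.Ici a := by
    ext t; simp only [Set.mem_inter_iff, Set.mem_Ioi, Set.mem_Ici]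
    exact ⟨fun h => h.1, fun h => ⟨h, ha.trans_le h⟩⟩
  rw [hset, ← restrict_Ioi_eq_restrict_Ici, ← ofReal_integral_eq_lintegral_ofReal,
    integral_Ioi_rpow_of_lt (by linarith) ha, show p - 3 + 1 = p - 2 by ring, ← neg_sub p 2, div_neg,
    neg_div]
  · exact integrableOn_Ioi_rpow_of_lt (by linarith) ha
  · exact (ae_restrict_mem measurableSet_Ioi).mono fun t ht => Real.rpow_nonneg (ha.trans ht).le _

section

variable {α : Type*} [MeasurableSpace α] {μ : Measure α} [SFinite μ]

/-- Tonelli: for fixed x the integral of t^(p-2) over 0 < t < 4‖f x‖ converges at zero because p >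
1. -/
theorem lintegral_Ioi_lintegral_lt {f : α → ℂ} (hf : Measurable f) {p : ℝ} (hp : 1 < p) :
    ∫⁻ t in Set.Ioi (0 : ℝ), (∫⁻ x in {x | t / 4 < ‖f x‖}, ‖f x‖ₑ ∂μ) * ENNReal.ofReal (t ^ (p - 2)) =
      ENNReal.ofReal (4 ^ (p - 1) / (p - 1)) * ∫⁻ x, ‖f x‖ₑ ^ p ∂μ := by
  have hm : ∀ t : ℝ, MeasurableSet {x | t / 4 < ‖f x‖} := fun t =>
    measurableSet_lt measurable_const hf.norm
  have h1 : ∀ t : ℝ, (∫⁻ x in {x | t / 4 < ‖f x‖}, ‖f x‖ₑ ∂μ) * ENNReal.ofReal (t ^ (p - 2)) =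
      ∫⁻ x, ‖f x‖ₑ * {t | t < 4 * ‖f x‖}.indicator (fun t => ENNReal.ofReal (t ^ (p - 2))) t ∂μ := by
    intro t
    rw [← lintegral_indicator (hm t), ← lintegral_mul_const' _ _ (by simp)]
    refine lintegral_congr fun x => ?_
    by_cases h : t / 4 < ‖f x‖
    · rw [Set.indicator_of_mem (by exact h), Set.indicator_of_mem]
      simp only [Set.mem_ofPred_eq]; linarith
    · rw [Set.indicator_of_notMem (by exact h), Set.indicator_of_notMem]
      · simp
      · simp only [Set.mem_ofPred_eq]; intro; apply h; linarith
  simp_rw [h1]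
  rw [lintegral_lintegral_swap, ← lintegral_const_mul' _ _ (by simp)]
  · refine lintegral_congr fun x => ?_
    rw [lintegral_const_mul' _ _ (by simp), lintegral_Ioi_indicator_rpow_lt hp (by positivity),
      ← ofReal_norm, ← ENNReal.ofReal_mul (norm_nonneg _),
      ENNReal.ofReal_rpow_of_nonneg (norm_nonneg _) (by linarith),
      ← ENNReal.ofReal_mul (div_nonneg (by positivity) (by linarith))]
    congr 1
    rw [Real.mul_rpow (by norm_num) (norm_nonneg _)]
    rcases (norm_nonneg (f x)).eq_or_lt with h | h
    · rw [← h, Real.zero_rpow (by linarith : p ≠ 0)]; simp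
    · rw [Real.rpow_sub_one h.ne']; field_simp
  · refine Measurable.aemeasurable ?_
    have hset : MeasurableSet {z : ℝ × α | z.1 < 4 * ‖f z.2‖} :=
      measurableSet_lt measurable_fst (by fun_prop)
    have : Measurable fun z : ℝ × α => ‖f z.2‖ₑ *
        {z : ℝ × α | z.1 < 4 * ‖f z.2‖}.indicator (fun z => ENNReal.ofReal (z.1 ^ (p - 2))) z := by
      refine Measurable.mul (by fun_prop) (Measurable.indicator ?_ hset)
      exact (measurable_fst.pow_const _).ennreal_ofReal
    exact this

/-- Tonelli again: for fixed x with f x ≠ 0 the integral of t^(p-3) over t ≥ 2‖f x‖ converges at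
infinity because p < 2. -/
theorem lintegral_Ioi_lintegral_le {f : α → ℂ} (hf : Measurable f) {p : ℝ} (hp0 : 0 < p) (hp : p < 2) :
    ∫⁻ t in Set.Ioi (0 : ℝ), (∫⁻ x in {x | ‖f x‖ ≤ t / 2}, ‖f x‖ₑ ^ 2 ∂μ) *
      ENNReal.ofReal (t ^ (p - 3)) ≤
      ENNReal.ofReal (2 ^ (p - 2) / (2 - p)) * ∫⁻ x, ‖f x‖ₑ ^ p ∂μ := by
  have hm : ∀ t : ℝ, MeasurableSet {x | ‖f x‖ ≤ t / 2} := fun t =>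
    measurableSet_le hf.norm measurable_const
  have h1 : ∀ t : ℝ, (∫⁻ x in {x | ‖f x‖ ≤ t / 2}, ‖f x‖ₑ ^ 2 ∂μ) * ENNReal.ofReal (t ^ (p - 3)) =
      ∫⁻ x, ‖f x‖ₑ ^ 2 * {t | 2 * ‖f x‖ ≤ t}.indicator (fun t => ENNReal.ofReal (t ^ (p - 3))) t ∂μ := by
    intro t
    rw [← lintegral_indicator (hm t), ← lintegral_mul_const' _ _ (by simp)]
    refine lintegral_congr fun x => ?_
    by_cases h : ‖f x‖ ≤ t / 2
    · rw [Set.indicator_of_mem (by exact h), Set.indicator_of_mem]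
      simp only [Set.mem_ofPred_eq]; linarith
    · rw [Set.indicator_of_notMem (by exact h), Set.indicator_of_notMem]
      · simp
      · simp only [Set.mem_ofPred_eq]; intro; apply h; linarith
  simp_rw [h1]
  rw [lintegral_lintegral_swap, ← lintegral_const_mul' _ _ (by simp)]
  · refine lintegral_mono fun x => ?_
    simp only
    rw [lintegral_const_mul' _ _ (by simp)]
    rcases (norm_nonneg (f x)).eq_or_lt with h | h
    · rw [norm_eq_zero.1 h.symm]; simp
    rw [lintegral_Ioi_indicator_rpow_ge hp (by positivity),
      ← ofReal_norm, ← ENNReal.ofReal_pow (norm_nonneg _), ← ENNReal.ofReal_mul (by positivity),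
      ENNReal.ofReal_rpow_of_nonneg (norm_nonneg _) (by linarith),
      ← ENNReal.ofReal_mul (div_nonneg (by positivity) (by linarith))]
    refine le_of_eq (congrArg _ ?_)
    rw [Real.mul_rpow (by norm_num) (norm_nonneg _), Real.rpow_sub h, Real.rpow_two]
    have : 2 - p ≠ 0 := by linarith
    field_simp
  · refine Measurable.aemeasurable ?_
    have hset : MeasurableSet {z : ℝ × α | 2 * ‖f z.2‖ ≤ z.1} :=
      measurableSet_le (by fun_prop) measurable_fst
    have : Measurable fun z : ℝ × α => ‖f z.2‖ₑ ^ 2 *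
        {z : ℝ × α | 2 * ‖f z.2‖ ≤ z.1}.indicator (fun z => ENNReal.ofReal (z.1 ^ (p - 3))) z := by
      refine Measurable.mul (by fun_prop) (Measurable.indicator ?_ hset)
      exact (measurable_fst.pow_const _).ennreal_ofReal
    exact this

end

section ConvKernel

variable {V : Type*} [NormedAddCommGroup V] [InnerProductSpace ℝ V] [FiniteDimensional ℝ V]
  [MeasurableSpace V] [BorelSpace V]

theorem cubeDilationConst_ne_top : cubeDilationConst V ≠ ∞ :=
  ENNReal.mul_ne_top (ENNReal.pow_ne_top ENNReal.ofReal_ne_top) measure_ball_lt_top.ne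

/-- Layer-cake formula combined with the distributional inequality. The term with large values of f
needs p > 1, the one with small values needs p < 2. -/
theorem exists_lintegral_kernelConv_le_of_lt_two (hd : 0 < Module.finrank ℝ V) (A : ℝ≥0) {p : ℝ}
    (hp1 : 1 < p) (hp2 : p < 2) :
    ∃ C : ℝ≥0, ∀ K : V → ℂ, IsHormanderKernel A K → ∀ f : V → ℂ, Continuous f → Integrable f →
      ∫⁻ x, ‖kernelConv K f x‖ₑ ^ p ≤ C * ∫⁻ x, ‖f x‖ₑ ^ p := by
  set C₁ : ℝ≥0∞ :=
    2 * (cubeDilationConst V + A * (2 ^ Module.finrank ℝ V) ^ 2 + 2 * 2 ^ Module.finrank ℝ V * A)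
    with hC₁
  have hC₁t : C₁ ≠ ∞ := by
    have := cubeDilationConst_ne_top (V := V)
    rw [hC₁]
    finiteness
  set C : ℝ≥0∞ := ENNReal.ofReal p * (2 * C₁ * ENNReal.ofReal (4 ^ (p - 1) / (p - 1)) +
    4 * A * ENNReal.ofReal (2 ^ (p - 2) / (2 - p))) with hC
  have hCt : C ≠ ∞ := by rw [hC]; finiteness
  refine ⟨C.toNNReal, fun K hK f hc hi => ?_⟩
  rw [ENNReal.coe_toNNReal hCt]
  have hcont := continuous_kernelConv hK.continuous hK.bounded hi
  have h1 : ∀ x, ‖kernelConv K f x‖ₑ ^ p = ENNReal.ofReal (‖kernelConv K f x‖ ^ p) := fun x => by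
    rw [← ofReal_norm, ENNReal.ofReal_rpow_of_nonneg (norm_nonneg _) (by linarith)]
  simp_rw [h1]
  rw [lintegral_rpow_eq_lintegral_meas_lt_mul _ (Filter.Eventually.of_forall fun x => norm_nonneg _)
    hcont.norm.aemeasurable (by linarith), hC, mul_assoc]
  refine mul_le_mul' le_rfl ?_
  have h2 : ∀ t ∈ Set.Ioi (0 : ℝ), volume {x | t < ‖kernelConv K f x‖} * ENNReal.ofReal (t ^ (p - 1)) ≤
      2 * C₁ * ((∫⁻ x in {x | t / 4 < ‖f x‖}, ‖f x‖ₑ) * ENNReal.ofReal (t ^ (p - 2))) +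
      4 * A * ((∫⁻ x in {x | ‖f x‖ ≤ t / 2}, ‖f x‖ₑ ^ 2) * ENNReal.ofReal (t ^ (p - 3))) := by
    intro t ht
    have ht' : 0 < t := ht
    have hs : 0 < (t / 2).toNNReal := by simpa using ht'
    have hsc : ((t / 2).toNNReal : ℝ≥0∞) = ENNReal.ofReal (t / 2) := rfl
    -- The inequality is taken at height t/2, so that its threshold is exactly t; its truncation
    -- levels become t/4 and t/2.
    have hw := hK.volume_lt_kernelConv_le hd hc hi hs
    rw [← hC₁, hsc] at hw
    have e1 : {x | (2 * ENNReal.ofReal (t / 2)) < ‖kernelConv K f x‖ₑ} = {x | t < ‖kernelConv K f x‖} := by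
      ext x
      simp only [Set.mem_ofPred_eq]
      rw [← ofReal_norm, show (2 : ℝ≥0∞) = ENNReal.ofReal 2 by simp,
        ← ENNReal.ofReal_mul (by norm_num), ENNReal.ofReal_lt_ofReal_iff_of_nonneg (by positivity)]
      ring_nf
    have e2 : {x | ENNReal.ofReal (t / 2) / 2 < ‖f x‖ₑ} = {x | t / 4 < ‖f x‖} := by
      ext x
      simp only [Set.mem_ofPred_eq]
      rw [← ofReal_norm, show (2 : ℝ≥0∞) = ENNReal.ofReal 2 by simp,
        ← ENNReal.ofReal_div_of_pos (by norm_num), ENNReal.ofReal_lt_ofReal_iff_of_nonneg (by positivity)]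
      ring_nf
    have e3 : {x | ‖f x‖ₑ ≤ ENNReal.ofReal (t / 2)} = {x | ‖f x‖ ≤ t / 2} := by
      ext x
      simp only [Set.mem_ofPred_eq]
      rw [← ofReal_norm, ENNReal.ofReal_le_ofReal_iff (by positivity)]
    rw [e1, e2, e3, ← ENNReal.ofReal_inv_of_pos (by positivity)] at hw
    have e4 : ENNReal.ofReal (t / 2)⁻¹ * ENNReal.ofReal (t ^ (p - 1)) =
        2 * ENNReal.ofReal (t ^ (p - 2)) := by
      rw [show (2 : ℝ≥0∞) = ENNReal.ofReal 2 by simp, ← ENNReal.ofReal_mul (by positivity),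
        ← ENNReal.ofReal_mul (by norm_num), show p - 1 = p - 2 + 1 by ring, Real.rpow_add_one ht'.ne']
      congr 1
      field_simp
    have e5 : ENNReal.ofReal (t / 2)⁻¹ ^ 2 * ENNReal.ofReal (t ^ (p - 1)) =
        4 * ENNReal.ofReal (t ^ (p - 3)) := by
      rw [show (4 : ℝ≥0∞) = ENNReal.ofReal 4 by simp, ← ENNReal.ofReal_pow (by positivity),
        ← ENNReal.ofReal_mul (by positivity),
        ← ENNReal.ofReal_mul (by norm_num), show p - 1 = p - 3 + 2 by ring, Real.rpow_add ht',
        Real.rpow_two]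
      congr 1
      field_simp
      norm_num
    calc volume {x | t < ‖kernelConv K f x‖} * ENNReal.ofReal (t ^ (p - 1))
        ≤ _ := mul_le_mul' hw le_rfl
      _ = C₁ * (∫⁻ x in {x | t / 4 < ‖f x‖}, ‖f x‖ₑ) *
            (ENNReal.ofReal (t / 2)⁻¹ * ENNReal.ofReal (t ^ (p - 1))) +
          A * (∫⁻ x in {x | ‖f x‖ ≤ t / 2}, ‖f x‖ₑ ^ 2) *
            (ENNReal.ofReal (t / 2)⁻¹ ^ 2 * ENNReal.ofReal (t ^ (p - 1))) := by ring
      _ = _ := by rw [e4, e5]; ring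
  refine (setLIntegral_mono' measurableSet_Ioi h2).trans ?_
  rw [lintegral_add_left', lintegral_const_mul' _ _ (by finiteness),
    lintegral_const_mul' _ _ (by finiteness), lintegral_Ioi_lintegral_lt hc.measurable hp1, add_mul]
  · refine add_le_add (le_of_eq (by ring)) ?_
    refine (mul_le_mul' le_rfl (lintegral_Ioi_lintegral_le hc.measurable (by linarith) hp2)).trans_eq ?_
    ring
  · refine AEMeasurable.const_mul (AEMeasurable.mul ?_ ?_) _
    · refine Measurable.aemeasurable (Antitone.measurable fun s t hst => ?_)
      exact lintegral_mono_set fun x hx => lt_of_le_of_lt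
        (div_le_div_of_nonneg_right hst (by norm_num)) hx
    · exact (Measurable.pow_const measurable_id _).ennreal_ofReal.aemeasurable

end ConvKernel

/-! ### Duality and the `L^p` bounds for all exponents -/

section ConvKernel

variable {V : Type*} [NormedAddCommGroup V] [InnerProductSpace ℝ V] [FiniteDimensional ℝ V]
  [MeasurableSpace V] [BorelSpace V]

theorem integrable_kernelConv {K g : V → ℂ} (hK : Integrable K) (hg : Integrable g) :
    Integrable (kernelConv K g) := by
  have := hg.integrable_convolution (ContinuousLinearMap.mul ℂ ℂ) hK
  refine this.congr (Filter.Eventually.of_forall fun x => ?_)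
  simp only [MeasureTheory.convolution, kernelConv, ContinuousLinearMap.mul_apply', mul_comm]

theorem norm_kernelConv_le {K g : V → ℂ} {B : ℝ} (hB : ∀ x, ‖g x‖ ≤ B) (hK : Integrable K) (x : V) :
    ‖kernelConv K g x‖ ≤ B * ∫ y, ‖K y‖ := by
  refine (norm_integral_le_integral_norm _).trans ?_
  rw [← integral_sub_left_eq_self (fun y => ‖K y‖) volume x, ← integral_const_mul]
  refine integral_mono_of_nonneg (Filter.Eventually.of_forall fun y => norm_nonneg _)
    ((hK.comp_sub_left x).norm.const_mul B) (Filter.Eventually.of_forall fun y => ?_)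
  simp only [norm_mul]
  rw [mul_comm]
  exact mul_le_mul_of_nonneg_right (hB _) (norm_nonneg _)

theorem IsHormanderKernel.comp_neg {A : ℝ≥0} {K : V → ℂ} (hK : IsHormanderKernel A K) :
    IsHormanderKernel A fun x => K (-x) := by
  refine ⟨hK.continuous.comp continuous_neg, hK.integrable.comp_neg, hK.bounded.imp fun B hB x => hB _,
    fun g hg hgi hgB => ?_, fun y => ?_⟩
  · have h1 : ∀ x, kernelConv (fun x => K (-x)) g x = kernelConv K (fun y => g (-y)) (-x) := by
      intro x
      simp only [kernelConv]
      rw [← integral_neg_eq_self]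
      refine integral_congr_ae (Filter.Eventually.of_forall fun y => ?_)
      simp only
      congr 2
      abel
    simp_rw [h1]
    rw [lintegral_neg_eq_self (fun x => ‖kernelConv K (fun y => g (-y)) x‖ₑ ^ 2),
      ← lintegral_neg_eq_self (fun x => ‖g x‖ₑ ^ 2)]
    exact hK.lintegral_sq_le _ (hg.comp measurable_neg) hgi.comp_neg (hgB.imp fun B hB x => hB _)
  · refine le_trans (le_of_eq ?_) (hK.hormander (-y))
    have hm : ∀ z : V, MeasurableSet {x : V | 2 * ‖z‖ ≤ ‖x‖} := fun z =>
      measurableSet_le measurable_const measurable_norm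
    rw [← lintegral_indicator (hm _), ← lintegral_indicator (hm _), ← lintegral_neg_eq_self]
    refine lintegral_congr fun x => ?_
    simp only [Set.indicator, Set.mem_ofPred_eq, norm_neg, neg_neg, sub_neg_eq_add, neg_sub']

theorem integral_kernelConv_mul {K f h : V → ℂ} (hK : Continuous K) (hKb : ∃ B : ℝ, ∀ x, ‖K x‖ ≤ B)
    (hf : Integrable f) (hh : Integrable h) :
    ∫ x, kernelConv K f x * h x = ∫ y, f y * kernelConv (fun x => K (-x)) h y := by
  obtain ⟨B, hB⟩ := hKb
  have hint : Integrable (Function.uncurry fun x y => K (x - y) * (h x * f y))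
      (volume.prod volume) := by
    refine (hh.mul_prod hf).bdd_mul (c := B) (f := fun z : V × V => K (z.1 - z.2)) ?_
      (Filter.Eventually.of_forall fun z => hB _)
    exact (hK.comp (continuous_fst.sub continuous_snd)).aestronglyMeasurable
  calc ∫ x, kernelConv K f x * h x = ∫ x, ∫ y, K (x - y) * (h x * f y) := by
        refine integral_congr_ae (Filter.Eventually.of_forall fun x => ?_)
        simp only [kernelConv]
        rw [← integral_mul_const]
        refine integral_congr_ae (Filter.Eventually.of_forall fun y => ?_)
        simp only; ring
    _ = ∫ y, ∫ x, K (x - y) * (h x * f y) := integral_integral_swap hint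
    _ = _ := by
        refine integral_congr_ae (Filter.Eventually.of_forall fun y => ?_)
        simp only [kernelConv]
        rw [← integral_const_mul]
        refine integral_congr_ae (Filter.Eventually.of_forall fun x => ?_)
        simp only [neg_sub]; ring

/-- Follows from |f|^p ≤ B^(p-1) |f|. It supplies the a priori finiteness needed to cancel a factor
in the duality argument. -/
theorem lintegral_rpow_ne_top_of_bounded {α : Type*} [MeasurableSpace α] {μ : Measure α} {f : α → ℂ}
    (hf : Integrable f μ) (hb : ∃ B : ℝ, ∀ x, ‖f x‖ ≤ B) {p : ℝ} (hp : 1 ≤ p) :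
    ∫⁻ x, ‖f x‖ₑ ^ p ∂μ ≠ ∞ := by
  obtain ⟨B, hB⟩ := hb
  have h1 : ∀ x, ‖f x‖ₑ ^ p ≤ ENNReal.ofReal B ^ (p - 1) * ‖f x‖ₑ := by
    intro x
    have hle : ‖f x‖ₑ ≤ ENNReal.ofReal B := by
      rw [← ofReal_norm]; exact ENNReal.ofReal_le_ofReal (hB x)
    calc ‖f x‖ₑ ^ p = ‖f x‖ₑ ^ ((p - 1) + 1) := by rw [sub_add_cancel]
      _ = ‖f x‖ₑ ^ (p - 1) * ‖f x‖ₑ := by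
        rw [ENNReal.rpow_add_of_nonneg _ _ (by linarith) zero_le_one, ENNReal.rpow_one]
      _ ≤ _ := mul_le_mul' (ENNReal.rpow_le_rpow hle (by linarith)) le_rfl
  refine ((lintegral_mono h1).trans_lt ?_).ne
  rw [lintegral_const_mul' _ _ (ENNReal.rpow_ne_top_of_nonneg (by linarith) ENNReal.ofReal_ne_top)]
  exact ENNReal.mul_lt_top (ENNReal.rpow_lt_top_of_nonneg (by linarith) ENNReal.ofReal_ne_top) hf.2

/-- For p = 2 this is part of the definition of a Hörmander kernel. For p > 2 the transposed
operator is convolution with the reflected kernel, again a Hörmander kernel with the same constant,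
and the conjugate exponent lies below 2. -/
theorem exists_lintegral_kernelConv_le (hd : 0 < Module.finrank ℝ V) (A : ℝ≥0) {p : ℝ} (hp1 : 1 < p) :
    ∃ C : ℝ≥0, ∀ K : V → ℂ, IsHormanderKernel A K → ∀ f : V → ℂ, Continuous f → Integrable f →
      (∃ B : ℝ, ∀ x, ‖f x‖ ≤ B) → ∫⁻ x, ‖kernelConv K f x‖ₑ ^ p ≤ C * ∫⁻ x, ‖f x‖ₑ ^ p := by
  rcases lt_trichotomy p 2 with hp2 | rfl | hp2
  · obtain ⟨C, hC⟩ := exists_lintegral_kernelConv_le_of_lt_two hd A hp1 hp2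
    exact ⟨C, fun K hK f hc hi _ => hC K hK f hc hi⟩
  · refine ⟨A, fun K hK f hc hi hb => ?_⟩
    simpa using hK.lintegral_sq_le f hc.measurable hi hb
  · set q : ℝ := p / (p - 1) with hq
    have hpq : p.HolderConjugate q := Real.HolderConjugate.conjExponent hp1
    have hq1 : 1 < q := hpq.symm.lt
    have hq2 : q < 2 := by rw [hq, div_lt_iff₀ (by linarith)]; linarith
    obtain ⟨C, hC⟩ := exists_lintegral_kernelConv_le_of_lt_two hd A hq1 hq2
    refine ⟨C ^ (p / q), fun K hK f hc hi hb => ?_⟩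
    set G := kernelConv K f with hG
    have hGc : Continuous G := continuous_kernelConv hK.continuous hK.bounded hi
    have hGi : Integrable G := integrable_kernelConv hK.integrable hi
    have hGb : ∃ B : ℝ, ∀ x, ‖G x‖ ≤ B := hb.imp' (fun B => B * ∫ y, ‖K y‖) fun B hB =>
      norm_kernelConv_le hB hK.integrable
    -- The extremal function in Hölder's inequality: G h = |G|^p and |h|^q = |G|^p. It is continuous
    -- and integrable because p > 2, so the bound for exponent q applies to it.
    set h : V → ℂ := fun x => (starRingEnd ℂ) (G x) * ((‖G x‖ ^ (p - 2) : ℝ) : ℂ) with hh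
    have hrc : Continuous fun x => ‖G x‖ ^ (p - 2) :=
      hGc.norm.rpow_const fun x => Or.inr (by linarith)
    have hhc : Continuous h :=
      (Complex.continuous_conj.comp hGc).mul (Complex.continuous_ofReal.comp hrc)
    have hhn : ∀ x, ‖h x‖ = ‖G x‖ ^ (p - 1) := by
      intro x
      rw [hh, norm_mul, RCLike.norm_conj, Complex.norm_real, Real.norm_of_nonneg (by positivity)]
      rcases (norm_nonneg (G x)).eq_or_lt with h0 | h0
      · rw [← h0, Real.zero_rpow (by linarith : p - 1 ≠ 0), zero_mul]
      · rw [show p - 1 = p - 2 + 1 by ring, Real.rpow_add_one h0.ne', mul_comm]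
    have hhi : Integrable h := by
      obtain ⟨B, hB⟩ := hGb
      have hconj : Integrable fun x => (starRingEnd ℂ) (G x) :=
        (Complex.conjCLE.toContinuousLinearMap.integrable_comp hGi)
      refine hconj.mul_bdd (c := B ^ (p - 2)) (Complex.continuous_ofReal.comp hrc).aestronglyMeasurable
        (Filter.Eventually.of_forall fun x => ?_)
      change ‖((‖G x‖ ^ (p - 2) : ℝ) : ℂ)‖ ≤ _
      rw [Complex.norm_real, Real.norm_of_nonneg (by positivity)]
      exact Real.rpow_le_rpow (norm_nonneg _) (hB x) (by linarith)
    set X := ∫⁻ x, ‖G x‖ₑ ^ p with hX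
    set F := ∫⁻ x, ‖f x‖ₑ ^ p with hF
    have hXt : X ≠ ∞ := lintegral_rpow_ne_top_of_bounded hGi hGb hp1.le
    have hhq : ∫⁻ x, ‖h x‖ₑ ^ q = X := by
      refine lintegral_congr fun x => ?_
      rw [← ofReal_norm, hhn, ← ENNReal.ofReal_rpow_of_nonneg (norm_nonneg _) (by linarith),
        ofReal_norm, ← ENNReal.rpow_mul, hpq.sub_one_mul_conj]
    have hGh : ∫ x, G x * h x = ((∫ x, ‖G x‖ ^ p : ℝ) : ℂ) := by
      rw [← integral_complex_ofReal]
      refine integral_congr_ae (Filter.Eventually.of_forall fun x => ?_)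
      simp only [hh]
      rw [← mul_assoc, Complex.mul_conj, Complex.normSq_eq_norm_sq, ← Complex.ofReal_mul]
      congr 1
      rcases (norm_nonneg (G x)).eq_or_lt with h0 | h0
      · rw [← h0, Real.zero_rpow (by linarith : p ≠ 0)]; simp
      · rw [← Real.rpow_two, ← Real.rpow_add h0]; congr 1; ring
    have hXeq : X = ‖∫ x, G x * h x‖ₑ := by
      rw [hGh, ← ofReal_norm, Complex.norm_real, Real.norm_of_nonneg (by positivity),
        ofReal_integral_eq_lintegral_ofReal]
      · refine lintegral_congr fun x => ?_
        rw [← ofReal_norm, ENNReal.ofReal_rpow_of_nonneg (norm_nonneg _) (by linarith)]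
      · refine ⟨(hGc.norm.rpow_const fun x => Or.inr (by linarith)).aestronglyMeasurable, ?_⟩
        refine lt_of_le_of_lt (le_of_eq (lintegral_congr fun x => ?_)) hXt.lt_top
        rw [← ofReal_norm, Real.norm_of_nonneg (by positivity), ← ofReal_norm,
          ENNReal.ofReal_rpow_of_nonneg (norm_nonneg _) (by linarith)]
      · exact Filter.Eventually.of_forall fun x => by positivity
    have hhK := hC _ hK.comp_neg h hhc hhi
    have hle : X ≤ F ^ (1 / p) * (C * X) ^ (1 / q) := by
      conv_lhs => rw [hXeq]
      rw [hG, integral_kernelConv_mul hK.continuous hK.bounded hi hhi]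
      refine (enorm_integral_le_lintegral_enorm _).trans ?_
      simp_rw [enorm_mul]
      refine (ENNReal.lintegral_mul_le_Lp_mul_Lq volume hpq hc.enorm.aemeasurable
        (continuous_kernelConv hK.comp_neg.continuous hK.comp_neg.bounded hhi).enorm.aemeasurable).trans ?_
      refine mul_le_mul' le_rfl (ENNReal.rpow_le_rpow ?_ (by positivity))
      rwa [hhq] at hhK
    rcases eq_or_ne X 0 with h0 | h0
    · rw [h0]; exact zero_le
    have hq0 : 0 < q := by linarith
    have hp0 : 0 < p := by linarith
    -- X ≤ F^(1/p) (C X)^(1/q) with X finite and nonzero: the factor X^(1/q) cancels, and raising to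
    -- the power p leaves the constant C^(p/q).
    have e1 : X = X ^ (1 / p) * X ^ (1 / q) := by
      rw [← ENNReal.rpow_add _ _ h0 hXt, one_div, one_div, hpq.inv_add_inv_eq_one, ENNReal.rpow_one]
    have hX0' : X ^ (1 / q) ≠ 0 := (ENNReal.rpow_pos (pos_iff_ne_zero.2 h0) hXt).ne'
    have hXt' : X ^ (1 / q) ≠ ∞ := ENNReal.rpow_ne_top_of_nonneg (by positivity) hXt
    have e2 : X ^ (1 / p) ≤ F ^ (1 / p) * C ^ (1 / q) := by
      rw [ENNReal.mul_rpow_of_nonneg _ _ (by positivity : 0 ≤ 1 / q), ← mul_assoc] at hle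
      rw [e1] at hle
      conv_rhs at hle => rw [← e1]
      exact (ENNReal.mul_le_mul_iff_left hX0' hXt').1 hle
    calc X = (X ^ (1 / p)) ^ p := by rw [← ENNReal.rpow_mul, one_div_mul_cancel hp0.ne', ENNReal.rpow_one]
      _ ≤ (F ^ (1 / p) * C ^ (1 / q)) ^ p := ENNReal.rpow_le_rpow e2 hp0.le
      _ = C ^ (p / q) * F := by
        rw [ENNReal.mul_rpow_of_nonneg _ _ hp0.le, ← ENNReal.rpow_mul, ← ENNReal.rpow_mul,
          one_div_mul_cancel hp0.ne', ENNReal.rpow_one, mul_comm]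
        congr 2; field_simp
      _ = _ := by rw [ENNReal.coe_rpow_of_nonneg _ (by positivity)]

end ConvKernel

/-! ### Plancherel for integrable square integrable functions -/

section Plancherel

variable {V : Type*} [NormedAddCommGroup V] [InnerProductSpace ℝ V] [FiniteDimensional ℝ V]
  [MeasurableSpace V] [BorelSpace V]

/-- Both sides pair in the same way with test functions: the L² transform is compatible with that of
tempered distributions, and the integral transform can be moved to the test function. -/
theorem coeFn_fourier_toLp_ae_eq {u : V → ℂ} (hu : Integrable u) (hu2 : MemLp u 2) :
    ((𝓕 (hu2.toLp u) : Lp (α := V) ℂ 2 volume) : V → ℂ) =ᵐ[volume] 𝓕 u := by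
  have hloc : LocallyIntegrable ((𝓕 (hu2.toLp u) : Lp (α := V) ℂ 2 volume) : V → ℂ) :=
    (Lp.memLp _).locallyIntegrable (by norm_num)
  have hcont : Continuous (𝓕 u) :=
    VectorFourier.fourierIntegral_continuous Real.continuous_fourierChar continuous_inner hu
  refine ae_eq_of_integral_contDiff_smul_eq hloc hcont.locallyIntegrable ?_
  intro g hg hc
  have hg' : ContDiff ℝ (⊤ : ℕ∞) (fun x => (g x : ℂ)) := Complex.ofRealCLM.contDiff.comp hg
  have hc' : HasCompactSupport (fun x => (g x : ℂ)) :=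
    hc.comp_left (g := fun r : ℝ => (r : ℂ)) (by simp)
  set ψ : 𝓢(V, ℂ) := hc'.toSchwartzMap hg' with hψ
  have h1 := DFunLike.congr_fun (Lp.fourier_toTemperedDistribution_eq (hu2.toLp u)) ψ
  rw [TemperedDistribution.fourier_apply, Lp.toTemperedDistribution_apply,
    Lp.toTemperedDistribution_apply] at h1
  have h2 : ∫ x, (𝓕 ψ) x • (hu2.toLp u) x = ∫ x, (𝓕 ψ) x • u x :=
    integral_congr_ae (hu2.coeFn_toLp.mono fun x hx => by simp only [hx])
  have h3 : ∫ x, (𝓕 (ψ : V → ℂ)) x • u x = ∫ x, ψ x • (𝓕 u) x :=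
    VectorFourier.integral_fourierIntegral_smul_eq_flip (L := innerₗ V) Real.continuous_fourierChar
      continuous_inner ψ.integrable hu |>.trans (by simp [flip_innerₗ]; rfl)
  rw [h2, fourier_coe, h3] at h1
  simpa [hψ] using h1.symm

theorem lintegral_enorm_fourier_sq {u : V → ℂ} (hu : Integrable u) (hu2 : MemLp u 2) :
    ∫⁻ x, ‖𝓕 u x‖ₑ ^ 2 = ∫⁻ x, ‖u x‖ₑ ^ 2 := by
  have h1 : eLpNorm (𝓕 u) 2 volume = eLpNorm u 2 volume := by
    rw [← eLpNorm_congr_ae (coeFn_fourier_toLp_ae_eq hu hu2), ← Lp.enorm_def, ← Lp.enorm_toLp hu2]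
    simp only [← ofReal_norm, Lp.norm_fourier_eq]
  have h2 : ∀ w : V → ℂ, eLpNorm w 2 volume ^ 2 = ∫⁻ x, ‖w x‖ₑ ^ 2 := fun w => by
    rw [eLpNorm_eq_lintegral_rpow_enorm_toReal (by simp) (by simp)]
    simp only [ENNReal.toReal_ofNat, ENNReal.rpow_two, ← ENNReal.rpow_natCast, ← ENNReal.rpow_mul]
    norm_num
  rw [← h2, ← h2, h1]

theorem lintegral_enorm_fourierInv_sq {u : V → ℂ} (hu : Integrable u) (hu2 : MemLp u 2) :
    ∫⁻ x, ‖𝓕⁻ u x‖ₑ ^ 2 = ∫⁻ x, ‖u x‖ₑ ^ 2 := by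
  rw [← lintegral_enorm_fourier_sq hu hu2, ← lintegral_neg_eq_self]
  simp only [Real.fourierInv_eq_fourier_neg, neg_neg]

theorem memLp_of_integrable_of_bounded {α : Type*} [MeasurableSpace α] {μ : Measure α} {g : α → ℂ}
    (hg : Integrable g μ) (hb : ∃ B : ℝ, ∀ x, ‖g x‖ ≤ B) {p : ℝ≥0∞} (hp1 : 1 ≤ p) (hp : p ≠ ∞) :
    MemLp g p μ := by
  refine ⟨hg.1, (eLpNorm_lt_top_iff_lintegral_rpow_enorm_lt_top (by positivity) hp).2 ?_⟩
  refine (lintegral_rpow_ne_top_of_bounded hg hb ?_).lt_top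
  simpa using ENNReal.toReal_mono hp hp1

/-- Fubini. Convolution with 𝓕 u is the Fourier multiplier operator with symbol u, so a bound for
|u| bounds it on L². -/
theorem kernelConv_fourier {u g : V → ℂ} (hu : Integrable u) (hg : Integrable g) :
    kernelConv (𝓕 u) g = 𝓕 (fun ξ => u ξ * 𝓕⁻ g ξ) := by
  funext x
  set e : V × V → ℂ := fun z => Complex.exp (↑(-2 * Real.pi * inner ℝ z.2 (x - z.1)) * Complex.I)
    with he
  have hec : Continuous e := by rw [he]; fun_prop
  have hen : ∀ z, ‖e z‖ ≤ 1 := fun z => (Complex.norm_exp_ofReal_mul_I _).le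
  have hint : Integrable (Function.uncurry fun y ξ : V => e (y, ξ) * (g y * u ξ))
      (volume.prod volume) :=
    (hg.mul_prod hu).bdd_mul hec.aestronglyMeasurable (Filter.Eventually.of_forall hen)
  calc kernelConv (𝓕 u) g x
      = ∫ y, ∫ ξ, e (y, ξ) * (g y * u ξ) := by
        simp only [kernelConv, Real.fourier_eq', smul_eq_mul]
        refine integral_congr_ae (Filter.Eventually.of_forall fun y => ?_)
        simp only
        rw [← integral_mul_const]
        refine integral_congr_ae (Filter.Eventually.of_forall fun ξ => ?_)
        simp only [he]; ring
    _ = ∫ ξ, ∫ y, e (y, ξ) * (g y * u ξ) :=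
        integral_integral_swap hint
    _ = _ := by
        simp only [Real.fourier_eq', Real.fourierInv_eq', smul_eq_mul]
        refine integral_congr_ae (Filter.Eventually.of_forall fun ξ => ?_)
        simp only
        rw [← integral_const_mul, ← integral_const_mul]
        refine integral_congr_ae (Filter.Eventually.of_forall fun y => ?_)
        simp only [he]
        rw [inner_sub_right, real_inner_comm y ξ, mul_sub, sub_eq_add_neg, Complex.ofReal_add, add_mul,
          Complex.exp_add, show -(-2 * Real.pi * inner ℝ y ξ) = 2 * Real.pi * inner ℝ y ξ by ring]
        ring

theorem lintegral_kernelConv_fourier_sq_le {u g : V → ℂ} (hu : Integrable u) {B : ℝ≥0}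
    (hB : ∀ ξ, ‖u ξ‖ ≤ B) (hg : Integrable g) (hgb : ∃ B : ℝ, ∀ x, ‖g x‖ ≤ B) :
    ∫⁻ x, ‖kernelConv (𝓕 u) g x‖ₑ ^ 2 ≤ (B ^ 2 : ℝ≥0) * ∫⁻ x, ‖g x‖ₑ ^ 2 := by
  have hg2 : MemLp g 2 := memLp_of_integrable_of_bounded hg hgb one_le_two ENNReal.ofNat_ne_top
  have hcont : Continuous (𝓕⁻ g) := by
    have : (𝓕⁻ g) = fun x => 𝓕 g (-x) := funext fun x => Real.fourierInv_eq_fourier_neg g x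
    rw [this]
    exact (VectorFourier.fourierIntegral_continuous Real.continuous_fourierChar continuous_inner
      hg).comp continuous_neg
  have hgn : ∀ ξ, ‖𝓕⁻ g ξ‖ ≤ ∫ x, ‖g x‖ := fun ξ => by
    rw [Real.fourierInv_eq_fourier_neg]
    exact VectorFourier.norm_fourierIntegral_le_integral_norm _ _ _ _ _
  have hi : Integrable fun ξ => u ξ * 𝓕⁻ g ξ :=
    hu.mul_bdd (c := ∫ x, ‖g x‖) hcont.aestronglyMeasurable (Filter.Eventually.of_forall hgn)
  have hb : ∃ D : ℝ, ∀ ξ, ‖u ξ * 𝓕⁻ g ξ‖ ≤ D := ⟨B * ∫ x, ‖g x‖, fun ξ => by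
    rw [norm_mul]
    exact mul_le_mul (hB ξ) (hgn ξ) (norm_nonneg _) B.2⟩
  rw [kernelConv_fourier hu hg, lintegral_enorm_fourier_sq hi
    (memLp_of_integrable_of_bounded hi hb one_le_two ENNReal.ofNat_ne_top),
    ← lintegral_enorm_fourierInv_sq hg hg2, ← lintegral_const_mul' _ _ (by simp)]
  refine lintegral_mono fun ξ => ?_
  simp only
  rw [enorm_mul, mul_pow, ENNReal.coe_pow]
  gcongr
  exact_mod_cast hB ξ

end Plancherel

/-! ### Littlewood-Paley pieces of Mikhlin multipliers -/

section Mikhlin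

variable {V : Type*} [NormedAddCommGroup V] [InnerProductSpace ℝ V]

/-- `m` satisfies the Mikhlin condition of order `l` with constant `B`. -/
structure IsMikhlin (l : ℕ) (B : ℝ) (m : V → ℂ) : Prop where
  contDiffOn : ContDiffOn ℝ l m {0}ᶜ
  norm_iteratedFDeriv_le : ∀ k ≤ l, ∀ ξ, ξ ≠ 0 → ‖iteratedFDeriv ℝ k m ξ‖ ≤ B * (‖ξ‖ ^ k)⁻¹

theorem IsMikhlin.norm_le {l : ℕ} {B : ℝ} {m : V → ℂ} (hm : IsMikhlin l B m) {ξ : V} (hξ : ξ ≠ 0) :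
    ‖m ξ‖ ≤ B := by
  simpa using hm.norm_iteratedFDeriv_le 0 (Nat.zero_le _) ξ hξ

/-- The Mikhlin condition is scale invariant with the same constant, so every dyadic annulus can be
moved to the unit one. The case s = -1 gives reflections. -/
theorem IsMikhlin.comp_smul {l : ℕ} {B : ℝ} {m : V → ℂ} (hm : IsMikhlin l B m) {s : ℝ} (hs : s ≠ 0) :
    IsMikhlin l B fun ξ => m (s • ξ) := by
  refine ⟨hm.contDiffOn.comp (contDiff_const_smul s).contDiffOn fun ξ hξ => ?_, fun k hk ξ hξ => ?_⟩
  · simpa [hs] using hξ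
  · set g : V ≃L[ℝ] V := ContinuousLinearEquiv.smulLeft (Units.mk0 s hs) with hg
    have hgs : ∀ x, g x = s • x := fun x => rfl
    have h1 := g.iteratedFDerivWithin_comp_right m uniqueDiffOn_univ (x := ξ) (Set.mem_univ _) k
    simp only [Set.preimage_univ, iteratedFDerivWithin_univ] at h1
    have h2 : m ∘ g = fun ξ => m (s • ξ) := rfl
    rw [← h2, h1]
    refine (ContinuousMultilinearMap.norm_compContinuousLinearMap_le _ _).trans ?_
    have hgn : ‖(g : V →L[ℝ] V)‖ ≤ |s| :=
      ContinuousLinearMap.opNorm_le_bound _ (abs_nonneg _) fun x => by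
        change ‖s • x‖ ≤ _
        rw [norm_smul, Real.norm_eq_abs]
    have hb := hm.norm_iteratedFDeriv_le k hk (g ξ) (by rw [hgs]; exact smul_ne_zero hs hξ)
    have hs' : 0 < |s| := abs_pos.2 hs
    have hξ' : 0 < ‖ξ‖ := norm_pos_iff.2 hξ
    rw [hgs, norm_smul, Real.norm_eq_abs] at hb
    calc _ ≤ B * ((|s| * ‖ξ‖) ^ k)⁻¹ * |s| ^ k := by
          refine mul_le_mul hb ?_ (by positivity) ((norm_nonneg _).trans hb)
          rw [Finset.prod_const, Finset.card_univ, Fintype.card_fin]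
          exact pow_le_pow_left₀ (norm_nonneg _) hgn k
      _ = B * (‖ξ‖ ^ k)⁻¹ := by rw [mul_pow]; field_simp

variable [FiniteDimensional ℝ V]

variable (V) in
/-- A smooth bump function that is `1` on the unit ball and supported in the ball of radius `2`. -/
noncomputable def unitBump : ContDiffBump (0 : V) := ⟨1, 2, one_pos, one_lt_two⟩

/-- A smooth function supported in an annulus, whose dilates sum up telescopically. -/
noncomputable def annulusBump (ξ : V) : ℂ := (unitBump V ((2 : ℝ)⁻¹ • ξ) - unitBump V ξ : ℝ)

theorem contDiff_annulusBump {n : ℕ∞} : ContDiff ℝ n (annulusBump : V → ℂ) :=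
  Complex.ofRealCLM.contDiff.comp
    (((unitBump V).contDiff.comp (contDiff_const_smul _)).sub (unitBump V).contDiff)

theorem annulusBump_eq_zero_of_norm_le {ξ : V} (h : ‖ξ‖ ≤ 1) : annulusBump ξ = 0 := by
  have h1 : unitBump V ξ = 1 := (unitBump V).one_of_mem_closedBall (by simpa [unitBump] using h)
  have h2 : unitBump V ((2 : ℝ)⁻¹ • ξ) = 1 := by
    refine (unitBump V).one_of_mem_closedBall ?_
    simp only [unitBump, Metric.mem_closedBall, dist_zero_right, norm_smul, norm_inv, Real.norm_ofNat]
    linarith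
  simp [annulusBump, h1, h2]

theorem annulusBump_eq_zero_of_le_norm {ξ : V} (h : 4 ≤ ‖ξ‖) : annulusBump ξ = 0 := by
  have h1 : unitBump V ξ = 0 := (unitBump V).zero_of_le_dist (by
    simp only [unitBump, dist_zero_right]; linarith)
  have h2 : unitBump V ((2 : ℝ)⁻¹ • ξ) = 0 := by
    refine (unitBump V).zero_of_le_dist ?_
    simp only [unitBump, dist_zero_right, norm_smul, norm_inv, Real.norm_ofNat]
    linarith
  simp [annulusBump, h1, h2]

theorem IsMikhlin.contDiff_annulusBump_mul {l : ℕ} {B : ℝ} {m : V → ℂ} (hm : IsMikhlin l B m) :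
    ContDiff ℝ l fun ξ => annulusBump ξ * m ξ := by
  rw [contDiff_iff_contDiffAt]
  intro ξ
  rcases eq_or_ne ξ 0 with rfl | hξ
  · refine (contDiffAt_const (c := (0 : ℂ))).congr_of_eventuallyEq ?_
    filter_upwards [Metric.ball_mem_nhds (0 : V) one_pos] with ξ hξ
    rw [annulusBump_eq_zero_of_norm_le (by simpa using (Metric.mem_ball.1 hξ).le), zero_mul]
  · exact (contDiff_annulusBump (n := l)).contDiffAt.mul
      (hm.contDiffOn.contDiffAt (isOpen_compl_singleton.mem_nhds hξ))

theorem support_annulusBump_mul (m : V → ℂ) :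
    Function.support (fun ξ => annulusBump ξ * m ξ) ⊆ Metric.closedBall 0 4 := by
  intro ξ hξ
  by_contra h
  rw [mem_closedBall_zero_iff, not_le] at h
  exact hξ (by simp [annulusBump_eq_zero_of_le_norm h.le])

theorem tsupport_annulusBump_mul (m : V → ℂ) :
    tsupport (fun ξ => annulusBump ξ * m ξ) ⊆ Metric.closedBall 0 4 :=
  closure_minimal (support_annulusBump_mul m) Metric.isClosed_closedBall

theorem hasCompactSupport_annulusBump_mul (m : V → ℂ) :
    HasCompactSupport fun ξ => annulusBump ξ * m ξ :=
  (isCompact_closedBall (0 : V) 4).of_isClosed_subset isClosed_closure (tsupport_annulusBump_mul m)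

variable (V) in
theorem exists_norm_iteratedFDeriv_annulusBump_le (i : ℕ) :
    ∃ D : ℝ, ∀ ξ : V, ‖iteratedFDeriv ℝ i (annulusBump : V → ℂ) ξ‖ ≤ D := by
  have h1 : HasCompactSupport (annulusBump : V → ℂ) := by
    have h := hasCompactSupport_annulusBump_mul (fun _ : V => (1 : ℂ))
    simp only [mul_one] at h
    exact h
  have h2 : Continuous (iteratedFDeriv ℝ i (annulusBump : V → ℂ)) :=
    (contDiff_annulusBump (n := i)).continuous_iteratedFDeriv (m := i) (by exact_mod_cast le_rfl)
  exact h2.bounded_above_of_compact_support (h1.iteratedFDeriv (𝕜 := ℝ) i)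

variable (V) in
-- Leibniz' rule: the bump vanishes on the unit ball, and outside it the factors ‖ξ‖^(-k) are at
-- most one. The point is that the constant does not depend on m.
theorem exists_norm_iteratedFDeriv_annulusBump_mul_le (l : ℕ) (B : ℝ) :
    ∃ C : ℝ, 0 ≤ C ∧ ∀ m : V → ℂ, IsMikhlin l B m → ∀ k ≤ l, ∀ ξ,
      ‖iteratedFDeriv ℝ k (fun ξ => annulusBump ξ * m ξ) ξ‖ ≤ C := by
  choose D hD using exists_norm_iteratedFDeriv_annulusBump_le V
  have hD0 : ∀ i, 0 ≤ D i := fun i => (norm_nonneg _).trans (hD i 0)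
  set B' := max B 0
  set C : ℝ := ∑ k ∈ Finset.range (l + 1), ∑ i ∈ Finset.range (k + 1), k.choose i * D i * B' with hC
  have hC0 : ∀ k, 0 ≤ ∑ i ∈ Finset.range (k + 1), k.choose i * D i * B' := fun k =>
    Finset.sum_nonneg fun i _ => mul_nonneg (mul_nonneg (Nat.cast_nonneg _) (hD0 i)) (le_max_right _ _)
  refine ⟨C, Finset.sum_nonneg fun k _ => hC0 k, fun m hm k hk ξ => ?_⟩
  rcases lt_or_ge ‖ξ‖ 1 with hξ | hξ
  · have : (fun ξ => annulusBump ξ * m ξ) =ᶠ[nhds ξ] fun _ => 0 := by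
      filter_upwards [(isOpen_lt continuous_norm continuous_const).mem_nhds hξ] with η hη
      rw [annulusBump_eq_zero_of_norm_le (le_of_lt hη), zero_mul]
    rw [(this.iteratedFDeriv ℝ k).eq_of_nhds]
    simp only [iteratedFDeriv_fun_zero, Pi.zero_apply, norm_zero]
    exact Finset.sum_nonneg fun k _ => hC0 k
  · have hξ0 : ξ ∈ ({0}ᶜ : Set V) := fun h => by
      rw [Set.mem_singleton_iff.1 h, norm_zero] at hξ; linarith
    have hkl : ((k : ℕ∞) : WithTop ℕ∞) ≤ ((l : ℕ∞) : WithTop ℕ∞) := by exact_mod_cast hk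
    have h2 := norm_iteratedFDerivWithin_mul_le (contDiff_annulusBump (n := l)).contDiffOn
      hm.contDiffOn isOpen_compl_singleton.uniqueDiffOn hξ0 hkl
    have h3 : ∀ (j : ℕ) (f : V → ℂ), iteratedFDerivWithin ℝ j f {0}ᶜ ξ = iteratedFDeriv ℝ j f ξ :=
      fun j f => iteratedFDerivWithin_of_isOpen j isOpen_compl_singleton hξ0
    simp only [h3] at h2
    refine h2.trans ((Finset.sum_le_sum (g := fun i => k.choose i * D i * B') fun i hi => ?_).trans ?_)
    · refine mul_le_mul (mul_le_mul_of_nonneg_left (hD i ξ) (Nat.cast_nonneg _)) ?_ (norm_nonneg _)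
        (mul_nonneg (Nat.cast_nonneg _) (hD0 i))
      refine (hm.norm_iteratedFDeriv_le (k - i) ((Nat.sub_le _ _).trans hk) ξ hξ0).trans ?_
      calc B * (‖ξ‖ ^ (k - i))⁻¹ ≤ B' * (‖ξ‖ ^ (k - i))⁻¹ :=
            mul_le_mul_of_nonneg_right (le_max_left _ _) (by positivity)
        _ ≤ B' * 1 := mul_le_mul_of_nonneg_left (inv_le_one_of_one_le₀ (one_le_pow₀ hξ)) (le_max_right _ _)
        _ = B' := mul_one _
    · exact Finset.single_le_sum (f := fun k => ∑ i ∈ Finset.range (k + 1), k.choose i * D i * B')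
        (fun k _ => hC0 k) (Finset.mem_range.2 (Nat.lt_succ_of_le hk))

variable [MeasurableSpace V] [BorelSpace V]

variable (V) in
-- Bounds on l derivatives of a function supported in a fixed ball become decay of order l of its
-- Fourier transform. The gradient decays equally well, since the extra factor ‖ξ‖ is bounded on the
-- support.
theorem exists_norm_fourier_annulusBump_mul_le (l : ℕ) (B : ℝ) :
    ∃ C : ℝ, 0 ≤ C ∧ ∀ m : V → ℂ, IsMikhlin l B m →
      ContDiff ℝ 1 (𝓕 fun ξ => annulusBump ξ * m ξ) ∧
      ∀ k ≤ 1, ∀ x, (1 + ‖x‖) ^ l * ‖iteratedFDeriv ℝ k (𝓕 fun ξ => annulusBump ξ * m ξ) x‖ ≤ C := by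
  obtain ⟨C, hC0, hC⟩ := exists_norm_iteratedFDeriv_annulusBump_mul_le V l B
  set v : ℝ := volume.real (Metric.closedBall (0 : V) 4) with hv
  set D : ℕ → ℕ → ℝ := fun k n => (2 * Real.pi) ^ k * (2 * k + 2) ^ n *
      ∑ p ∈ Finset.range (k + 1) ×ˢ Finset.range (n + 1), 4 ^ p.1 * C * v with hD
  have hD0 : ∀ k n, 0 ≤ D k n := fun k n => by positivity
  refine ⟨∑ k ∈ Finset.range 2, 2 ^ l * (D k 0 + D k l),
    Finset.sum_nonneg fun k _ => mul_nonneg (by positivity) (add_nonneg (hD0 _ _) (hD0 _ _)),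
    fun m hm => ?_⟩
  set f : V → ℂ := fun ξ => annulusBump ξ * m ξ with hf
  have hfs : ContDiff ℝ l f := hm.contDiff_annulusBump_mul
  have hfc : HasCompactSupport f := hasCompactSupport_annulusBump_mul m
  have hsupp : ∀ (n : ℕ) v, v ∉ Metric.closedBall (0 : V) 4 → iteratedFDeriv ℝ n f v = 0 := by
    intro n v hv
    by_contra h
    exact hv (tsupport_annulusBump_mul m (tsupport_iteratedFDeriv_subset (𝕜 := ℝ) n
      (subset_tsupport _ h)))
  have hint : ∀ k n : ℕ, n ≤ l → Integrable (fun v ↦ ‖v‖ ^ k * ‖iteratedFDeriv ℝ n f v‖) := by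
    intro k n hn
    refine Continuous.integrable_of_hasCompactSupport ?_ ?_
    · exact (continuous_norm.pow k).mul (hfs.continuous_iteratedFDeriv (by exact_mod_cast hn)).norm
    · exact (hfc.iteratedFDeriv (𝕜 := ℝ) n).norm.mul_left
  have hval : ∀ k n : ℕ, n ≤ l → ∫ v, ‖v‖ ^ k * ‖iteratedFDeriv ℝ n f v‖ ≤ 4 ^ k * C * v := by
    intro k n hn
    calc ∫ v, ‖v‖ ^ k * ‖iteratedFDeriv ℝ n f v‖
        ≤ ∫ v, (Metric.closedBall (0 : V) 4).indicator (fun _ => 4 ^ k * C) v := by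
          refine integral_mono (hint k n hn) ?_ fun w => ?_
          · exact (integrable_indicator_iff measurableSet_closedBall).2
              (integrableOn_const (measure_closedBall_lt_top).ne)
          · by_cases hw : w ∈ Metric.closedBall (0 : V) 4
            · rw [Set.indicator_of_mem hw]
              refine mul_le_mul (pow_le_pow_left₀ (norm_nonneg _) (mem_closedBall_zero_iff.1 hw) k)
                (hC m hm n hn w) (norm_nonneg _) (by positivity)
            · rw [Set.indicator_of_notMem hw]
              simp [hsupp n w hw]
      _ = 4 ^ k * C * v := by
          rw [integral_indicator measurableSet_closedBall, setIntegral_const, smul_eq_mul, mul_comm]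
  have hcd : ContDiff ℝ 1 (𝓕 f) := by
    have := Real.contDiff_fourier (f := f) (N := 1) fun n hn => by
      simpa using hint n 0 (Nat.zero_le _)
    exact_mod_cast this
  have hb : ∀ k n : ℕ, n ≤ l → ∀ x, ‖x‖ ^ n * ‖iteratedFDeriv ℝ k (𝓕 f) x‖ ≤ D k n := by
    intro k n hn x
    have h1 := Real.pow_mul_norm_iteratedFDeriv_fourier_le (K := ⊤) (N := l) (f := f)
      (by exact_mod_cast hfs) (fun k n _ hn => hint k n (by exact_mod_cast hn)) (k := k) (n := n) le_top
      (by exact_mod_cast hn) x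
    refine h1.trans (mul_le_mul_of_nonneg_left (Finset.sum_le_sum fun p hp => ?_) (by positivity))
    refine hval p.1 p.2 ?_
    have := (Finset.mem_product.1 hp).2
    rw [Finset.mem_range] at this
    omega
  refine ⟨hcd, fun k hk x => ?_⟩
  have h2 : (1 + ‖x‖) ^ l ≤ 2 ^ l * (1 + ‖x‖ ^ l) := by
    have hx := norm_nonneg x
    calc (1 + ‖x‖) ^ l ≤ (2 * max 1 ‖x‖) ^ l := by
          refine pow_le_pow_left₀ (by positivity) ?_ l
          linarith [le_max_left 1 ‖x‖, le_max_right 1 ‖x‖]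
      _ = 2 ^ l * (max 1 ‖x‖) ^ l := mul_pow _ _ _
      _ ≤ _ := by
        refine mul_le_mul_of_nonneg_left ?_ (by positivity)
        rcases max_cases 1 ‖x‖ with h | h <;> rw [h.1]
        · rw [one_pow]; linarith [pow_nonneg hx l]
        · linarith
  calc (1 + ‖x‖) ^ l * ‖iteratedFDeriv ℝ k (𝓕 f) x‖
      ≤ 2 ^ l * (1 + ‖x‖ ^ l) * ‖iteratedFDeriv ℝ k (𝓕 f) x‖ :=
        mul_le_mul_of_nonneg_right h2 (norm_nonneg _)
    _ = 2 ^ l * (‖x‖ ^ 0 * ‖iteratedFDeriv ℝ k (𝓕 f) x‖ + ‖x‖ ^ l * ‖iteratedFDeriv ℝ k (𝓕 f) x‖) := by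
        ring
    _ ≤ 2 ^ l * (D k 0 + D k l) := by
        refine mul_le_mul_of_nonneg_left (add_le_add (hb k 0 (Nat.zero_le _) x) (hb k l le_rfl x))
          (by positivity)
    _ ≤ _ := Finset.single_le_sum (f := fun k => 2 ^ l * (D k 0 + D k l))
        (fun k _ => mul_nonneg (by positivity) (add_nonneg (hD0 _ _) (hD0 _ _)))
        (Finset.mem_range.2 (by omega))

end Mikhlin

/-! ### The Hörmander condition for truncated Mikhlin multipliers -/

section Hormander

variable {V : Type*} [NormedAddCommGroup V] [InnerProductSpace ℝ V] [FiniteDimensional ℝ V]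

omit [FiniteDimensional ℝ V] in
-- On the ball of radius ‖z‖ around u one has 1 + ‖x‖ ≥ (1 + ‖u‖)/2, so k and its gradient are at
-- most E there. The mean value inequality gives E‖z‖, good for small z; the triangle inequality
-- gives 2E, good for large z. The minimum is what makes the dyadic scales summable.
theorem norm_sub_le_of_decay {C : ℝ} {n : ℕ} {k : V → ℂ} (hk : ContDiff ℝ 1 k)
    (hC : ∀ j ≤ 1, ∀ x, (1 + ‖x‖) ^ (n + 1) * ‖iteratedFDeriv ℝ j k x‖ ≤ C) {u z : V} (hz : z ≠ 0)
    (huz : 2 * ‖z‖ ≤ ‖u‖) :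
    ‖k (u - z) - k u‖ ≤ 2 ^ (n + 2) * C * min ‖z‖ ‖z‖⁻¹ * ((1 + ‖u‖) ^ n)⁻¹ := by
  have hz0 : 0 < ‖z‖ := norm_pos_iff.2 hz
  have hu0 : 0 < 1 + ‖u‖ := by positivity
  have hu1 : (1 : ℝ) ≤ 1 + ‖u‖ := by linarith [norm_nonneg u]
  have hC0 : 0 ≤ C := le_trans (by positivity) (hC 0 zero_le_one 0)
  set E := 2 ^ (n + 1) * C * ((1 + ‖u‖) ^ (n + 1))⁻¹ with hE
  have hE0 : 0 ≤ E := by positivity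
  have hbd : ∀ j ≤ 1, ∀ x, ‖u‖ - ‖z‖ ≤ ‖x‖ → ‖iteratedFDeriv ℝ j k x‖ ≤ E := by
    intro j hj x hx
    have h1 : (1 + ‖u‖) / 2 ≤ 1 + ‖x‖ := by linarith
    have h2 : ((1 + ‖u‖) / 2) ^ (n + 1) ≤ (1 + ‖x‖) ^ (n + 1) := pow_le_pow_left₀ (by positivity) h1 _
    have h3 := (mul_le_mul_of_nonneg_right h2 (norm_nonneg (iteratedFDeriv ℝ j k x))).trans (hC j hj x)
    rw [div_pow, div_mul_eq_mul_div, div_le_iff₀ (by positivity)] at h3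
    rw [hE, ← div_eq_mul_inv, le_div_iff₀ (by positivity)]
    linarith
  have hEn : E ≤ 2 ^ (n + 1) * C * ((1 + ‖u‖) ^ n)⁻¹ := by
    refine mul_le_mul_of_nonneg_left (inv_anti₀ (by positivity) ?_) (by positivity)
    exact pow_le_pow_right₀ hu1 (Nat.le_succ n)
  -- One of the n + 1 powers of decay is traded for ‖z‖⁻¹, using ‖z‖ ≤ 1 + ‖u‖.
  have hEz : E ≤ 2 ^ (n + 1) * C * ‖z‖⁻¹ * ((1 + ‖u‖) ^ n)⁻¹ := by
    rw [hE, pow_succ (1 + ‖u‖), mul_inv, mul_assoc, mul_assoc, mul_assoc,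
      mul_comm ((1 + ‖u‖) ^ n)⁻¹]
    have : (1 + ‖u‖)⁻¹ ≤ ‖z‖⁻¹ := inv_anti₀ hz0 (by linarith)
    gcongr
  have hA : ‖k (u - z) - k u‖ ≤ E * ‖z‖ := by
    have := (convex_closedBall u ‖z‖).norm_image_sub_le_of_norm_fderiv_le (𝕜 := ℝ) (f := k) (C := E)
      (x := u) (y := u - z) (fun x _ => (hk.differentiable one_ne_zero) x) (fun x hx => ?_)
      (Metric.mem_closedBall_self hz0.le) (by simp)
    · simpa using this
    · rw [← norm_iteratedFDeriv_one]
      refine hbd 1 le_rfl x ?_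
      have h4 : ‖u - x‖ ≤ ‖z‖ := by rw [← dist_eq_norm, dist_comm]; exact hx
      linarith [norm_sub_norm_le u x]
  have hB : ‖k (u - z) - k u‖ ≤ 2 * E := by
    have h5 := hbd 0 zero_le_one (u - z) (norm_sub_norm_le u z)
    have h6 := hbd 0 zero_le_one u (by linarith)
    rw [norm_iteratedFDeriv_zero] at h5 h6
    linarith [norm_sub_le (k (u - z)) (k u)]
  rcases min_cases ‖z‖ ‖z‖⁻¹ with h | h <;> rw [h.1]
  · calc _ ≤ E * ‖z‖ := hA
      _ ≤ 2 ^ (n + 1) * C * ((1 + ‖u‖) ^ n)⁻¹ * ‖z‖ := mul_le_mul_of_nonneg_right hEn hz0.le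
      _ ≤ 2 * (2 ^ (n + 1) * C * ((1 + ‖u‖) ^ n)⁻¹ * ‖z‖) := by
          have : 0 ≤ 2 ^ (n + 1) * C * ((1 + ‖u‖) ^ n)⁻¹ * ‖z‖ := by positivity
          linarith
      _ = _ := by ring
  · calc _ ≤ 2 * E := hB
      _ ≤ 2 * (2 ^ (n + 1) * C * ‖z‖⁻¹ * ((1 + ‖u‖) ^ n)⁻¹) := by linarith
      _ = _ := by ring

/-- The increment of s/(1 + s) under doubling is comparable to min(s, 1/s), so the sum over dyadic
scales telescopes and is bounded independently of its length. -/
theorem min_inv_le_telescope {s : ℝ} (hs : 0 < s) :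
    min s s⁻¹ ≤ 6 * (2 * s / (1 + 2 * s) - s / (1 + s)) := by
  have h1 : 2 * s / (1 + 2 * s) - s / (1 + s) = s / ((1 + s) * (1 + 2 * s)) := by field_simp; ring
  rw [h1, mul_div_assoc', le_div_iff₀ (by positivity)]
  rcases le_total s 1 with h | h
  · refine (mul_le_mul_of_nonneg_right (min_le_left _ _) (by positivity)).trans ?_
    have : (1 + s) * (1 + 2 * s) ≤ 6 := by nlinarith
    nlinarith
  · refine (mul_le_mul_of_nonneg_right (min_le_right _ _) (by positivity)).trans ?_
    rw [inv_mul_le_iff₀ hs]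
    nlinarith

theorem sum_min_inv_le {r : ℝ} (hr : 0 < r) (n : ℕ) :
    ∑ i ∈ Finset.range n, min (2 ^ i * r) (2 ^ i * r)⁻¹ ≤ 6 := by
  have h1 : ∀ i ∈ Finset.range n, min (2 ^ i * r) (2 ^ i * r)⁻¹ ≤
      6 * (2 ^ (i + 1) * r / (1 + 2 ^ (i + 1) * r) - 2 ^ i * r / (1 + 2 ^ i * r)) := by
    intro i _
    have := min_inv_le_telescope (s := 2 ^ i * r) (by positivity)
    rwa [show 2 * (2 ^ i * r) = 2 ^ (i + 1) * r by ring] at this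
  refine (Finset.sum_le_sum h1).trans ?_
  rw [← Finset.mul_sum, Finset.sum_range_sub fun i => (2 : ℝ) ^ i * r / (1 + 2 ^ i * r)]
  have h2 : (2 : ℝ) ^ n * r / (1 + 2 ^ n * r) ≤ 1 := by
    rw [div_le_one (by positivity)]; linarith
  have h3 : 0 ≤ (2 : ℝ) ^ 0 * r / (1 + 2 ^ 0 * r) := by positivity
  linarith

/-- The truncation of a multiplier to frequencies between `2 ^ (-N)` and `2 ^ N`. -/
noncomputable def truncMultiplier (m : V → ℂ) (N : ℕ) (ξ : V) : ℂ :=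
  ∑ i ∈ Finset.range (2 * N), annulusBump (((2 : ℝ) ^ i / 2 ^ N)⁻¹ • ξ) * m ξ

/-- The annular bumps telescope to a difference of two bumps with values in [0, 1]. This gives the
uniform bound for the truncation, and shows that at each ξ ≠ 0 it is eventually equal to m. -/
theorem truncMultiplier_eq (m : V → ℂ) (N : ℕ) (ξ : V) :
    truncMultiplier m N ξ =
      ((unitBump V (((2 : ℝ) ^ N)⁻¹ • ξ) - unitBump V ((2 : ℝ) ^ N • ξ) : ℝ) : ℂ) * m ξ := by
  rw [truncMultiplier, ← Finset.sum_mul]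
  congr 1
  have h : ∀ i ∈ Finset.range (2 * N), annulusBump (((2 : ℝ) ^ i / 2 ^ N)⁻¹ • ξ) =
      (unitBump V (((2 : ℝ) ^ (i + 1) / 2 ^ N)⁻¹ • ξ) : ℂ) -
        (unitBump V (((2 : ℝ) ^ i / 2 ^ N)⁻¹ • ξ) : ℂ) := by
    intro i _
    rw [annulusBump, Complex.ofReal_sub, smul_smul]
    congr 4
    rw [pow_succ]; field_simp
  rw [Finset.sum_congr rfl h,
    Finset.sum_range_sub fun i => (unitBump V (((2 : ℝ) ^ i / 2 ^ N)⁻¹ • ξ) : ℂ), Complex.ofReal_sub]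
  congr 4
  · rw [two_mul, pow_add]; field_simp
  · simp

theorem norm_truncMultiplier_le {l : ℕ} {B : ℝ≥0} {m : V → ℂ} (hm : IsMikhlin l B m) (N : ℕ) (ξ : V) :
    ‖truncMultiplier m N ξ‖ ≤ B := by
  rcases eq_or_ne ξ 0 with rfl | hξ
  · rw [truncMultiplier_eq]; simp
  · rw [truncMultiplier_eq, norm_mul, Complex.norm_real, Real.norm_eq_abs]
    refine (mul_le_mul (abs_sub_le_of_nonneg_of_le (unitBump V).nonneg (unitBump V).le_one
      (unitBump V).nonneg (unitBump V).le_one) (hm.norm_le hξ) (norm_nonneg _) zero_le_one).trans ?_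
    rw [one_mul]

theorem tendsto_truncMultiplier (m : V → ℂ) {ξ : V} (hξ : ξ ≠ 0) :
    Filter.Tendsto (fun N => truncMultiplier m N ξ) Filter.atTop (nhds (m ξ)) := by
  have hξ0 : 0 < ‖ξ‖ := norm_pos_iff.2 hξ
  refine tendsto_const_nhds.congr' ?_
  have hp : Filter.Tendsto (fun N : ℕ => (2 : ℝ) ^ N) Filter.atTop Filter.atTop :=
    tendsto_pow_atTop_atTop_of_one_lt one_lt_two
  filter_upwards [hp.eventually_ge_atTop ‖ξ‖, hp.eventually_ge_atTop (2 / ‖ξ‖)] with N h1 h2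
  have h3 : unitBump V (((2 : ℝ) ^ N)⁻¹ • ξ) = 1 := by
    refine (unitBump V).one_of_mem_closedBall ?_
    simp only [unitBump, Metric.mem_closedBall, dist_zero_right, norm_smul, norm_inv, norm_pow,
      Real.norm_ofNat]
    rw [inv_mul_le_iff₀ (by positivity), mul_one]
    exact h1
  have h4 : unitBump V ((2 : ℝ) ^ N • ξ) = 0 := by
    refine (unitBump V).zero_of_le_dist ?_
    simp only [unitBump, dist_zero_right, norm_smul, norm_pow, Real.norm_ofNat]
    rwa [div_le_iff₀ hξ0] at h2
  rw [truncMultiplier_eq, h3, h4]; simp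

variable [MeasurableSpace V] [BorelSpace V]

theorem lintegral_comp_smul {f : V → ℝ≥0∞} (hf : Measurable f) {s : ℝ} (hs : 0 < s) :
    ENNReal.ofReal (s ^ Module.finrank ℝ V) * ∫⁻ x, f (s • x) = ∫⁻ x, f x := by
  have h := Measure.map_addHaar_smul (volume : Measure V) hs.ne'
  rw [← lintegral_map hf (measurable_const_smul s), h, lintegral_smul_measure, smul_eq_mul, ← mul_assoc,
    ← ENNReal.ofReal_mul (by positivity), abs_of_pos (by positivity), mul_inv_cancel₀ (by positivity),
    ENNReal.ofReal_one, one_mul]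

theorem fourier_comp_inv_smul (f : V → ℂ) {s : ℝ} (hs : 0 < s) (x : V) :
    𝓕 (fun ξ => f (s⁻¹ • ξ)) x = (s ^ Module.finrank ℝ V : ℝ) * 𝓕 f (s • x) := by
  rw [Real.fourier_eq', Real.fourier_eq']
  have h := Measure.integral_comp_inv_smul (volume : Measure V)
    (fun η => Complex.exp (↑(-2 * Real.pi * inner ℝ η (s • x)) * Complex.I) • f η) s
  rw [abs_of_pos (by positivity), Complex.real_smul] at h
  rw [← h]
  refine integral_congr_ae (Filter.Eventually.of_forall fun ξ => ?_)
  simp only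
  rw [real_inner_smul_left, real_inner_smul_right, inv_mul_cancel_left₀ hs.ne']

/-- Substitution u = s x: an L¹-normalized dilation merely replaces y by s y in Hörmander's
integral. -/
theorem lintegral_hormander_dilation {k : V → ℂ} (hk : Continuous k) {s : ℝ} (hs : 0 < s) (y : V) :
    ∫⁻ x in {x | 2 * ‖y‖ ≤ ‖x‖}, ‖((s ^ Module.finrank ℝ V : ℝ) : ℂ) * k (s • (x - y)) -
      ((s ^ Module.finrank ℝ V : ℝ) : ℂ) * k (s • x)‖ₑ =
    ∫⁻ u in {u | 2 * ‖s • y‖ ≤ ‖u‖}, ‖k (u - s • y) - k u‖ₑ := by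
  have hm : ∀ z : V, MeasurableSet {x : V | 2 * ‖z‖ ≤ ‖x‖} := fun z =>
    measurableSet_le measurable_const measurable_norm
  have hmf : Measurable fun u => ‖k (u - s • y) - k u‖ₑ := by
    have := hk.measurable
    fun_prop
  rw [← lintegral_indicator (hm _), ← lintegral_indicator (hm _),
    ← lintegral_comp_smul (hmf.indicator (hm _)) hs, ← lintegral_const_mul' _ _ (by simp)]
  refine lintegral_congr fun x => ?_
  have h1 : 2 * ‖s • y‖ ≤ ‖s • x‖ ↔ 2 * ‖y‖ ≤ ‖x‖ := by
    rw [norm_smul, norm_smul, mul_left_comm]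
    exact mul_le_mul_iff_right₀ (norm_pos_iff.2 hs.ne')
  simp only [Set.indicator, Set.mem_ofPred_eq, h1]
  split_ifs
  · rw [← mul_sub, enorm_mul, smul_sub]
    congr 1
    rw [← ofReal_norm, Complex.norm_real, Real.norm_of_nonneg (by positivity)]
  · simp

variable (V) in
-- Of the d + 2 powers of decay, one pays for the factor ‖z‖⁻¹ in the pointwise bound; the remaining
-- d + 1 make it integrable.
theorem exists_lintegral_hormander_le (C : ℝ) :
    ∃ A : ℝ≥0, ∀ k : V → ℂ, ContDiff ℝ 1 k →
      (∀ j ≤ 1, ∀ x, (1 + ‖x‖) ^ (Module.finrank ℝ V + 2) * ‖iteratedFDeriv ℝ j k x‖ ≤ C) →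
      ∀ z ≠ 0, ∫⁻ u in {u | 2 * ‖z‖ ≤ ‖u‖}, ‖k (u - z) - k u‖ₑ ≤
        A * ENNReal.ofReal (min ‖z‖ ‖z‖⁻¹) := by
  set d := Module.finrank ℝ V
  set I : ℝ≥0∞ := ∫⁻ u : V, ENNReal.ofReal ((1 + ‖u‖) ^ (d + 1))⁻¹ with hI
  have hIt : I ≠ ∞ := by
    have h := (integrable_one_add_norm (E := V) (μ := volume) (r := (d + 1 : ℕ))
      (by exact_mod_cast Nat.lt_succ_self d)).lintegral_lt_top
    have e : ∀ u : V, (1 + ‖u‖) ^ (-((d + 1 : ℕ) : ℝ)) = ((1 + ‖u‖) ^ (d + 1))⁻¹ := fun u => by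
      rw [Real.rpow_neg (by positivity), Real.rpow_natCast]
    simp only [e] at h
    exact h.ne
  refine ⟨(ENNReal.ofReal (2 ^ (d + 3) * C) * I).toNNReal, fun k hk hC z hz => ?_⟩
  rw [ENNReal.coe_toNNReal (ENNReal.mul_ne_top ENNReal.ofReal_ne_top hIt)]
  have hC0 : 0 ≤ C := le_trans (by positivity) (hC 0 zero_le_one 0)
  have hm : MeasurableSet {x : V | 2 * ‖z‖ ≤ ‖x‖} := measurableSet_le measurable_const measurable_norm
  calc ∫⁻ u in {u | 2 * ‖z‖ ≤ ‖u‖}, ‖k (u - z) - k u‖ₑ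
      ≤ ∫⁻ u in {u | 2 * ‖z‖ ≤ ‖u‖}, ENNReal.ofReal (2 ^ (d + 3) * C * min ‖z‖ ‖z‖⁻¹) *
          ENNReal.ofReal ((1 + ‖u‖) ^ (d + 1))⁻¹ := by
        refine setLIntegral_mono' hm fun u hu => ?_
        rw [← ENNReal.ofReal_mul (by positivity), ← ofReal_norm]
        exact ENNReal.ofReal_le_ofReal (norm_sub_le_of_decay hk hC hz hu)
    _ ≤ ∫⁻ u, ENNReal.ofReal (2 ^ (d + 3) * C * min ‖z‖ ‖z‖⁻¹) *
          ENNReal.ofReal ((1 + ‖u‖) ^ (d + 1))⁻¹ := setLIntegral_le_lintegral _ _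
    _ = _ := by
        rw [lintegral_const_mul' _ _ (by simp), ← hI, ENNReal.ofReal_mul (by positivity)]
        ring

theorem IsMikhlin.integrable_piece {l : ℕ} {B : ℝ} {m : V → ℂ} (hm : IsMikhlin l B m) {s : ℝ}
    (hs : 0 < s) : Integrable fun ξ => annulusBump (s⁻¹ • ξ) * m ξ := by
  have h1 : Integrable fun ξ => annulusBump ξ * m (s • ξ) :=
    (hm.comp_smul hs.ne').contDiff_annulusBump_mul.continuous.integrable_of_hasCompactSupport
      (hasCompactSupport_annulusBump_mul _)
  have h2 := h1.comp_smul (inv_ne_zero hs.ne')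
  simpa [smul_smul, hs.ne'] using h2

theorem fourier_piece (m : V → ℂ) {s : ℝ} (hs : 0 < s) (x : V) :
    𝓕 (fun ξ => annulusBump (s⁻¹ • ξ) * m ξ) x =
      (s ^ Module.finrank ℝ V : ℝ) * 𝓕 (fun ξ => annulusBump ξ * m (s • ξ)) (s • x) := by
  rw [← fourier_comp_inv_smul _ hs]
  simp [smul_smul, hs.ne']

theorem IsMikhlin.integrable_truncMultiplier {l : ℕ} {B : ℝ} {m : V → ℂ} (hm : IsMikhlin l B m)
    (N : ℕ) : Integrable (truncMultiplier m N) :=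
  integrable_finsetSum _ fun i _ => hm.integrable_piece (by positivity)

theorem IsMikhlin.fourier_truncMultiplier {l : ℕ} {B : ℝ} {m : V → ℂ} (hm : IsMikhlin l B m)
    (N : ℕ) (x : V) : 𝓕 (truncMultiplier m N) x = ∑ i ∈ Finset.range (2 * N),
      (((2 : ℝ) ^ i / 2 ^ N) ^ Module.finrank ℝ V : ℝ) *
        𝓕 (fun ξ => annulusBump ξ * m (((2 : ℝ) ^ i / 2 ^ N) • ξ)) (((2 : ℝ) ^ i / 2 ^ N) • x) := by
  have h : ∀ i ∈ Finset.range (2 * N), Integrable fun ξ =>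
      Complex.exp (↑(-2 * Real.pi * inner ℝ ξ x) * Complex.I) •
        (annulusBump (((2 : ℝ) ^ i / 2 ^ N)⁻¹ • ξ) * m ξ) := by
    intro i _
    refine (hm.integrable_piece (s := (2 : ℝ) ^ i / 2 ^ N) (by positivity)).bdd_mul (c := 1) ?_
      (Filter.Eventually.of_forall fun ξ => (Complex.norm_exp_ofReal_mul_I _).le)
    exact Continuous.aestronglyMeasurable (by fun_prop)
  rw [Real.fourier_eq']
  simp only [truncMultiplier, Finset.smul_sum]
  rw [integral_finsetSum _ h]
  refine Finset.sum_congr rfl fun i _ => ?_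
  rw [← fourier_piece m (by positivity), Real.fourier_eq']

variable (V) in
/-- The truncations of Mikhlin multipliers have uniform Hörmander kernels. -/
theorem exists_isHormanderKernel_fourier_truncMultiplier (B : ℝ≥0) :
    ∃ A : ℝ≥0, ∀ m : V → ℂ, IsMikhlin (Module.finrank ℝ V + 2) B m → ∀ N : ℕ,
      IsHormanderKernel A (𝓕 (truncMultiplier m N)) := by
  obtain ⟨C, hC0, hC⟩ := exists_norm_fourier_annulusBump_mul_le V (Module.finrank ℝ V + 2) B
  obtain ⟨A, hA⟩ := exists_lintegral_hormander_le V C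
  -- `B ^ 2` comes from Plancherel; the 6 is the bound for the dyadic sum in `sum_min_inv_le`.
  refine ⟨max (B ^ 2) (6 * A), fun m hm N => ?_⟩
  have hcont : ∀ {u : V → ℂ}, Integrable u → Continuous (𝓕 u) := fun hu =>
    VectorFourier.fourierIntegral_continuous Real.continuous_fourierChar continuous_inner hu
  have hti := hm.integrable_truncMultiplier N
  have hs : ∀ i : ℕ, 0 < (2 : ℝ) ^ i / 2 ^ N := fun i => by positivity
  have hmi := fun i : ℕ => hC _ (hm.comp_smul (hs i).ne')
  refine ⟨hcont hti, ?_, ⟨∫ ξ, ‖truncMultiplier m N ξ‖, fun x =>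
    VectorFourier.norm_fourierIntegral_le_integral_norm _ _ _ _ _⟩, fun g _ hg hgb => ?_, fun y => ?_⟩
  · refine Integrable.congr (f := fun x => ∑ i ∈ Finset.range (2 * N),
      (((2 : ℝ) ^ i / 2 ^ N) ^ Module.finrank ℝ V : ℝ) *
        𝓕 (fun ξ => annulusBump ξ * m (((2 : ℝ) ^ i / 2 ^ N) • ξ)) (((2 : ℝ) ^ i / 2 ^ N) • x)) ?_
      (Filter.Eventually.of_forall fun x => (hm.fourier_truncMultiplier N x).symm)
    refine integrable_finsetSum _ fun i _ => Integrable.const_mul ?_ _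
    refine Integrable.comp_smul (f := 𝓕 (fun ξ => annulusBump ξ * m (((2 : ℝ) ^ i / 2 ^ N) • ξ)))
      ?_ (hs i).ne'
    have h := (integrable_one_add_norm (E := V) (μ := volume) (r := (Module.finrank ℝ V + 2 : ℕ))
      (by exact_mod_cast (by omega : Module.finrank ℝ V < Module.finrank ℝ V + 2))).const_mul C
    refine h.mono' (hmi i).1.continuous.aestronglyMeasurable (Filter.Eventually.of_forall fun x => ?_)
    have h1 := (hmi i).2 0 zero_le_one x
    rw [norm_iteratedFDeriv_zero] at h1
    rw [Real.rpow_neg (by positivity), Real.rpow_natCast, ← div_eq_mul_inv, le_div_iff₀ (by positivity),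
      mul_comm]
    exact h1
  · refine (lintegral_kernelConv_fourier_sq_le hti (norm_truncMultiplier_le hm N) hg hgb).trans ?_
    gcongr
    exact le_max_left _ _
  · rcases eq_or_ne y 0 with rfl | hy
    · simp
    have hy0 : 0 < ‖y‖ := norm_pos_iff.2 hy
    set K : ℕ → V → ℂ := fun i x => (((2 : ℝ) ^ i / 2 ^ N) ^ Module.finrank ℝ V : ℝ) *
        𝓕 (fun ξ => annulusBump ξ * m (((2 : ℝ) ^ i / 2 ^ N) • ξ)) (((2 : ℝ) ^ i / 2 ^ N) • x) with hK
    have hKc : ∀ i, Continuous (K i) := fun i =>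
      continuous_const.mul ((hmi i).1.continuous.comp (continuous_const_smul _))
    calc ∫⁻ x in {x | 2 * ‖y‖ ≤ ‖x‖}, ‖𝓕 (truncMultiplier m N) (x - y) - 𝓕 (truncMultiplier m N) x‖ₑ
        ≤ ∫⁻ x in {x | 2 * ‖y‖ ≤ ‖x‖}, ∑ i ∈ Finset.range (2 * N), ‖K i (x - y) - K i x‖ₑ := by
          refine lintegral_mono fun x => ?_
          simp only
          rw [hm.fourier_truncMultiplier N, hm.fourier_truncMultiplier N, ← Finset.sum_sub_distrib]
          exact enorm_sum_le _ _
      _ = ∑ i ∈ Finset.range (2 * N), ∫⁻ x in {x | 2 * ‖y‖ ≤ ‖x‖}, ‖K i (x - y) - K i x‖ₑ :=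
          lintegral_finsetSum _ fun i _ => by
            have := (hKc i).measurable
            fun_prop
      -- After rescaling to the unit annulus, piece i sees a translation of size 2^i r with r =
      -- ‖y‖/2^N, and the resulting sum is bounded uniformly in N and y.
      _ ≤ ∑ i ∈ Finset.range (2 * N), A *
            ENNReal.ofReal (min (2 ^ i * (‖y‖ / 2 ^ N)) (2 ^ i * (‖y‖ / 2 ^ N))⁻¹) := by
          refine Finset.sum_le_sum fun i _ => ?_
          simp only [hK]
          rw [lintegral_hormander_dilation (hmi i).1.continuous (hs i)]
          refine (hA _ (hmi i).1 (hmi i).2 _ (smul_ne_zero (hs i).ne' hy)).trans_eq ?_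
          rw [norm_smul, Real.norm_of_nonneg (hs i).le]
          congr 3 <;> ring
      _ ≤ A * ENNReal.ofReal 6 := by
          rw [← Finset.mul_sum, ← ENNReal.ofReal_sum_of_nonneg fun i _ => by positivity]
          exact mul_le_mul' le_rfl (ENNReal.ofReal_le_ofReal (sum_min_inv_le (by positivity) _))
      _ ≤ _ := by
          rw [mul_comm]
          have : (6 * A : ℝ≥0) ≤ max (B ^ 2) (6 * A) := le_max_right _ _
          refine le_trans (le_of_eq ?_) (ENNReal.coe_le_coe.2 this)
          simp

/-- Move the Fourier transform to φ and use dominated convergence. The truncations need not converge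
to m at the origin, which is a null set because V is nontrivial. -/
theorem tendsto_integral_fourier_truncMultiplier [Nontrivial V] {l : ℕ} {B : ℝ≥0} {m : V → ℂ}
    (hm : IsMikhlin l B m) (φ : 𝓢(V, ℂ)) :
    Filter.Tendsto (fun N => ∫ x, 𝓕 (truncMultiplier m N) x * φ x) Filter.atTop
      (nhds (∫ ξ, m ξ * 𝓕 φ ξ)) := by
  have h1 : ∀ N, ∫ x, 𝓕 (truncMultiplier m N) x * φ x = ∫ ξ, truncMultiplier m N ξ * 𝓕 φ ξ := by
    intro N
    have := VectorFourier.integral_fourierIntegral_smul_eq_flip (L := innerₗ V)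
      Real.continuous_fourierChar continuous_inner (hm.integrable_truncMultiplier N)
      (φ.integrable (μ := volume))
    rw [flip_innerₗ] at this
    exact this
  simp_rw [h1]
  refine tendsto_integral_of_dominated_convergence (fun ξ => B * ‖𝓕 φ ξ‖) (fun N => ?_)
    ((𝓕 φ).integrable.norm.const_mul _) (fun N => ?_) ?_
  · exact (hm.integrable_truncMultiplier N).aestronglyMeasurable.mul
      (𝓕 φ).continuous.aestronglyMeasurable
  · refine Filter.Eventually.of_forall fun ξ => ?_
    rw [norm_mul]
    exact mul_le_mul_of_nonneg_right (norm_truncMultiplier_le hm N ξ) (norm_nonneg _)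
  · filter_upwards [Measure.ae_ne volume (0 : V)] with ξ hξ
    exact (tendsto_truncMultiplier m hξ).mul_const _

end Hormander

/-! ### Subspace arrangements of modules -/

namespace FSModule

/-- A choice of one vector in each of the four subspaces, with sum zero. -/
def IsRelation (M : FSModule) (u : Fin 4 → M.carrier) : Prop :=
  (∀ i, u i ∈ M.sub i) ∧ ∑ i, u i = 0

/-- The subspaces with index in `I` span the module. -/
def Spans (I : Finset (Fin 4)) (M : FSModule) : Prop :=
  ∀ x : M.carrier, ∃ u : Fin 4 → M.carrier,
    (∀ i, u i ∈ M.sub i) ∧ (∀ i ∉ I, u i = 0) ∧ ∑ i, u i = x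

/-- The subspaces with index in `I` are independent. -/
def Indep (I : Finset (Fin 4)) (M : FSModule) : Prop :=
  ∀ u : Fin 4 → M.carrier, M.IsRelation u → (∀ i ∉ I, u i = 0) → ∀ i, u i = 0

/-- The space of relations projects onto each of `M_1, M_2, M_3`. -/
def RelationsSurj (M : FSModule) : Prop :=
  ∀ a : Fin 3, ∀ x ∈ M.sub a.succ, ∃ u, M.IsRelation u ∧ u a.succ = x

/-- The space of relations is the sum of the three subspaces of relations that do not involve
`M_1`, respectively `M_2`, respectively `M_3`. -/
def RelationsSpan (M : FSModule) : Prop :=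
  ∀ u, M.IsRelation u → ∃ w : Fin 3 → Fin 4 → M.carrier,
    (∀ a, M.IsRelation (w a) ∧ w a a.succ = 0) ∧ ∀ i, ∑ a, w a i = u i

/-- The three subspaces of relations that do not involve `M_1`, respectively `M_2`, respectively
`M_3` are independent. -/
def RelationsIndep (M : FSModule) : Prop :=
  ∀ w : Fin 3 → Fin 4 → M.carrier, (∀ a, M.IsRelation (w a) ∧ w a a.succ = 0) →
    (∀ i, ∑ a, w a i = 0) → ∀ a i, w a i = 0

/-- A property of modules that is inherited by direct sums. -/
structure IsAdditive (Q : FSModule.{0} → Prop) : Prop where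
  oplus : ∀ {M N : FSModule}, Q M → Q N → Q (M.oplus N)
  directSum : ∀ {k : ℕ} {M : Fin k → FSModule}, (∀ s, Q (M s)) → Q (FSModule.directSum M)

theorem IsAdditive.power {Q : FSModule → Prop} (hQ : IsAdditive Q) {M : FSModule} (h : Q M)
    (n : ℕ) : Q (M.power n) :=
  hQ.directSum fun _ => h

theorem Iso.exists_equiv {M N : FSModule} (h : M.Iso N) :
    ∃ ψ : M.carrier ≃ₗ[ℝ] N.carrier, (∀ i x, ψ x ∈ N.sub i ↔ x ∈ M.sub i) ∧
      (∀ i x, ψ.symm x ∈ M.sub i ↔ x ∈ N.sub i) ∧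
      (∀ u, N.IsRelation (fun i => ψ (u i)) ↔ M.IsRelation u) ∧
      (∀ u, M.IsRelation (fun i => ψ.symm (u i)) ↔ N.IsRelation u) := by
  obtain ⟨ψ, hψ⟩ := h
  have h1 : ∀ i x, ψ x ∈ N.sub i ↔ x ∈ M.sub i := by
    intro i x
    rw [← hψ i]
    exact ⟨fun ⟨y, hy, hyx⟩ => ψ.injective hyx ▸ hy, fun hx => ⟨x, hx, rfl⟩⟩
  have h2 : ∀ i x, ψ.symm x ∈ M.sub i ↔ x ∈ N.sub i := by
    intro i x
    rw [← h1 i, ψ.apply_symm_apply]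
  refine ⟨ψ, h1, h2, fun u => ?_, fun u => ?_⟩
  · simp only [IsRelation, h1, ← map_sum, map_eq_zero_iff ψ ψ.injective]
  · simp only [IsRelation, h2, ← map_sum, map_eq_zero_iff ψ.symm ψ.symm.injective]

theorem mem_oplus {M N : FSModule} {i : Fin 4} {x : (M.oplus N).carrier} :
    x ∈ (M.oplus N).sub i ↔ x.1 ∈ M.sub i ∧ x.2 ∈ N.sub i :=
  Submodule.mem_prod

theorem mem_directSum {k : ℕ} {M : Fin k → FSModule} {i : Fin 4} {x : (directSum M).carrier} :
    x ∈ (directSum M).sub i ↔ ∀ s, x s ∈ (M s).sub i := by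
  exact Submodule.mem_pi.trans (by simp)

theorem oplus_eq_zero {M N : FSModule} {x : (M.oplus N).carrier} :
    x = 0 ↔ x.1 = 0 ∧ x.2 = 0 :=
  Prod.ext_iff

theorem directSum_eq_zero {k : ℕ} {M : Fin k → FSModule} {x : (directSum M).carrier} :
    x = 0 ↔ ∀ s, x s = 0 :=
  funext_iff

theorem fst_sum_oplus {M N : FSModule} {ι : Type*} [Fintype ι] (u : ι → (M.oplus N).carrier) :
    (∑ i, u i).1 = ∑ i, (u i).1 :=
  Prod.fst_sum

theorem snd_sum_oplus {M N : FSModule} {ι : Type*} [Fintype ι] (u : ι → (M.oplus N).carrier) :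
    (∑ i, u i).2 = ∑ i, (u i).2 :=
  Prod.snd_sum

theorem sum_directSum_apply {k : ℕ} {M : Fin k → FSModule} {ι : Type*} [Fintype ι]
    (u : ι → (directSum M).carrier) (s : Fin k) : (∑ i, u i) s = ∑ i, u i s :=
  Finset.sum_apply s _ _

theorem isRelation_oplus {M N : FSModule} {u : Fin 4 → (M.oplus N).carrier} :
    (M.oplus N).IsRelation u ↔
      M.IsRelation (fun i => (u i).1) ∧ N.IsRelation (fun i => (u i).2) := by
  simp only [IsRelation, mem_oplus, oplus_eq_zero, fst_sum_oplus, snd_sum_oplus, forall_and]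
  tauto

theorem isRelation_directSum {k : ℕ} {M : Fin k → FSModule}
    {u : Fin 4 → (directSum M).carrier} :
    (directSum M).IsRelation u ↔ ∀ s, (M s).IsRelation (fun i => u i s) := by
  simp only [IsRelation, mem_directSum, directSum_eq_zero, sum_directSum_apply, forall_and]
  exact ⟨fun h => ⟨fun s i => h.1 i s, h.2⟩, fun h => ⟨fun i s => h.1 s i, h.2⟩⟩

theorem Iso.spans {I : Finset (Fin 4)} {M N : FSModule} (h : M.Iso N) (hN : N.Spans I) :
    M.Spans I := by
  intro x
  obtain ⟨ψ, -, h2, -, -⟩ := h.exists_equiv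
  obtain ⟨u, hu, hI, hx⟩ := hN (ψ x)
  refine ⟨fun i => ψ.symm (u i), fun i => (h2 _ _).2 (hu i), fun i hi => by simp [hI i hi], ?_⟩
  rw [← map_sum, hx, ψ.symm_apply_apply]

theorem isAdditive_spans (I : Finset (Fin 4)) : IsAdditive (Spans I) where
  oplus := by
    intro M N hM hN x
    obtain ⟨u, hu, huI, hux⟩ := hM x.1
    obtain ⟨v, hv, hvI, hvx⟩ := hN x.2
    refine ⟨fun i => (u i, v i), fun i => mem_oplus.2 ⟨hu i, hv i⟩,
      fun i hi => oplus_eq_zero.2 ⟨huI i hi, hvI i hi⟩, Prod.ext ?_ ?_⟩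
    · exact (fst_sum_oplus (M := M) (N := N) _).trans hux
    · exact (snd_sum_oplus (M := M) (N := N) _).trans hvx
  directSum := by
    intro k M hM x
    choose u hu huI hux using fun s => hM s (x s)
    refine ⟨fun i s => u s i, fun i => mem_directSum.2 fun s => hu s i,
      fun i hi => directSum_eq_zero.2 fun s => huI s i hi, funext fun s => ?_⟩
    exact (sum_directSum_apply (M := M) _ s).trans (hux s)

theorem Iso.indep {I : Finset (Fin 4)} {M N : FSModule} (h : M.Iso N) (hN : N.Indep I) :
    M.Indep I := by
  intro u hu hI i
  obtain ⟨ψ, -, -, h3, -⟩ := h.exists_equiv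
  have := hN (fun i => ψ (u i)) ((h3 u).2 hu) (fun i hi => by simp [hI i hi]) i
  exact (map_eq_zero_iff ψ ψ.injective).1 this

theorem isAdditive_indep (I : Finset (Fin 4)) : IsAdditive (Indep I) where
  oplus := by
    intro M N hM hN u hu hI i
    have := isRelation_oplus.1 hu
    exact oplus_eq_zero.2 ⟨hM _ this.1 (fun i hi => (oplus_eq_zero.1 (hI i hi)).1) i,
      hN _ this.2 (fun i hi => (oplus_eq_zero.1 (hI i hi)).2) i⟩
  directSum := by
    intro k M hM u hu hI i
    exact directSum_eq_zero.2 fun s => hM s _ (isRelation_directSum.1 hu s)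
      (fun i hi => directSum_eq_zero.1 (hI i hi) s) i

theorem Iso.relationsSurj {M N : FSModule} (h : M.Iso N) (hN : N.RelationsSurj) :
    M.RelationsSurj := by
  intro a x hx
  obtain ⟨ψ, h1, -, -, h4⟩ := h.exists_equiv
  obtain ⟨u, hu, hux⟩ := hN a (ψ x) ((h1 _ _).2 hx)
  exact ⟨fun i => ψ.symm (u i), (h4 u).2 hu, by simp [hux]⟩

theorem isAdditive_relationsSurj : IsAdditive RelationsSurj where
  oplus := by
    intro M N hM hN a x hx
    obtain ⟨u, hu, hux⟩ := hM a x.1 (mem_oplus.1 hx).1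
    obtain ⟨v, hv, hvx⟩ := hN a x.2 (mem_oplus.1 hx).2
    exact ⟨fun i => (u i, v i), isRelation_oplus.2 ⟨hu, hv⟩, Prod.ext hux hvx⟩
  directSum := by
    intro k M hM a x hx
    choose u hu hux using fun s => hM s a (x s) (mem_directSum.1 hx s)
    exact ⟨fun i s => u s i, isRelation_directSum.2 hu, funext hux⟩

theorem Iso.relationsSpan {M N : FSModule} (h : M.Iso N) (hN : N.RelationsSpan) :
    M.RelationsSpan := by
  intro u hu
  obtain ⟨ψ, -, -, h3, h4⟩ := h.exists_equiv
  obtain ⟨w, hw, hwu⟩ := hN _ ((h3 u).2 hu)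
  refine ⟨fun a i => ψ.symm (w a i), fun a => ⟨(h4 _).2 (hw a).1, by simp [(hw a).2]⟩,
    fun i => ?_⟩
  rw [← map_sum, hwu, ψ.symm_apply_apply]

theorem isAdditive_relationsSpan : IsAdditive RelationsSpan where
  oplus := by
    intro M N hM hN u hu
    obtain ⟨v, hv, hvu⟩ := hM _ (isRelation_oplus.1 hu).1
    obtain ⟨w, hw, hwu⟩ := hN _ (isRelation_oplus.1 hu).2
    refine ⟨fun a i => (v a i, w a i), fun a => ⟨isRelation_oplus.2 ⟨(hv a).1, (hw a).1⟩,
      oplus_eq_zero.2 ⟨(hv a).2, (hw a).2⟩⟩, fun i => Prod.ext ?_ ?_⟩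
    · exact (fst_sum_oplus (M := M) (N := N) _).trans (hvu i)
    · exact (snd_sum_oplus (M := M) (N := N) _).trans (hwu i)
  directSum := by
    intro k M hM u hu
    choose w hw hwu using fun s => hM s _ (isRelation_directSum.1 hu s)
    refine ⟨fun a i s => w s a i, fun a => ⟨isRelation_directSum.2 fun s => (hw s a).1,
      directSum_eq_zero.2 fun s => (hw s a).2⟩, fun i => funext fun s => ?_⟩
    exact (sum_directSum_apply (M := M) _ s).trans (hwu s i)

theorem Iso.relationsIndep {M N : FSModule} (h : M.Iso N) (hN : N.RelationsIndep) :
    M.RelationsIndep := by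
  intro w hw h0 a i
  obtain ⟨ψ, -, -, h3, -⟩ := h.exists_equiv
  have := hN (fun a i => ψ (w a i)) (fun a => ⟨(h3 _).2 (hw a).1, by simp [(hw a).2]⟩)
    (fun i => by rw [← map_sum, h0, map_zero]) a i
  exact (map_eq_zero_iff ψ ψ.injective).1 this

theorem isAdditive_relationsIndep : IsAdditive RelationsIndep where
  oplus := by
    intro M N hM hN w hw h0 a i
    refine oplus_eq_zero.2 ⟨hM (fun a i => (w a i).1) (fun a => ⟨(isRelation_oplus.1 (hw a).1).1,
      (oplus_eq_zero.1 (hw a).2).1⟩) (fun i => ?_) a i, hN (fun a i => (w a i).2)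
      (fun a => ⟨(isRelation_oplus.1 (hw a).1).2, (oplus_eq_zero.1 (hw a).2).2⟩)
      (fun i => ?_) a i⟩
    · rw [← fst_sum_oplus, h0]; rfl
    · rw [← snd_sum_oplus, h0]; rfl
  directSum := by
    intro k M hM w hw h0 a i
    refine directSum_eq_zero.2 fun s => hM s (fun a i => w a i s)
      (fun a => ⟨isRelation_directSum.1 (hw a).1 s, directSum_eq_zero.1 (hw a).2 s⟩)
      (fun i => ?_) a i
    rw [← sum_directSum_apply, h0]; rfl

end FSModule

/-! ### Matrix criteria for modules given by column spaces -/

namespace FSModule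

theorem Spans.mono {I J : Finset (Fin 4)} (hIJ : I ⊆ J) {M : FSModule} (h : M.Spans I) :
    M.Spans J := fun x =>
  let ⟨u, hu, hI, hx⟩ := h x
  ⟨u, hu, fun i hi => hI i fun h => hi (hIJ h), hx⟩

section ofColumns

variable {n d₀ d₁ d₂ d₃ : ℕ}
    {A₀ : Matrix (Fin n) (Fin d₀) ℝ} {A₁ : Matrix (Fin n) (Fin d₁) ℝ}
    {A₂ : Matrix (Fin n) (Fin d₂) ℝ} {A₃ : Matrix (Fin n) (Fin d₃) ℝ}

theorem mem_ofColumns_iff {u : Fin 4 → Fin n → ℝ} :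
    (∀ i, u i ∈ (ofColumns A₀ A₁ A₂ A₃).sub i) ↔ (∃ v, A₀.mulVec v = u 0) ∧
      (∃ v, A₁.mulVec v = u 1) ∧ (∃ v, A₂.mulVec v = u 2) ∧ (∃ v, A₃.mulVec v = u 3) := by
  simp [Fin.forall_fin_succ, ofColumns]
  rfl

theorem spans_ofColumns {I : Finset (Fin 4)}
    (h : ∀ x : Fin n → ℝ, ∃ v₀ v₁ v₂ v₃, (0 ∉ I → v₀ = 0) ∧ (1 ∉ I → v₁ = 0) ∧
      (2 ∉ I → v₂ = 0) ∧ (3 ∉ I → v₃ = 0) ∧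
      ∀ i, A₀.mulVec v₀ i + A₁.mulVec v₁ i + A₂.mulVec v₂ i + A₃.mulVec v₃ i = x i) :
    (ofColumns A₀ A₁ A₂ A₃).Spans I := by
  intro x
  obtain ⟨v₀, v₁, v₂, v₃, h0, h1, h2, h3, hx⟩ := h x
  refine ⟨![A₀.mulVec v₀, A₁.mulVec v₁, A₂.mulVec v₂, A₃.mulVec v₃],
    mem_ofColumns_iff.2 ⟨⟨_, rfl⟩, ⟨_, rfl⟩, ⟨_, rfl⟩, ⟨_, rfl⟩⟩, fun i hi => ?_, ?_⟩
  · fin_cases i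
    · exact (congrArg _ (h0 hi)).trans A₀.mulVec_zero
    · exact (congrArg _ (h1 hi)).trans A₁.mulVec_zero
    · exact (congrArg _ (h2 hi)).trans A₂.mulVec_zero
    · exact (congrArg _ (h3 hi)).trans A₃.mulVec_zero
  · exact (Fin.sum_univ_four (M := Fin n → ℝ) _).trans (funext hx)

theorem isRelation_ofColumns {u : Fin 4 → Fin n → ℝ} :
    (ofColumns A₀ A₁ A₂ A₃).IsRelation u ↔ ∃ v₀ v₁ v₂ v₃,
      u = ![A₀.mulVec v₀, A₁.mulVec v₁, A₂.mulVec v₂, A₃.mulVec v₃] ∧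
      ∀ i, A₀.mulVec v₀ i + A₁.mulVec v₁ i + A₂.mulVec v₂ i + A₃.mulVec v₃ i = 0 := by
  constructor
  · rintro ⟨hu, hsum⟩
    obtain ⟨⟨v₀, h0⟩, ⟨v₁, h1⟩, ⟨v₂, h2⟩, ⟨v₃, h3⟩⟩ := mem_ofColumns_iff.1 hu
    refine ⟨v₀, v₁, v₂, v₃, ?_, ?_⟩
    · rw [h0, h1, h2, h3]
      funext i
      fin_cases i <;> rfl
    · rw [h0, h1, h2, h3]
      exact congrFun ((Fin.sum_univ_four (M := Fin n → ℝ) u).symm.trans hsum)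
  · rintro ⟨v₀, v₁, v₂, v₃, rfl, h⟩
    refine ⟨mem_ofColumns_iff.2 ⟨⟨_, rfl⟩, ⟨_, rfl⟩, ⟨_, rfl⟩, ⟨_, rfl⟩⟩, ?_⟩
    exact (Fin.sum_univ_four (M := Fin n → ℝ) _).trans (funext h)

theorem indep_ofColumns {I : Finset (Fin 4)}
    (h : ∀ v₀ v₁ v₂ v₃,
      (∀ i, A₀.mulVec v₀ i + A₁.mulVec v₁ i + A₂.mulVec v₂ i + A₃.mulVec v₃ i = 0) →
      (0 ∉ I → ∀ i, A₀.mulVec v₀ i = 0) → (1 ∉ I → ∀ i, A₁.mulVec v₁ i = 0) →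
      (2 ∉ I → ∀ i, A₂.mulVec v₂ i = 0) → (3 ∉ I → ∀ i, A₃.mulVec v₃ i = 0) →
      (∀ i, A₀.mulVec v₀ i = 0) ∧ (∀ i, A₁.mulVec v₁ i = 0) ∧ (∀ i, A₂.mulVec v₂ i = 0) ∧
        (∀ i, A₃.mulVec v₃ i = 0)) :
    (ofColumns A₀ A₁ A₂ A₃).Indep I := by
  intro u hu hI
  obtain ⟨v₀, v₁, v₂, v₃, rfl, hsum⟩ := isRelation_ofColumns.1 hu
  obtain ⟨h0, h1, h2, h3⟩ := h v₀ v₁ v₂ v₃ hsum (fun hi => congrFun (hI 0 hi))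
    (fun hi => congrFun (hI 1 hi)) (fun hi => congrFun (hI 2 hi)) (fun hi => congrFun (hI 3 hi))
  intro i
  fin_cases i
  exacts [funext h0, funext h1, funext h2, funext h3]

theorem relationsSurj_ofColumns
    (h₁ : ∀ v₁, ∃ v₀ v₂ v₃, ∀ i, A₀.mulVec v₀ i + A₁.mulVec v₁ i + A₂.mulVec v₂ i +
      A₃.mulVec v₃ i = 0)
    (h₂ : ∀ v₂, ∃ v₀ v₁ v₃, ∀ i, A₀.mulVec v₀ i + A₁.mulVec v₁ i + A₂.mulVec v₂ i +
      A₃.mulVec v₃ i = 0)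
    (h₃ : ∀ v₃, ∃ v₀ v₁ v₂, ∀ i, A₀.mulVec v₀ i + A₁.mulVec v₁ i + A₂.mulVec v₂ i +
      A₃.mulVec v₃ i = 0) :
    (ofColumns A₀ A₁ A₂ A₃).RelationsSurj := by
  intro a x hx
  fin_cases a
  · obtain ⟨v₁, rfl⟩ := hx
    obtain ⟨v₀, v₂, v₃, h⟩ := h₁ v₁
    exact ⟨_, isRelation_ofColumns.2 ⟨v₀, v₁, v₂, v₃, rfl, h⟩, rfl⟩
  · obtain ⟨v₂, rfl⟩ := hx
    obtain ⟨v₀, v₁, v₃, h⟩ := h₂ v₂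
    exact ⟨_, isRelation_ofColumns.2 ⟨v₀, v₁, v₂, v₃, rfl, h⟩, rfl⟩
  · obtain ⟨v₃, rfl⟩ := hx
    obtain ⟨v₀, v₁, v₂, h⟩ := h₃ v₃
    exact ⟨_, isRelation_ofColumns.2 ⟨v₀, v₁, v₂, v₃, rfl, h⟩, rfl⟩

theorem relationsSpan_ofColumns
    (h : ∀ v₀ v₁ v₂ v₃, (∀ i, A₀.mulVec v₀ i + A₁.mulVec v₁ i + A₂.mulVec v₂ i +
      A₃.mulVec v₃ i = 0) → ∃ x₀ y₀ z₀ y₁ z₁ x₂ z₂ x₃ y₃,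
      (∀ i, A₀.mulVec x₀ i + A₂.mulVec x₂ i + A₃.mulVec x₃ i = 0) ∧
      (∀ i, A₀.mulVec y₀ i + A₁.mulVec y₁ i + A₃.mulVec y₃ i = 0) ∧
      (∀ i, A₀.mulVec z₀ i + A₁.mulVec z₁ i + A₂.mulVec z₂ i = 0) ∧
      x₀ + y₀ + z₀ = v₀ ∧ y₁ + z₁ = v₁ ∧ x₂ + z₂ = v₂ ∧ x₃ + y₃ = v₃) :
    (ofColumns A₀ A₁ A₂ A₃).RelationsSpan := by
  intro u hu
  obtain ⟨v₀, v₁, v₂, v₃, rfl, hsum⟩ := isRelation_ofColumns.1 hu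
  obtain ⟨x₀, y₀, z₀, y₁, z₁, x₂, z₂, x₃, y₃, hx, hy, hz, rfl, rfl, rfl, rfl⟩ := h _ _ _ _ hsum
  refine ⟨![![A₀.mulVec x₀, A₁.mulVec 0, A₂.mulVec x₂, A₃.mulVec x₃],
    ![A₀.mulVec y₀, A₁.mulVec y₁, A₂.mulVec 0, A₃.mulVec y₃],
    ![A₀.mulVec z₀, A₁.mulVec z₁, A₂.mulVec z₂, A₃.mulVec 0]], fun a => ?_, fun i => ?_⟩
  · fin_cases a
    · exact ⟨isRelation_ofColumns.2 ⟨_, _, _, _, rfl, by simpa using hx⟩, A₁.mulVec_zero⟩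
    · exact ⟨isRelation_ofColumns.2 ⟨_, _, _, _, rfl, by simpa using hy⟩, A₂.mulVec_zero⟩
    · exact ⟨isRelation_ofColumns.2 ⟨_, _, _, _, rfl, by simpa using hz⟩, A₃.mulVec_zero⟩
  · refine (Fin.sum_univ_three (M := Fin n → ℝ) _).trans ?_
    fin_cases i <;> simp [Matrix.mulVec_add]

/-- The component 0 of a relation is minus the sum of the other three, so only those have to be
shown to vanish. -/
theorem relationsIndep_ofColumns
    (h : ∀ (v₀ : Fin 3 → Fin d₀ → ℝ) (v₁ : Fin 3 → Fin d₁ → ℝ) (v₂ : Fin 3 → Fin d₂ → ℝ)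
      (v₃ : Fin 3 → Fin d₃ → ℝ), (∀ a : Fin 3, ∀ i, A₀.mulVec (v₀ a) i + A₁.mulVec (v₁ a) i +
      A₂.mulVec (v₂ a) i + A₃.mulVec (v₃ a) i = 0) → (∀ i, A₁.mulVec (v₁ 0) i = 0) →
      (∀ i, A₂.mulVec (v₂ 1) i = 0) → (∀ i, A₃.mulVec (v₃ 2) i = 0) →
      (∀ i, A₁.mulVec (v₁ 0) i + A₁.mulVec (v₁ 1) i + A₁.mulVec (v₁ 2) i = 0) →
      (∀ i, A₂.mulVec (v₂ 0) i + A₂.mulVec (v₂ 1) i + A₂.mulVec (v₂ 2) i = 0) →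
      (∀ i, A₃.mulVec (v₃ 0) i + A₃.mulVec (v₃ 1) i + A₃.mulVec (v₃ 2) i = 0) →
      (∀ a i, A₁.mulVec (v₁ a) i = 0) ∧ (∀ a i, A₂.mulVec (v₂ a) i = 0) ∧
        (∀ a i, A₃.mulVec (v₃ a) i = 0)) :
    (ofColumns A₀ A₁ A₂ A₃).RelationsIndep := by
  intro w hw hsum
  choose v₀ v₁ v₂ v₃ hv hR using fun a => isRelation_ofColumns.1 (hw a).1
  have hv' : ∀ a i, w a i = (![A₀.mulVec (v₀ a), A₁.mulVec (v₁ a), A₂.mulVec (v₂ a),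
    A₃.mulVec (v₃ a)] : Fin 4 → Fin n → ℝ) i := fun a => congrFun (hv a)
  have hS : ∀ i : Fin 4, w 0 i + w 1 i + w 2 i = 0 := fun i =>
    (Fin.sum_univ_three (M := Fin n → ℝ) _).symm.trans (hsum i)
  simp only [hv'] at hS
  have hZ := fun a => (hv' a a.succ).symm.trans (hw a).2
  obtain ⟨h1, h2, h3⟩ := h v₀ v₁ v₂ v₃ hR (congrFun (hZ 0)) (congrFun (hZ 1)) (congrFun (hZ 2))
    (congrFun (hS 1)) (congrFun (hS 2)) (congrFun (hS 3))
  intro a i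
  refine (hv' a i).trans ?_
  have h0 : ∀ i, A₀.mulVec (v₀ a) i = 0 := by
    intro i
    have := hR a i
    rw [h1, h2, h3] at this
    simpa using this
  fin_cases i
  exacts [funext h0, funext (h1 a), funext (h2 a), funext (h3 a)]

end ofColumns

end FSModule

/-! ### The properties of the indecomposable modules -/

namespace FSModule

theorem spans_modP {a b : Fin 3} (hab : b ≠ a) : (modP a).Spans {0, b.succ} := by
  fin_cases a <;> fin_cases b <;> simp at hab <;>
    refine spans_ofColumns fun x => ?_
  · exact ⟨![], ![], ![x 0], 0, by simp⟩
  · exact ⟨![], ![], 0, ![x 0], by simp⟩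
  · exact ⟨![], ![x 0], ![], 0, by simp⟩
  · exact ⟨![], 0, ![], ![x 0], by simp⟩
  · exact ⟨![], ![x 0], 0, ![], by simp⟩
  · exact ⟨![], 0, ![x 0], ![], by simp⟩

/-- The subspaces with indices 0 and b are distinct lines in the plane. -/
theorem spans_modK {a b : Fin 3} (hab : b ≠ a) : (modK a).Spans {0, b.succ} := by
  fin_cases a <;> fin_cases b <;> simp at hab <;>
    refine spans_ofColumns fun x => ?_
  · exact ⟨![x 0], ![], ![x 1], 0, by simp [Fin.forall_fin_succ]⟩
  · exact ⟨![x 0 - x 1], ![], 0, ![x 1], by simp [Fin.forall_fin_succ]⟩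
  · exact ⟨![x 0], ![x 1], ![], 0, by simp [Fin.forall_fin_succ]⟩
  · exact ⟨![x 0 - x 1], 0, ![], ![x 1], by simp [Fin.forall_fin_succ]⟩
  · exact ⟨![x 0], ![x 1], 0, ![], by simp [Fin.forall_fin_succ]⟩
  · exact ⟨![x 0 - x 1], 0, ![x 1], ![], by simp [Fin.forall_fin_succ]⟩

theorem indep_modP {a b : Fin 3} (hab : b ≠ a) : (modP a).Indep {0, a.succ, b.succ} := by
  fin_cases a <;> fin_cases b <;> simp at hab <;>
    (refine indep_ofColumns fun v₀ v₁ v₂ v₃ h => ?_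
     simp [Matrix.vecHead, Matrix.vecTail] at h ⊢
     try grind)

theorem indep_modK {a b : Fin 3} (hab : b ≠ a) : (modK a).Indep {0, a.succ, b.succ} := by
  fin_cases a <;> fin_cases b <;> simp at hab <;>
    (refine indep_ofColumns fun v₀ v₁ v₂ v₃ h => ?_
     simp [Fin.forall_fin_succ, Matrix.vecHead, Matrix.vecTail] at h ⊢
     try grind)

/-- The case a = b need not be excluded: it only concerns a smaller set of indices. -/
theorem indep_modY {a b : Fin 3} : modY.Indep {0, a.succ, b.succ} := by
  fin_cases a <;> fin_cases b <;>
    (refine indep_ofColumns fun v₀ v₁ v₂ v₃ h => ?_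
     simp [Fin.forall_fin_succ, Matrix.vecHead, Matrix.vecTail] at h ⊢
     try grind)

theorem indep_modZ {a b : Fin 3} : modZ.Indep {0, a.succ, b.succ} := by
  fin_cases a <;> fin_cases b <;>
    (refine indep_ofColumns fun v₀ v₁ v₂ v₃ h => ?_
     simp [Fin.forall_fin_succ, Matrix.vecHead, Matrix.vecTail] at h ⊢
     try grind)

theorem spans_modY {a b : Fin 3} (hab : b ≠ a) : modY.Spans {0, a.succ, b.succ} := by
  fin_cases a <;> fin_cases b <;> simp at hab <;>
    refine spans_ofColumns fun x => ?_
  · exact ⟨![], ![x 0], ![x 1], 0, by simp [Fin.forall_fin_succ]⟩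
  · exact ⟨![], ![x 0 - x 1], 0, ![x 1], by simp [Fin.forall_fin_succ]⟩
  · exact ⟨![], ![x 0], ![x 1], 0, by simp [Fin.forall_fin_succ]⟩
  · exact ⟨![], 0, ![x 1 - x 0], ![x 0], by simp [Fin.forall_fin_succ]⟩
  · exact ⟨![], ![x 0 - x 1], 0, ![x 1], by simp [Fin.forall_fin_succ]⟩
  · exact ⟨![], 0, ![x 1 - x 0], ![x 0], by simp [Fin.forall_fin_succ]⟩

theorem spans_modZ {a b : Fin 3} (hab : b ≠ a) : modZ.Spans {0, a.succ, b.succ} := by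
  have h1 : modZ.Spans {0, 1, 2} := spans_ofColumns fun x =>
    ⟨![x 0], ![x 1 - x 2], ![x 2], 0, by simp [Fin.forall_fin_succ]⟩
  have h2 : modZ.Spans {0, 1, 3} := spans_ofColumns fun x =>
    ⟨![x 0 - x 2], ![x 1], 0, ![x 2], by simp [Fin.forall_fin_succ]⟩
  have h3 : modZ.Spans {0, 2, 3} := spans_ofColumns fun x =>
    ⟨![x 0 - x 2 + x 1], 0, ![x 1], ![x 2 - x 1], by simp [Fin.forall_fin_succ]⟩
  fin_cases a <;> fin_cases b <;> simp at hab
  exacts [h1, h2, h1.mono (by decide), h3, h2.mono (by decide), h3.mono (by decide)]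


theorem spans_one_two_three_modP (a : Fin 3) : (modP a).Spans {1, 2, 3} := by
  fin_cases a <;> refine spans_ofColumns fun x => ?_
  · exact ⟨![], ![], ![x 0], 0, by simp⟩
  · exact ⟨![], ![x 0], ![], 0, by simp⟩
  · exact ⟨![], ![x 0], 0, ![], by simp⟩

theorem spans_one_two_three_modK (a : Fin 3) : (modK a).Spans {1, 2, 3} := by
  fin_cases a <;> refine spans_ofColumns fun x => ?_
  · exact ⟨0, ![], ![x 1 - x 0], ![x 0], by simp [Fin.forall_fin_succ]⟩
  · exact ⟨0, ![x 1 - x 0], ![], ![x 0], by simp [Fin.forall_fin_succ]⟩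
  · exact ⟨0, ![x 1 - x 0], ![x 0], ![], by simp [Fin.forall_fin_succ]⟩

theorem spans_one_two_three_modY : modY.Spans {1, 2, 3} :=
  spans_ofColumns fun x => ⟨![], ![x 0], ![x 1], 0, by simp [Fin.forall_fin_succ]⟩

theorem spans_one_two_three_modZ : modZ.Spans {1, 2, 3} :=
  spans_ofColumns fun x => ⟨0, ![x 1 - x 2 + x 0], ![x 2 - x 0], ![x 0],
    by simp [Fin.forall_fin_succ]⟩

theorem spans_one_two_three_modL : modL.Spans {1, 2, 3} :=
  spans_ofColumns fun x => ⟨0, ![x 0, x 1], ![x 2, x 3], 0, by simp [Fin.forall_fin_succ]⟩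

theorem spans_one_two_three_modB : modB.Spans {1, 2, 3} :=
  spans_ofColumns fun x => ⟨0, ![x 2 - x 1 - x 4 + x 0, x 3], ![x 4 - x 0, 0], ![x 0, x 1],
    by
    simp [Fin.forall_fin_succ, Matrix.vecHead, Matrix.vecTail]⟩

theorem relationsSurj_modP (a : Fin 3) : (modP a).RelationsSurj := by
  fin_cases a <;> refine relationsSurj_ofColumns (fun v => ?_) (fun v => ?_) fun v => ?_
  · exact ⟨0, 0, 0, by simp⟩
  · exact ⟨0, 0, ![-v 0], by simp [Matrix.vecHead]⟩
  · exact ⟨0, 0, ![-v 0], by simp [Matrix.vecHead]⟩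
  · exact ⟨0, 0, ![-v 0], by simp [Matrix.vecHead]⟩
  · exact ⟨0, 0, 0, by simp⟩
  · exact ⟨0, ![-v 0], 0, by simp [Matrix.vecHead]⟩
  · exact ⟨0, ![-v 0], 0, by simp [Matrix.vecHead]⟩
  · exact ⟨0, ![-v 0], 0, by simp [Matrix.vecHead]⟩
  · exact ⟨0, 0, 0, by simp⟩

theorem relationsSurj_modK (a : Fin 3) : (modK a).RelationsSurj := by
  fin_cases a <;> refine relationsSurj_ofColumns (fun v => ?_) (fun v => ?_) fun v => ?_
  · exact ⟨0, 0, 0, by simp⟩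
  · exact ⟨![v 0], 0, ![-v 0], by
    simp [Fin.forall_fin_succ, Matrix.vecHead, Matrix.vecTail]⟩
  · exact ⟨![-v 0], 0, ![-v 0], by
    simp [Fin.forall_fin_succ, Matrix.vecHead, Matrix.vecTail]⟩
  · exact ⟨![v 0], 0, ![-v 0], by
    simp [Fin.forall_fin_succ, Matrix.vecHead, Matrix.vecTail]⟩
  · exact ⟨0, 0, 0, by simp⟩
  · exact ⟨![-v 0], ![-v 0], 0, by
    simp [Fin.forall_fin_succ, Matrix.vecHead, Matrix.vecTail]⟩
  · exact ⟨![v 0], ![-v 0], 0, by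
    simp [Fin.forall_fin_succ, Matrix.vecHead, Matrix.vecTail]⟩
  · exact ⟨![-v 0], ![-v 0], 0, by
    simp [Fin.forall_fin_succ, Matrix.vecHead, Matrix.vecTail]⟩
  · exact ⟨0, 0, 0, by simp⟩

theorem relationsSurj_modL : modL.RelationsSurj := by
  refine relationsSurj_ofColumns (fun v => ?_) (fun v => ?_) fun v => ?_
  · exact ⟨0, ![v 0, v 1], ![-v 0, -v 1], by
    simp [Fin.forall_fin_succ, Matrix.vecHead, Matrix.vecTail]⟩
  · exact ⟨0, ![v 0, v 1], ![-v 0, -v 1], by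
    simp [Fin.forall_fin_succ, Matrix.vecHead, Matrix.vecTail]⟩
  · exact ⟨0, ![-v 0, -v 1], ![-v 0, -v 1], by
    simp [Fin.forall_fin_succ, Matrix.vecHead, Matrix.vecTail]⟩

theorem relationsSurj_modB : modB.RelationsSurj := by
  refine relationsSurj_ofColumns (fun v => ?_) (fun v => ?_) fun v => ?_
  · exact ⟨![v 1, v 0], ![0, -v 1], ![0, -v 0], by
    simp [Fin.forall_fin_succ, Matrix.vecHead, Matrix.vecTail]⟩
  · exact ⟨![v 0 - v 1, 0], ![-v 0, -v 1], ![-v 0, 0], by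
    simp [Fin.forall_fin_succ, Matrix.vecHead, Matrix.vecTail]⟩
  · exact ⟨![-v 0, -v 1], ![v 0 - v 1, 0], ![-v 0, 0], by
    simp [Fin.forall_fin_succ, Matrix.vecHead, Matrix.vecTail]
    ring⟩

/-- The subspace with index a is zero, so every relation already avoids a and is its own
decomposition. -/
theorem relationsSpan_modP (a : Fin 3) : (modP a).RelationsSpan := by
  fin_cases a <;> refine relationsSpan_ofColumns fun v₀ v₁ v₂ v₃ h => ?_
  · exact ⟨v₀, 0, 0, v₁, 0, v₂, 0, v₃, 0, by
    simpa [eq_iff_true_of_subsingleton] using h⟩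
  · exact ⟨0, v₀, 0, v₁, 0, v₂, 0, 0, v₃, by
    simpa [eq_iff_true_of_subsingleton] using h⟩
  · exact ⟨0, 0, v₀, 0, v₁, 0, v₂, 0, v₃, by
    simpa [eq_iff_true_of_subsingleton] using h⟩

theorem relationsSpan_modK (a : Fin 3) : (modK a).RelationsSpan := by
  fin_cases a <;> refine relationsSpan_ofColumns fun v₀ v₁ v₂ v₃ h => ?_
  · exact ⟨v₀, 0, 0, v₁, 0, v₂, 0, v₃, 0, by
    simpa [eq_iff_true_of_subsingleton] using h⟩
  · exact ⟨0, v₀, 0, v₁, 0, v₂, 0, 0, v₃, by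
    simpa [eq_iff_true_of_subsingleton] using h⟩
  · exact ⟨0, 0, v₀, 0, v₁, 0, v₂, 0, v₃, by
    simpa [eq_iff_true_of_subsingleton] using h⟩

/-- The relations have dimension 1 + 2 + 2 + 2 - 4 = 3, and those avoiding each of 1, 2, 3 form a
line. The witnesses are the multiples of three generators of these lines. -/
theorem relationsSpan_modL : modL.RelationsSpan := by
  refine relationsSpan_ofColumns fun v₀ v₁ v₂ v₃ h => ?_
  refine ⟨![-v₃ 1], ![-v₃ 0], ![v₀ 0 + v₃ 0 + v₃ 1], ![-v₃ 0, v₃ 0],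
    ![0, -(v₀ 0 + v₃ 0 + v₃ 1)], ![v₃ 1, -v₃ 1], ![-(v₀ 0 + v₃ 0 + v₃ 1), 0],
    ![0, v₃ 1], ![v₃ 0, 0], ?_⟩
  simp [Fin.forall_fin_succ, funext_iff, Matrix.vecHead, Matrix.vecTail] at h ⊢
  grind

/-- Again three lines in a space of dimension 4 · 2 - 5 = 3. The coefficients are `v₂ 0`, `-v₃ 1 -
v₂ 0` and `-v₂ 1`. -/
theorem relationsSpan_modB : modB.RelationsSpan := by
  refine relationsSpan_ofColumns fun v₀ v₁ v₂ v₃ h => ?_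
  refine ⟨![v₂ 0, v₂ 0], ![0, -v₃ 1 - v₂ 0], ![-v₂ 1, 0], ![-v₂ 0 - v₃ 1, 0],
    ![0, -v₂ 1], ![v₂ 0, 0], ![0, v₂ 1], ![-v₂ 0, -v₂ 0], ![0, v₃ 1 + v₂ 0], ?_⟩
  simp [Fin.forall_fin_succ, funext_iff, Matrix.vecHead, Matrix.vecTail] at h ⊢
  grind

theorem relationsIndep_modP (a : Fin 3) : (modP a).RelationsIndep := by
  fin_cases a <;>
    (refine relationsIndep_ofColumns fun v₀ v₁ v₂ v₃ h => ?_
     simp [Fin.forall_fin_succ] at h ⊢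
     grind)

theorem relationsIndep_modK (a : Fin 3) : (modK a).RelationsIndep := by
  fin_cases a <;>
    (refine relationsIndep_ofColumns fun v₀ v₁ v₂ v₃ h => ?_
     simp [Fin.forall_fin_succ] at h ⊢
     grind)

theorem relationsIndep_modL : modL.RelationsIndep := by
  refine relationsIndep_ofColumns fun v₀ v₁ v₂ v₃ h => ?_
  simp [Fin.forall_fin_succ] at h ⊢
  grind

theorem relationsIndep_modB : modB.RelationsIndep := by
  refine relationsIndep_ofColumns fun v₀ v₁ v₂ v₃ h => ?_
  simp [Fin.forall_fin_succ] at h ⊢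
  grind

end FSModule

/-! ### Consequences of the three structural hypotheses -/

namespace FSModule

theorem Indep.anti {I J : Finset (Fin 4)} (hIJ : I ⊆ J) {M : FSModule} (h : M.Indep J) :
    M.Indep I := fun u hu hI => h u hu fun i hi => hI i fun h => hi (hIJ h)

/-- In dual terms, H has the two coordinate systems (Π₀, Π_i) and (Π₀, Π_j, Π_k). This is all that
the analytic argument uses of the decomposition. -/
theorem BilinearHolderType.spans_indep {M : FSModule} {p : Fin 3 → ℝ≥0∞}
    (h : M.BilinearHolderType p) : M.Spans {1, 2, 3} ∧
      ∃ i j k : Fin 3, i ≠ j ∧ j ≠ k ∧ i ≠ k ∧ (p j)⁻¹ = (p k)⁻¹ ∧ (p k)⁻¹ = 1 - (p i)⁻¹ ∧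
        M.Spans {0, i.succ} ∧ M.Indep {0, i.succ} ∧ M.Spans {0, j.succ, k.succ} ∧
        M.Indep {0, j.succ, k.succ} := by
  obtain ⟨i, j, k, hij, hjk, hik, hp, hp', n₁, n₂, n₃, n₄, hM⟩ := h
  have key : ∀ {Q : FSModule.{0} → Prop}, IsAdditive Q → Q (modP j) → Q (modK j) → Q (modP k) →
      Q (modK k) → Q ((((modP j).power n₁).oplus ((modK j).power n₂)).oplus
        (((modP k).power n₃).oplus ((modK k).power n₄))) := fun hQ h1 h2 h3 h4 =>
    hQ.oplus (hQ.oplus (hQ.power h1 _) (hQ.power h2 _)) (hQ.oplus (hQ.power h3 _) (hQ.power h4 _))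
  have hsub : ∀ a b c : Fin 4, ({a, b} : Finset (Fin 4)) ⊆ {a, c, b} := by
    intro a b c x hx
    simp only [Finset.mem_insert, Finset.mem_singleton] at hx ⊢
    tauto
  have hsub' : ∀ a b c : Fin 4, ({a, b} : Finset (Fin 4)) ⊆ {a, b, c} := by
    intro a b c x hx
    simp only [Finset.mem_insert, Finset.mem_singleton] at hx ⊢
    tauto
  have hswap : ({0, j.succ, k.succ} : Finset (Fin 4)) = {0, k.succ, j.succ} := by
    rw [Finset.pair_comm]
  refine ⟨hM.spans (key (isAdditive_spans _) (spans_one_two_three_modP _)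
    (spans_one_two_three_modK _) (spans_one_two_three_modP _) (spans_one_two_three_modK _)),
    i, j, k, hij, hjk, hik, hp, hp', hM.spans (key (isAdditive_spans _) (spans_modP hij)
      (spans_modK hij) (spans_modP hik) (spans_modK hik)), hM.indep (key (isAdditive_indep _)
      ((indep_modP hij).anti (hsub _ _ _)) ((indep_modK hij).anti (hsub _ _ _))
      ((indep_modP hik).anti (hsub _ _ _)) ((indep_modK hik).anti (hsub _ _ _))),
    hM.spans (key (isAdditive_spans _) ((spans_modP hjk.symm).mono (hsub _ _ _))
      ((spans_modK hjk.symm).mono (hsub _ _ _)) ((spans_modP hjk).mono (hsub' _ _ _))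
      ((spans_modK hjk).mono (hsub' _ _ _))), hM.indep (key (isAdditive_indep _)
      (indep_modP hjk.symm) (indep_modK hjk.symm) ?_ ?_)⟩
  · rw [hswap]; exact indep_modP hjk
  · rw [hswap]; exact indep_modK hjk

/-- In dual terms, (Π₀, Π_a, Π_b) is a coordinate system for all a ≠ b if there are only summands 𝐘
and 𝐙. The extra summands 𝐏⁽ⁱ⁾ and 𝐊⁽ⁱ⁾ leave this true only for the pairs containing i, and then
p_i = 1. -/
theorem YoungType.spans_indep {M : FSModule} {p : Fin 3 → ℝ≥0∞} (h : M.YoungType p) :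
    M.Spans {1, 2, 3} ∧ ∃ i : Fin 3,
      (∀ b ≠ i, M.Spans {0, i.succ, b.succ} ∧ M.Indep {0, i.succ, b.succ}) ∧
      (p i = 1 ∨ ∀ a b : Fin 3, b ≠ a → M.Spans {0, a.succ, b.succ} ∧ M.Indep {0, a.succ, b.succ}) := by
  obtain ⟨-, h1, h2⟩ := h
  by_cases hp : ∀ i, p i ≠ 1
  · obtain ⟨n₁, n₂, hM⟩ := h1 hp
    have key : ∀ {Q : FSModule.{0} → Prop}, IsAdditive Q → Q modY → Q modZ →
        Q ((modY.power n₁).oplus (modZ.power n₂)) := fun hQ h1 h2 =>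
      hQ.oplus (hQ.power h1 _) (hQ.power h2 _)
    have hall : ∀ a b : Fin 3, b ≠ a →
        M.Spans {0, a.succ, b.succ} ∧ M.Indep {0, a.succ, b.succ} := fun a b hab =>
      ⟨hM.spans (key (isAdditive_spans _) (spans_modY hab) (spans_modZ hab)),
        hM.indep (key (isAdditive_indep _) indep_modY indep_modZ)⟩
    exact ⟨hM.spans (key (isAdditive_spans _) spans_one_two_three_modY spans_one_two_three_modZ),
      0, hall 0, Or.inr hall⟩
  · push Not at hp
    obtain ⟨i, hi⟩ := hp
    obtain ⟨n₁, n₂, n₃, n₄, hM⟩ := h2 i hi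
    have key : ∀ {Q : FSModule.{0} → Prop}, IsAdditive Q → Q modY → Q modZ → Q (modP i) →
        Q (modK i) → Q (((modY.power n₁).oplus (modZ.power n₂)).oplus
          (((modP i).power n₃).oplus ((modK i).power n₄))) := fun hQ h1 h2 h3 h4 =>
      hQ.oplus (hQ.oplus (hQ.power h1 _) (hQ.power h2 _))
        (hQ.oplus (hQ.power h3 _) (hQ.power h4 _))
    refine ⟨hM.spans (key (isAdditive_spans _) spans_one_two_three_modY spans_one_two_three_modZ
      (spans_one_two_three_modP _) (spans_one_two_three_modK _)), i, fun b hb => ⟨hM.spans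
        (key (isAdditive_spans _) (spans_modY hb) (spans_modZ hb) ((spans_modP hb).mono ?_)
          ((spans_modK hb).mono ?_)), hM.indep (key (isAdditive_indep _) indep_modY indep_modZ
            (indep_modP hb) (indep_modK hb))⟩, Or.inl hi⟩ <;>
    · intro x hx
      simp only [Finset.mem_insert, Finset.mem_singleton] at hx ⊢
      tauto

theorem LoomisWhitneyType.relations {M : FSModule} {p : Fin 3 → ℝ≥0∞}
    (h : M.LoomisWhitneyType p) : M.Spans {1, 2, 3} ∧ M.RelationsSurj ∧ M.RelationsSpan ∧
      M.RelationsIndep := by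
  obtain ⟨-, n₁, n₂, k, N, hN, hM⟩ := h
  have key : ∀ {Q : FSModule.{0} → Prop}, IsAdditive Q → Q modL → Q modB → (∀ a, Q (modP a)) →
      (∀ a, Q (modK a)) → Q (((modL.power n₁).oplus (modB.power n₂)).oplus (directSum N)) := by
    intro Q hQ h1 h2 h3 h4
    refine hQ.oplus (hQ.oplus (hQ.power h1 _) (hQ.power h2 _)) (hQ.directSum fun s => ?_)
    rcases hN s with ⟨a, ha⟩ | ⟨a, ha⟩
    · rw [← ha]; exact h3 a
    · rw [← ha]; exact h4 a
  exact ⟨hM.spans (key (isAdditive_spans _) spans_one_two_three_modL spans_one_two_three_modB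
      spans_one_two_three_modP spans_one_two_three_modK),
    hM.relationsSurj (key isAdditive_relationsSurj relationsSurj_modL relationsSurj_modB
      relationsSurj_modP relationsSurj_modK),
    hM.relationsSpan (key isAdditive_relationsSpan relationsSpan_modL relationsSpan_modB
      relationsSpan_modP relationsSpan_modK),
    hM.relationsIndep (key isAdditive_relationsIndep relationsIndep_modL relationsIndep_modB
      relationsIndep_modP relationsIndep_modK)⟩

end FSModule

/-! ### Translation from the module to the maps Π_i by duality -/

namespace SBLDatum

variable {H : Type*} {E : Fin 4 → Type*}
  [NormedAddCommGroup H] [InnerProductSpace ℝ H] [FiniteDimensional ℝ H]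
  [∀ i, NormedAddCommGroup (E i)] [∀ i, InnerProductSpace ℝ (E i)]
  [∀ i, FiniteDimensional ℝ (E i)]

/-- Every functional on H is a sum of functionals that factor through the Π_i with i ∈ I, hence
vanishes at a common zero of these maps. -/
theorem eq_zero_of_spans {D : SBLDatum H E} {I : Finset (Fin 4)} (h : D.module.Spans I) {x : H}
    (hx : ∀ i ∈ I, D.proj i x = 0) : x = 0 := by
  refine (Module.forall_dual_apply_eq_zero_iff ℝ x).1 fun φ => ?_
  obtain ⟨u, hu, hI, hφ⟩ := h φ
  let u' : Fin 4 → Module.Dual ℝ H := u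
  have hφ' : ∑ i, u' i = φ := hφ
  rw [← hφ', LinearMap.sum_apply]
  refine Finset.sum_eq_zero fun i _ => ?_
  by_cases hi : i ∈ I
  · obtain ⟨η, hη⟩ := hu i
    have : u' i x = η (D.proj i x) := LinearMap.congr_fun hη.symm x
    rw [this, hx i hi, map_zero]
  · exact LinearMap.congr_fun (show u' i = 0 from hI i hi) x

/-- A joint map is onto if its transpose is injective. The transpose adds up functionals pulled back
by the individual Π_i, so a vanishing sum is a relation supported in I. -/
theorem exists_proj_eq_of_indep {D : SBLDatum H E} {I : Finset (Fin 4)} (h : D.module.Indep I)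
    (e : ∀ i, E i) : ∃ x, ∀ i ∈ I, D.proj i x = e i := by
  classical
  have hJ : Function.Surjective (LinearMap.pi fun i : I => D.proj i) := by
    rw [← LinearMap.dualMap_injective_iff, injective_iff_map_eq_zero]
    intro φ hφ
    let η : ∀ i : I, Module.Dual ℝ (E i) := fun i => φ ∘ₗ LinearMap.single ℝ (fun i : I => E i) i
    have hsum : ∀ x, ∑ i : I, η i (D.proj i x) = 0 := by
      intro x
      have h1 : φ (fun i : I => D.proj i x) = 0 := LinearMap.congr_fun hφ x
      have h2 : (fun i : I => D.proj i x) = ∑ i : I, LinearMap.single ℝ (fun i : I => E i) i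
          (D.proj i x) := (LinearMap.sum_single_apply _ _).symm
      rw [h2, map_sum] at h1
      exact h1
    let u : Fin 4 → Module.Dual ℝ H := fun i =>
      if hi : i ∈ I then (η ⟨i, hi⟩) ∘ₗ D.proj i else 0
    have hu : ∀ i (hi : i ∈ I), u i = (η ⟨i, hi⟩) ∘ₗ D.proj i := fun i hi => dif_pos hi
    have hu0 : ∀ i ∉ I, u i = 0 := fun i hi => dif_neg hi
    have hrel : D.module.IsRelation u := by
      refine ⟨fun i => ?_, ?_⟩
      · by_cases hi : i ∈ I
        · exact ⟨η ⟨i, hi⟩, (hu i hi).symm⟩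
        · exact ⟨0, (hu0 i hi).symm⟩
      · refine LinearMap.ext (M := H) fun x => ?_
        refine (LinearMap.sum_apply (Finset.univ) u x).trans ?_
        have h1 : ∑ i, (u i) x = ∑ i ∈ I, (u i) x := by
          refine (Finset.sum_subset (Finset.subset_univ I) fun i _ hi => ?_).symm
          rw [hu0 i hi]; rfl
        rw [h1, ← Finset.sum_coe_sort]
        refine Eq.trans (Finset.sum_congr rfl fun i _ => ?_) (hsum x)
        rw [hu i i.2]; rfl
    have hzero := h u hrel hu0
    refine LinearMap.pi_ext' fun i => ?_
    refine LinearMap.ext fun y => ?_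
    obtain ⟨x, rfl⟩ := D.surj i y
    have h1 : u i = 0 := hzero i
    rw [hu i i.2] at h1
    exact LinearMap.congr_fun h1 x
  obtain ⟨x, hx⟩ := hJ fun i => e i
  exact ⟨x, fun i hi => congrFun hx ⟨i, hi⟩⟩

/-- The tuples of vectors `e_i` in `H_i` with `∑ Π_i^* e_i = 0`. -/
def relationSpace (D : SBLDatum H E) : Submodule ℝ (∀ i, E i) where
  carrier := {e | ∀ x, ∑ i, inner ℝ (e i) (D.proj i x) = 0}
  add_mem' := by
    intro e e' he he' x
    simp only [Pi.add_apply, inner_add_left, Finset.sum_add_distrib, he x, he' x, add_zero]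
  zero_mem' := by
    intro x
    simp
  smul_mem' := by
    intro c e he x
    simp only [Pi.smul_apply, real_inner_smul_left, ← Finset.mul_sum, he x, mul_zero]

/-- The functional `x ↦ ⟪e, Π_i x⟫` on `H`. -/
noncomputable def pullback (D : SBLDatum H E) (i : Fin 4) : E i →ₗ[ℝ] Module.Dual ℝ H :=
  (D.proj i).dualMap ∘ₗ innerₗ (E i)

theorem pullback_apply (D : SBLDatum H E) (i : Fin 4) (e : E i) (x : H) :
    D.pullback i e x = inner ℝ e (D.proj i x) := rfl

theorem pullback_injective (D : SBLDatum H E) (i : Fin 4) :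
    Function.Injective (D.pullback i) := by
  rw [injective_iff_map_eq_zero]
  intro e he
  obtain ⟨x, hx⟩ := D.surj i e
  have h1 := LinearMap.congr_fun he x
  rw [pullback_apply, hx] at h1
  exact inner_self_eq_zero.1 h1

theorem exists_pullback_eq {D : SBLDatum H E} {i : Fin 4} {u : D.module.carrier}
    (hu : u ∈ D.module.sub i) : ∃ e, D.pullback i e = u := by
  obtain ⟨η, hη⟩ := hu
  refine ⟨(InnerProductSpace.toDual ℝ (E i)).symm (LinearMap.toContinuousLinearMap η),
    Eq.trans ?_ hη⟩
  refine LinearMap.ext fun x => ?_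
  rw [pullback_apply, InnerProductSpace.toDual_symm_apply]
  rfl

theorem isRelation_pullback {D : SBLDatum H E} {e : ∀ i, E i} :
    D.module.IsRelation (fun i => D.pullback i (e i)) ↔ e ∈ D.relationSpace := by
  have h1 : ∀ x, (∑ i, D.pullback i (e i)) x = ∑ i, inner ℝ (e i) (D.proj i x) := fun x =>
    LinearMap.sum_apply _ _ _
  constructor
  · rintro ⟨-, h⟩ x
    exact (h1 x).symm.trans (LinearMap.congr_fun (show ∑ i, D.pullback i (e i) = 0 from h) x)
  · intro h
    exact ⟨fun i => ⟨innerₗ (E i) (e i), rfl⟩, LinearMap.ext (M := H) fun x => (h1 x).trans (h x)⟩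

theorem exists_relation {D : SBLDatum H E} {u : Fin 4 → D.module.carrier}
    (hu : D.module.IsRelation u) : ∃ e ∈ D.relationSpace, ∀ i, D.pullback i (e i) = u i := by
  choose e he using fun i => exists_pullback_eq (hu.1 i)
  have h1 : (fun i => D.pullback i (e i)) = u := funext he
  exact ⟨e, isRelation_pullback.1 (by rw [h1]; exact hu), he⟩

theorem exists_mem_relationSpace {D : SBLDatum H E} (h : D.module.RelationsSurj) (a : Fin 3)
    (y : E a.succ) : ∃ e ∈ D.relationSpace, e a.succ = y := by
  obtain ⟨u, hu, huy⟩ := h a (D.pullback a.succ y) ⟨innerₗ (E a.succ) y, rfl⟩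
  obtain ⟨e, he, heu⟩ := exists_relation hu
  exact ⟨e, he, D.pullback_injective _ ((heu _).trans huy)⟩

/-- The relations that do not involve the coordinate `a`. -/
def relationSpaceOff (D : SBLDatum H E) (a : Fin 3) : Submodule ℝ (∀ i, E i) :=
  D.relationSpace ⊓ LinearMap.ker (LinearMap.proj a.succ)

theorem mem_relationSpaceOff {D : SBLDatum H E} {a : Fin 3} {e : ∀ i, E i} :
    e ∈ D.relationSpaceOff a ↔ e ∈ D.relationSpace ∧ e a.succ = 0 := Iff.rfl

theorem exists_sum_eq_of_relationsSpan {D : SBLDatum H E} (h : D.module.RelationsSpan)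
    {e : ∀ i, E i} (he : e ∈ D.relationSpace) :
    ∃ w : ∀ a, D.relationSpaceOff a, ∑ a, (w a : ∀ i, E i) = e := by
  obtain ⟨w, hw, hwe⟩ := h _ (isRelation_pullback.2 he)
  choose v hv hvw using fun a => exists_relation (hw a).1
  refine ⟨fun a => ⟨v a, hv a, D.pullback_injective _ ?_⟩, funext fun i => ?_⟩
  · exact (hvw a _).trans ((hw a).2.trans (map_zero _).symm)
  · refine D.pullback_injective i (Eq.trans ?_ (hwe i))
    rw [Finset.sum_apply, map_sum]
    exact Finset.sum_congr rfl fun a _ => hvw a i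

theorem eq_zero_of_relationsIndep {D : SBLDatum H E} (h : D.module.RelationsIndep)
    {w : ∀ a, D.relationSpaceOff a} (hw : ∑ a, (w a : ∀ i, E i) = 0) : w = 0 := by
  have h1 := h (fun a i => D.pullback i ((w a : ∀ i, E i) i))
    (fun a => ⟨isRelation_pullback.2 (w a).2.1, ?_⟩) ?_
  · refine funext fun a => Subtype.ext (funext fun i => D.pullback_injective i ?_)
    exact (h1 a i).trans (map_zero _).symm
  · exact (congrArg _ (mem_relationSpaceOff.1 (w a).2).2).trans (map_zero _)
  · intro i
    refine Eq.trans (map_sum (D.pullback i) (fun a => (w a : ∀ i, E i) i) Finset.univ).symm ?_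
    rw [← Finset.sum_apply, hw]
    exact map_zero _

end SBLDatum

/-! ### Coordinates on the space of relations -/

namespace SBLDatum

variable {H : Type*} {E : Fin 4 → Type*}
  [NormedAddCommGroup H] [InnerProductSpace ℝ H] [FiniteDimensional ℝ H]
  [∀ i, NormedAddCommGroup (E i)] [∀ i, InnerProductSpace ℝ (E i)]
  [∀ i, FiniteDimensional ℝ (E i)] {D : SBLDatum H E}

theorem sum_relationSpaceOff_bijective (hS : D.module.RelationsSpan)
    (hI : D.module.RelationsIndep) :
    Function.Bijective (fun w : ∀ a, D.relationSpaceOff a =>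
      (⟨∑ a, (w a : ∀ i, E i), sum_mem fun a _ => (w a).2.1⟩ : D.relationSpace)) := by
  constructor
  · intro w w' h
    have h1 : ∑ a, ((w - w') a : ∀ i, E i) = 0 := by
      have h2 : ∑ a, (w a : ∀ i, E i) = ∑ a, (w' a : ∀ i, E i) := congrArg Subtype.val h
      simp only [Pi.sub_apply, Submodule.coe_sub, Finset.sum_sub_distrib, h2, sub_self]
    exact sub_eq_zero.1 (eq_zero_of_relationsIndep hI h1)
  · intro e
    obtain ⟨w, hw⟩ := exists_sum_eq_of_relationsSpan hS e.2
    exact ⟨w, Subtype.ext hw⟩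

/-- Evaluation at index a maps the relation space onto H_a, with kernel the relations avoiding a. It
is therefore an isomorphism on the complement formed by the relations avoiding b and those avoiding
c. -/
theorem add_apply_relationSpaceOff_bijective (hJ : D.module.RelationsSurj)
    (hS : D.module.RelationsSpan) (hI : D.module.RelationsIndep) {a b c : Fin 3}
    (hab : a ≠ b) (hbc : b ≠ c) (hac : a ≠ c) :
    Function.Bijective (fun w : D.relationSpaceOff b × D.relationSpaceOff c =>
      (w.1 : ∀ i, E i) a.succ + (w.2 : ∀ i, E i) a.succ) := by
  classical
  have huniv : (Finset.univ : Finset (Fin 3)) = {a, b, c} := by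
    revert hab hbc hac
    revert a b c
    decide
  have hsum : ∀ f : Fin 3 → ∀ i, E i, ∑ s, f s = f a + f b + f c := by
    intro f
    rw [huniv, Finset.sum_insert (by simp [hab, hac]), Finset.sum_insert (by simp [hbc]),
      Finset.sum_singleton, add_assoc]
  constructor
  · intro w w' h
    have hmem : ((w.1 - w'.1 : D.relationSpaceOff b) : ∀ i, E i) +
        ((w.2 - w'.2 : D.relationSpaceOff c) : ∀ i, E i) ∈ D.relationSpaceOff a := by
      refine mem_relationSpaceOff.2 ⟨add_mem (w.1 - w'.1).2.1 (w.2 - w'.2).2.1, ?_⟩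
      simp only [Submodule.coe_sub, Pi.add_apply, Pi.sub_apply]
      rw [sub_add_sub_comm, sub_eq_zero]
      exact h
    -- A triple with sum zero whose entries at b and c are the differences in question; independence
    -- forces it to vanish.
    let W : ∀ s, D.relationSpaceOff s :=
      Function.update (Function.update (Function.update 0 a (-⟨_, hmem⟩)) b (w.1 - w'.1)) c
        (w.2 - w'.2)
    have hWc : W c = w.2 - w'.2 := Function.update_self ..
    have hWb : W b = w.1 - w'.1 :=
      (Function.update_of_ne hbc ..).trans (Function.update_self ..)
    have hWa : W a = -⟨_, hmem⟩ := (Function.update_of_ne hac ..).trans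
      ((Function.update_of_ne hab ..).trans (Function.update_self ..))
    have hW : W = 0 := by
      refine eq_zero_of_relationsIndep hI ?_
      rw [hsum, hWa, hWb, hWc]
      simp only [Submodule.coe_neg, Submodule.coe_sub]
      abel
    refine Prod.ext ?_ ?_
    · rw [← sub_eq_zero, ← hWb, hW]; rfl
    · rw [← sub_eq_zero, ← hWc, hW]; rfl
  · intro y
    obtain ⟨e, he, hey⟩ := exists_mem_relationSpace hJ a y
    obtain ⟨w, hw⟩ := exists_sum_eq_of_relationsSpan hS he
    refine ⟨(w b, w c), ?_⟩
    rw [hsum] at hw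
    rw [← hey, ← hw]
    simp only [Pi.add_apply, (mem_relationSpaceOff.1 (w a).2).2, zero_add]

/-- Coordinates on the space of relations in which the components `1, 2, 3` of a relation depend,
bijectively, on two of the three coordinates each. -/
theorem exists_coordinates_relationSpace (hJ : D.module.RelationsSurj)
    (hS : D.module.RelationsSpan) (hI : D.module.RelationsIndep) : ∃ n : Fin 3 → ℕ,
      ∃ (R : (EuclideanSpace ℝ (Fin (n 0)) × EuclideanSpace ℝ (Fin (n 1)) ×
          EuclideanSpace ℝ (Fin (n 2))) ≃ₗ[ℝ] D.relationSpace)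
        (A₁ : (EuclideanSpace ℝ (Fin (n 1)) × EuclideanSpace ℝ (Fin (n 2))) ≃ₗ[ℝ] E 1)
        (A₂ : (EuclideanSpace ℝ (Fin (n 0)) × EuclideanSpace ℝ (Fin (n 2))) ≃ₗ[ℝ] E 2)
        (A₃ : (EuclideanSpace ℝ (Fin (n 0)) × EuclideanSpace ℝ (Fin (n 1))) ≃ₗ[ℝ] E 3),
        ∀ x y z, (R (x, y, z) : ∀ i, E i) 1 = A₁ (y, z) ∧
          (R (x, y, z) : ∀ i, E i) 2 = A₂ (x, z) ∧ (R (x, y, z) : ∀ i, E i) 3 = A₃ (x, y) := by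
  let n : Fin 3 → ℕ := fun a => Module.finrank ℝ (D.relationSpaceOff a)
  have T : ∀ a, EuclideanSpace ℝ (Fin (n a)) ≃ₗ[ℝ] D.relationSpaceOff a := fun a =>
    LinearEquiv.ofFinrankEq _ _ finrank_euclideanSpace_fin
  have hA : ∀ {a b c : Fin 3}, a ≠ b → b ≠ c → a ≠ c →
      ∃ A : (EuclideanSpace ℝ (Fin (n b)) × EuclideanSpace ℝ (Fin (n c))) ≃ₗ[ℝ] E a.succ,
        ∀ y z, A (y, z) = (T b y : ∀ i, E i) a.succ + (T c z : ∀ i, E i) a.succ := by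
    intro a b c hab hbc hac
    let L : (D.relationSpaceOff b × D.relationSpaceOff c) →ₗ[ℝ] E a.succ :=
      (LinearMap.proj (φ := E) a.succ ∘ₗ (D.relationSpaceOff b).subtype).coprod
        (LinearMap.proj (φ := E) a.succ ∘ₗ (D.relationSpaceOff c).subtype)
    exact ⟨((T b).prodCongr (T c)).trans (LinearEquiv.ofBijective L
      (add_apply_relationSpaceOff_bijective hJ hS hI hab hbc hac)), fun y z => rfl⟩
  obtain ⟨A₁, hA₁⟩ := hA (a := 0) (b := 1) (c := 2) (by decide) (by decide) (by decide)
  obtain ⟨A₂, hA₂⟩ := hA (a := 1) (b := 0) (c := 2) (by decide) (by decide) (by decide)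
  obtain ⟨A₃, hA₃⟩ := hA (a := 2) (b := 0) (c := 1) (by decide) (by decide) (by decide)
  let L : (EuclideanSpace ℝ (Fin (n 0)) × EuclideanSpace ℝ (Fin (n 1)) ×
      EuclideanSpace ℝ (Fin (n 2))) →ₗ[ℝ] D.relationSpace :=
    (Submodule.inclusion inf_le_left ∘ₗ (T 0).toLinearMap).coprod
      ((Submodule.inclusion inf_le_left ∘ₗ (T 1).toLinearMap).coprod
        (Submodule.inclusion inf_le_left ∘ₗ (T 2).toLinearMap))
  have hL : ∀ x y z, (L (x, y, z) : ∀ i, E i) = (T 0 x : ∀ i, E i) + ((T 1 y : ∀ i, E i) +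
    (T 2 z : ∀ i, E i)) := fun x y z => rfl
  have hLb : Function.Bijective L := by
    have hbij := sum_relationSpaceOff_bijective hS hI
    constructor
    · rw [injective_iff_map_eq_zero]
      rintro ⟨x, y, z⟩ h
      let w : ∀ a, D.relationSpaceOff a := Fin.cons (T 0 x) (Fin.cons (T 1 y)
        (Fin.cons (T 2 z) finZeroElim))
      have hw : w = 0 := by
        refine eq_zero_of_relationsIndep hI ?_
        rw [Fin.sum_univ_three, add_assoc]
        exact (hL x y z).symm.trans (congrArg Subtype.val h)
      have h0 : T 0 x = 0 := congrFun hw 0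
      have h1 : T 1 y = 0 := congrFun hw 1
      have h2 : T 2 z = 0 := congrFun hw 2
      rw [(T 0).map_eq_zero_iff] at h0
      rw [(T 1).map_eq_zero_iff] at h1
      rw [(T 2).map_eq_zero_iff] at h2
      rw [h0, h1, h2]; rfl
    · intro e
      obtain ⟨w, hw⟩ := exists_sum_eq_of_relationsSpan hS e.2
      refine ⟨((T 0).symm (w 0), (T 1).symm (w 1), (T 2).symm (w 2)), Subtype.ext ?_⟩
      rw [hL, ← hw, Fin.sum_univ_three, add_assoc]
      simp only [LinearEquiv.apply_symm_apply]
  refine ⟨n, LinearEquiv.ofBijective L hLb, A₁, A₂, A₃, fun x y z => ?_⟩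
  have h0 : (T 0 x : ∀ i, E i) 1 = 0 := (T 0 x).2.2
  have h1 : (T 1 y : ∀ i, E i) 2 = 0 := (T 1 y).2.2
  have h2 : (T 2 z : ∀ i, E i) 3 = 0 := (T 2 z).2.2
  refine ⟨?_, ?_, ?_⟩
  · rw [LinearEquiv.ofBijective_apply, hL, hA₁]
    simp only [Pi.add_apply, h0, zero_add]
    rfl
  · rw [LinearEquiv.ofBijective_apply, hL, hA₂]
    simp only [Pi.add_apply, h1, zero_add]
    rfl
  · rw [LinearEquiv.ofBijective_apply, hL, hA₃]
    simp only [Pi.add_apply, h2, add_zero]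
    rfl

end SBLDatum

/-! ### Linear changes of variables -/

instance isAddHaarMeasure_volume_prod {U W : Type*} [NormedAddCommGroup U] [NormedSpace ℝ U]
    [FiniteDimensional ℝ U] [MeasureSpace U] [BorelSpace U] [(volume : Measure U).IsAddHaarMeasure]
    [NormedAddCommGroup W] [NormedSpace ℝ W] [FiniteDimensional ℝ W] [MeasureSpace W]
    [BorelSpace W] [(volume : Measure W).IsAddHaarMeasure] :
    (volume : Measure (U × W)).IsAddHaarMeasure := by
  rw [Measure.volume_eq_prod]
  infer_instance

section ChangeOfVariables

variable {U W : Type*} [NormedAddCommGroup U] [NormedSpace ℝ U] [FiniteDimensional ℝ U]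
  [MeasureSpace U] [BorelSpace U] [(volume : Measure U).IsAddHaarMeasure]
  [NormedAddCommGroup W] [NormedSpace ℝ W] [FiniteDimensional ℝ W]
  [MeasureSpace W] [BorelSpace W] [(volume : Measure W).IsAddHaarMeasure]

/-- The constant by which a linear isomorphism scales the volume. -/
def IsVolumeScaling (S : U ≃ₗ[ℝ] W) (c : ℝ≥0) : Prop :=
  c ≠ 0 ∧ MeasurableEmbedding S ∧ Measure.map S volume = c • (volume : Measure W)

omit [FiniteDimensional ℝ W] in
-- Uniqueness of Haar measure up to a scalar.
theorem exists_isVolumeScaling (S : U ≃ₗ[ℝ] W) : ∃ c, IsVolumeScaling S c := by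
  have : FiniteDimensional ℝ W := S.finiteDimensional
  have hSm : MeasurableEmbedding S :=
    S.toContinuousLinearEquiv.toHomeomorph.measurableEmbedding
  have hH : (Measure.map S (volume : Measure U)).IsAddHaarMeasure :=
    S.toContinuousLinearEquiv.isAddHaarMeasure_map volume
  exact ⟨_, (Measure.addHaarScalarFactor_pos_of_isAddHaarMeasure _ _).ne', hSm,
    Measure.isAddLeftInvariant_eq_smul (Measure.map S volume) (volume : Measure W)⟩

namespace IsVolumeScaling

omit [FiniteDimensional ℝ U] [FiniteDimensional ℝ W] [BorelSpace U] [BorelSpace W]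
  [(volume : Measure U).IsAddHaarMeasure] [(volume : Measure W).IsAddHaarMeasure]

variable {S : U ≃ₗ[ℝ] W} {c : ℝ≥0}

theorem lintegral_comp (h : IsVolumeScaling S c) (f : W → ℝ≥0∞) :
    ∫⁻ u, f (S u) = c * ∫⁻ w, f w := by
  rw [← h.2.1.lintegral_map, h.2.2, lintegral_smul_measure]
  rfl

theorem integral_comp (h : IsVolumeScaling S c) (f : W → ℂ) :
    ∫ u, f (S u) = (c : ℝ) • ∫ w, f w := by
  rw [← h.2.1.integral_map, h.2.2, integral_smul_nnreal_measure, NNReal.smul_def]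

theorem integrable_comp_iff (h : IsVolumeScaling S c) {f : W → ℂ} :
    Integrable (fun u => f (S u)) ↔ Integrable f := by
  have h1 := h.2.1.integrable_map_iff (μ := volume) (g := f)
  rw [h.2.2] at h1
  refine h1.symm.trans ?_
  have h2 := integrable_smul_measure (μ := (volume : Measure W)) (f := f) (c := (c : ℝ≥0∞))
    (by simpa using h.1) (by simp)
  exact h2

end IsVolumeScaling

end ChangeOfVariables

/-! ### Integration of Schwartz functions over the fibres of a linear map -/

theorem SchwartzMap.exists_norm_le_rpow {U : Type*} [NormedAddCommGroup U] [NormedSpace ℝ U]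
    (Φ : 𝓢(U, ℂ)) (k : ℕ) : ∃ C : ℝ, 0 ≤ C ∧ ∀ u, ‖Φ u‖ ≤ C * (1 + ‖u‖) ^ (-(k : ℝ)) := by
  refine ⟨2 ^ k * (Finset.Iic (k, 0)).sup (fun m => SchwartzMap.seminorm ℝ m.1 m.2) Φ,
    by positivity, fun u => ?_⟩
  have h := one_add_le_sup_seminorm_apply (𝕜 := ℝ) (m := (k, 0)) le_rfl le_rfl Φ u
  rw [norm_iteratedFDeriv_zero] at h
  have hpos : (0 : ℝ) < (1 + ‖u‖) ^ k := by positivity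
  rw [Real.rpow_neg (by positivity), Real.rpow_natCast, ← div_eq_mul_inv, le_div_iff₀ hpos]
  linarith

section FiberIntegral

variable {U V N : Type*} [NormedAddCommGroup U] [InnerProductSpace ℝ U] [FiniteDimensional ℝ U]
  [MeasurableSpace U] [BorelSpace U]
  [NormedAddCommGroup V] [InnerProductSpace ℝ V] [FiniteDimensional ℝ V]
  [MeasurableSpace V] [BorelSpace V]
  [NormedAddCommGroup N] [InnerProductSpace ℝ N] [FiniteDimensional ℝ N]
  [MeasurableSpace N] [BorelSpace N]

omit [MeasurableSpace U] [BorelSpace U] [MeasurableSpace V] [BorelSpace V]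
  [MeasurableSpace N] [BorelSpace N] in
omit [FiniteDimensional ℝ V] [FiniteDimensional ℝ N] in
-- The fibre coordinate n is a bounded linear function of the point, so decay on U gives decay in n
-- uniformly in h. This is the majorant for the fibre integrals.
theorem SchwartzMap.exists_norm_symm_le_rpow (S : U ≃ₗ[ℝ] V × N) (Φ : 𝓢(U, ℂ)) (k : ℕ) :
    ∃ C : ℝ, 0 ≤ C ∧ ∀ h n, ‖Φ (S.symm (h, n))‖ ≤ C * (1 + ‖n‖) ^ (-(k : ℝ)) := by
  obtain ⟨C, hC, hΦ⟩ := Φ.exists_norm_le_rpow k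
  let T := S.toContinuousLinearEquiv.toContinuousLinearMap
  refine ⟨C * (1 + ‖T‖) ^ (k : ℝ), by positivity, fun h n => (hΦ _).trans ?_⟩
  rw [mul_assoc]
  refine mul_le_mul_of_nonneg_left ?_ hC
  set u := S.symm (h, n) with hu
  have h1 : ‖n‖ ≤ ‖T‖ * ‖u‖ := by
    have h2 : T u = (h, n) := S.apply_symm_apply (h, n)
    calc ‖n‖ ≤ ‖T u‖ := by rw [h2]; exact le_max_right _ _
      _ ≤ ‖T‖ * ‖u‖ := T.le_opNorm u
  have h3 : 1 + ‖n‖ ≤ (1 + ‖T‖) * (1 + ‖u‖) := by nlinarith [norm_nonneg u, norm_nonneg T]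
  rw [Real.rpow_neg (by positivity), Real.rpow_neg (by positivity), ← div_eq_mul_inv,
    le_div_iff₀ (by positivity), inv_mul_le_iff₀ (by positivity), mul_comm,
    ← Real.mul_rpow (by positivity) (by positivity)]
  exact Real.rpow_le_rpow (by positivity) h3 (by positivity)

omit [MeasurableSpace U] [BorelSpace U] [MeasurableSpace V] [BorelSpace V] in
theorem SchwartzMap.continuous_integral_symm (S : U ≃ₗ[ℝ] V × N) (Φ : 𝓢(U, ℂ)) :
    Continuous (fun h => ∫ n, Φ (S.symm (h, n))) := by
  obtain ⟨C, -, hΦ⟩ := Φ.exists_norm_symm_le_rpow S (Module.finrank ℝ N + 1)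
  have hS : Continuous S.symm := S.symm.toContinuousLinearEquiv.continuous
  refine continuous_of_dominated (bound := fun n => C * (1 + ‖n‖) ^
    (-((Module.finrank ℝ N + 1 : ℕ) : ℝ))) (fun h => ?_) (fun h => ae_of_all _ (hΦ h)) ?_
    (ae_of_all _ fun n => ?_)
  · exact (Φ.continuous.comp (hS.comp (by fun_prop))).aestronglyMeasurable
  · refine (integrable_one_add_norm ?_).const_mul C
    push_cast
    linarith
  · exact Φ.continuous.comp (hS.comp (by fun_prop))

theorem IsVolumeScaling.integral_comp_fst_mul {S : U ≃ₗ[ℝ] V × N} {c : ℝ≥0}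
    (h : IsVolumeScaling S c) (Φ : 𝓢(U, ℂ)) {g : V → ℂ} (hg : Continuous g) {B : ℝ}
    (hB : ∀ v, ‖g v‖ ≤ B) :
    Integrable (fun v => ((c : ℝ) • ∫ n, Φ (S.symm (v, n)))) ∧
    ∫ u, Φ u * g (S u).1 = ∫ v, ((c : ℝ) • ∫ n, Φ (S.symm (v, n))) * g v := by
  have h1 : Integrable (fun w : V × N => Φ (S.symm w)) := by
    refine h.integrable_comp_iff.1 ?_
    simpa using Φ.integrable (μ := volume)
  have h2 : Integrable (fun w : V × N => Φ (S.symm w) * g w.1) := by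
    refine h1.mul_bdd (c := B) (hg.comp continuous_fst).aestronglyMeasurable
      (ae_of_all _ fun w => hB w.1)
  refine ⟨h1.integral_prod_left.smul (c : ℝ), ?_⟩
  have h3 := h.integral_comp (fun w => Φ (S.symm w) * g w.1)
  simp only [LinearEquiv.symm_apply_apply] at h3
  rw [h3, Measure.volume_eq_prod, integral_prod _ h2, ← integral_smul]
  refine integral_congr_ae (ae_of_all _ fun v => ?_)
  simp only
  rw [integral_mul_const, smul_mul_assoc]

/-- The integrals of a Schwartz function over the fibres of a surjective linear map
`P = fst ∘ S` form a Schwartz function, whose Fourier transform is the composition of the Fourier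
transform of the given function with the adjoint of `P`. -/
theorem SchwartzMap.exists_fiberIntegral {S : U ≃ₗ[ℝ] V × N} {c : ℝ≥0}
    (h : IsVolumeScaling S c) {P : U →ₗ[ℝ] V} (hP : ∀ u, (S u).1 = P u) (Φ : 𝓢(U, ℂ)) :
    ∃ φ : 𝓢(V, ℂ), (∀ v, φ v = (c : ℝ) • ∫ n, Φ (S.symm (v, n))) ∧
      (∀ ξ, 𝓕 φ ξ = 𝓕 Φ (P.adjoint ξ)) ∧
      ∀ g : V → ℂ, Continuous g → (∃ B : ℝ, ∀ v, ‖g v‖ ≤ B) →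
        ∫ u, Φ u * g (P u) = ∫ v, φ v * g v := by
  have hPs : Function.Surjective P := fun v => ⟨S.symm (v, 0), by simp [← hP]⟩
  have hinj : Function.Injective P.adjoint := by
    rw [injective_iff_map_eq_zero]
    intro ξ hξ
    obtain ⟨u, hu⟩ := hPs ξ
    rw [← inner_self_eq_zero (𝕜 := ℝ)]
    nth_rewrite 2 [← hu]
    rw [← LinearMap.adjoint_inner_left, hξ, inner_zero_left]
  obtain ⟨K, -, hK⟩ := P.adjoint.exists_antilipschitzWith (LinearMap.ker_eq_bot.2 hinj)
  let A := LinearMap.toContinuousLinearMap P.adjoint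
  have hA : AntilipschitzWith K A := hK
  -- φ is defined on the Fourier side, where 𝓕 Φ ∘ P^* is Schwartz because P^* is injective; this
  -- avoids differentiating the fibre integrals. Fourier inversion then identifies φ with the fibre
  -- integral ψ.
  let φ : 𝓢(V, ℂ) := 𝓕⁻ (compCLMOfAntilipschitz ℂ A.hasTemperateGrowth hA (𝓕 Φ))
  have hφ : 𝓕 φ = compCLMOfAntilipschitz ℂ A.hasTemperateGrowth hA (𝓕 Φ) :=
    fourier_fourierInv_eq _
  have hφA : ∀ ξ, 𝓕 φ ξ = 𝓕 Φ (P.adjoint ξ) := fun ξ => by rw [hφ]; rfl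
  set ψ : V → ℂ := fun v => (c : ℝ) • ∫ n, Φ (S.symm (v, n)) with hψ
  have hψc : Continuous ψ := (Φ.continuous_integral_symm S).const_smul (c : ℝ)
  have key : ∀ g : V → ℂ, Continuous g → (∃ B : ℝ, ∀ v, ‖g v‖ ≤ B) →
      ∫ u, Φ u * g (P u) = ∫ v, ψ v * g v := by
    rintro g hg ⟨B, hB⟩
    simp only [← hP]
    exact (h.integral_comp_fst_mul Φ hg hB).2
  have hψi : Integrable ψ :=
    (h.integral_comp_fst_mul Φ (g := fun _ => 0) continuous_const (B := 0) (by simp)).1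
  -- The fibre identity is tested on characters, for which ⟪P u, ξ⟫ = ⟪u, P^* ξ⟫.
  have hF : 𝓕 ψ = 𝓕 (φ : V → ℂ) := by
    funext ξ
    have h1 := key (fun v => Complex.exp (↑(-2 * Real.pi * inner ℝ v ξ) * Complex.I))
      (by fun_prop) ⟨1, fun v => (Complex.norm_exp_ofReal_mul_I _).le⟩
    rw [← fourier_coe, hφA, fourier_coe, Real.fourier_eq', Real.fourier_eq']
    simp only [smul_eq_mul]
    simp only [LinearMap.adjoint_inner_right]
    simp only [mul_comm _ (ψ _), mul_comm _ (Φ _)]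
    exact h1.symm
  have hψφ : ψ = φ := by
    rw [← hψc.fourierInv_fourier_eq hψi (by rw [hF, ← fourier_coe]; exact (𝓕 φ).integrable), hF,
      φ.continuous.fourierInv_fourier_eq φ.integrable
        (by rw [← fourier_coe]; exact (𝓕 φ).integrable)]
  refine ⟨φ, fun v => (congrFun hψφ v).symm, hφA, fun g hg hB => ?_⟩
  rw [key g hg hB, hψφ]

end FiberIntegral

/-! ### Products of Schwartz functions of different linear projections -/

section RapidDecay

variable {V W : Type*} [NormedAddCommGroup V] [NormedSpace ℝ V]
  [NormedAddCommGroup W] [NormedSpace ℝ W]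

/-- All derivatives of `F` decay faster than any power of the weight `w`. -/
def HasRapidDecay (F : V → ℂ) (w : V → ℝ) : Prop :=
  ContDiff ℝ (⊤ : ℕ∞) F ∧
    ∀ k m : ℕ, ∃ C : ℝ, ∀ x, ‖iteratedFDeriv ℝ k F x‖ * w x ^ m ≤ C

theorem HasRapidDecay.mul {F G : V → ℂ} {w w' : V → ℝ} (hF : HasRapidDecay F w)
    (hG : HasRapidDecay G w') (hw : ∀ x, 0 ≤ w x) (hw' : ∀ x, 0 ≤ w' x) :
    HasRapidDecay (fun x => F x * G x) (fun x => w x * w' x) := by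
  refine ⟨hF.1.mul hG.1, fun k m => ?_⟩
  choose C hC using fun i => hF.2 i m
  choose C' hC' using fun i => hG.2 i m
  refine ⟨∑ i ∈ Finset.range (k + 1), (k.choose i : ℝ) * C i * C' (k - i), fun x => ?_⟩
  have h1 := norm_iteratedFDeriv_mul_le hF.1 hG.1 x (n := k) (by exact_mod_cast le_top)
  have hpos : 0 ≤ (w x * w' x) ^ m := pow_nonneg (mul_nonneg (hw x) (hw' x)) m
  refine (mul_le_mul_of_nonneg_right h1 hpos).trans ?_
  rw [Finset.sum_mul]
  refine Finset.sum_le_sum fun i _ => ?_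
  have h2 := mul_le_mul (hC i x) (hC' (k - i) x)
    (mul_nonneg (norm_nonneg _) (pow_nonneg (hw' x) m))
    ((mul_nonneg (norm_nonneg _) (pow_nonneg (hw x) m)).trans (hC i x))
  rw [mul_pow, mul_assoc (k.choose i : ℝ) (C i)]
  refine le_trans (le_of_eq ?_) (mul_le_mul_of_nonneg_left h2 (Nat.cast_nonneg (k.choose i)))
  ring

theorem SchwartzMap.hasRapidDecay_comp (f : 𝓢(W, ℂ)) (A : V →L[ℝ] W) :
    HasRapidDecay (fun x => f (A x)) (fun x => 1 + ‖A x‖) := by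
  refine ⟨(f.smooth _).comp A.contDiff, fun k m => ?_⟩
  refine ⟨(2 ^ m * (Finset.Iic (m, k)).sup (fun m => SchwartzMap.seminorm ℝ m.1 m.2) f) *
    ‖A‖ ^ k, fun x => ?_⟩
  have h1 := one_add_le_sup_seminorm_apply (𝕜 := ℝ) (m := (m, k)) le_rfl le_rfl f (A x)
  have h2 : ‖iteratedFDeriv ℝ k (fun x => f (A x)) x‖ ≤ ‖iteratedFDeriv ℝ k f (A x)‖ * ‖A‖ ^ k := by
    have h3 := A.iteratedFDeriv_comp_right (f := f) (f.smooth (⊤ : ℕ∞)) x (i := k)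
      (by exact_mod_cast le_top)
    refine (congrArg norm h3).trans_le ?_
    refine (ContinuousMultilinearMap.norm_compContinuousLinearMap_le _ _).trans ?_
    simp
  calc ‖iteratedFDeriv ℝ k (fun x => f (A x)) x‖ * (1 + ‖A x‖) ^ m
      ≤ (‖iteratedFDeriv ℝ k f (A x)‖ * ‖A‖ ^ k) * (1 + ‖A x‖) ^ m := by gcongr
    _ = ((1 + ‖A x‖) ^ m * ‖iteratedFDeriv ℝ k f (A x)‖) * ‖A‖ ^ k := by ring
    _ ≤ _ := by gcongr

theorem HasRapidDecay.exists_schwartzMap {F : V → ℂ} {w : V → ℝ} (hF : HasRapidDecay F w)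
    {K : ℝ≥0} (hw : ∀ x, ‖x‖ ≤ K * w x) : ∃ Φ : 𝓢(V, ℂ), ∀ x, Φ x = F x := by
  refine ⟨⟨F, hF.1, fun m k => ?_⟩, fun x => rfl⟩
  obtain ⟨C, hC⟩ := hF.2 k m
  refine ⟨(K : ℝ) ^ m * C, fun x => ?_⟩
  calc ‖x‖ ^ m * ‖iteratedFDeriv ℝ k F x‖
      ≤ (K * w x) ^ m * ‖iteratedFDeriv ℝ k F x‖ := by gcongr; exact hw x
    _ = K ^ m * (‖iteratedFDeriv ℝ k F x‖ * w x ^ m) := by rw [mul_pow]; ring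
    _ ≤ _ := by gcongr; exact hC x

/-- Each factor decays only in the directions its map sees, with weight 1 + ‖A_i x‖. The product of
the weights dominates their maximum, hence ‖x‖, because the joint map is injective. -/
theorem exists_schwartzMap_eq_prod [FiniteDimensional ℝ V] {X : Fin 3 → Type*}
    [∀ i, NormedAddCommGroup (X i)] [∀ i, NormedSpace ℝ (X i)] {A : ∀ i, V →ₗ[ℝ] X i}
    (hA : ∀ x, (∀ i, A i x = 0) → x = 0) (f : ∀ i, 𝓢(X i, ℂ)) :
    ∃ Φ : 𝓢(V, ℂ), ∀ x, Φ x = ∏ i, f i (A i x) := by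
  have hker : LinearMap.ker (LinearMap.pi A) = ⊥ := by
    rw [LinearMap.ker_eq_bot']
    exact fun x hx => hA x (congrFun hx)
  obtain ⟨K, -, hK⟩ := (LinearMap.pi A).exists_antilipschitzWith hker
  have h := fun i => (f i).hasRapidDecay_comp (LinearMap.toContinuousLinearMap (A i))
  have hpos : ∀ i x, 1 ≤ 1 + ‖LinearMap.toContinuousLinearMap (A i) x‖ := fun i x => by
    linarith [norm_nonneg (LinearMap.toContinuousLinearMap (A i) x)]
  have hpos' : ∀ i x, 0 ≤ 1 + ‖LinearMap.toContinuousLinearMap (A i) x‖ := fun i x =>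
    zero_le_one.trans (hpos i x)
  have h3 := ((h 0).mul (h 1) (hpos' 0) (hpos' 1)).mul (h 2)
    (fun x => mul_nonneg (hpos' 0 x) (hpos' 1 x)) (hpos' 2)
  obtain ⟨Φ, hΦ⟩ := h3.exists_schwartzMap (K := K) fun x => by
    have h4 : ‖x‖ ≤ K * ‖LinearMap.pi A x‖ := by
      simpa using hK.le_mul_norm_sub (x := x) (y := 0)
    refine h4.trans (mul_le_mul_of_nonneg_left ?_ K.2)
    have h01 := one_le_mul_of_one_le_of_one_le (hpos 0 x) (hpos 1 x)
    have h5 : ∀ i, ‖A i x‖ ≤ 1 + ‖LinearMap.toContinuousLinearMap (A i) x‖ := fun i => by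
      simp
    refine (pi_norm_le_iff_of_nonneg (mul_nonneg (zero_le_one.trans h01) (hpos' 2 x))).2
      fun i => ?_
    rw [LinearMap.pi_apply]
    fin_cases i
    · exact ((h5 0).trans (le_mul_of_one_le_right (hpos' 0 x) (hpos 1 x))).trans
        (le_mul_of_one_le_right (zero_le_one.trans h01) (hpos 2 x))
    · exact ((h5 1).trans (le_mul_of_one_le_left (hpos' 1 x) (hpos 0 x))).trans
        (le_mul_of_one_le_right (zero_le_one.trans h01) (hpos 2 x))
    · exact (h5 2).trans (le_mul_of_one_le_left (hpos' 2 x) h01)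
  refine ⟨Φ, fun x => ?_⟩
  rw [hΦ, Fin.prod_univ_three]
  rfl

end RapidDecay

/-! ### Existence of the form -/

/-- A linear map with a right inverse is, up to a linear isomorphism, the projection from a product
to its first factor. -/
theorem LinearMap.exists_linearEquiv_prod {U V : Type*} [AddCommGroup U] [Module ℝ U]
    [FiniteDimensional ℝ U] [AddCommGroup V] [Module ℝ V] (P : U →ₗ[ℝ] V) (σ : V →ₗ[ℝ] U)
    (hσ : ∀ v, P (σ v) = v) : ∃ (n : ℕ) (S : U ≃ₗ[ℝ] V × EuclideanSpace ℝ (Fin n)),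
      (∀ u, (S u).1 = P u) ∧ ∀ v, S (σ v) = (v, 0) := by
  let T : LinearMap.ker P ≃ₗ[ℝ] EuclideanSpace ℝ (Fin (Module.finrank ℝ (LinearMap.ker P))) :=
    LinearEquiv.ofFinrankEq _ _ finrank_euclideanSpace_fin.symm
  let Q : U →ₗ[ℝ] LinearMap.ker P := (LinearMap.id - σ ∘ₗ P).codRestrict _ fun u => by
    simp [hσ]
  have hQ : ∀ u, (Q u : U) = u - σ (P u) := fun u => rfl
  let L : U ≃ₗ[ℝ] V × LinearMap.ker P := LinearEquiv.ofLinearMap (P.prod Q)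
    (σ.coprod (LinearMap.ker P).subtype) (by
      refine LinearMap.ext fun x => Prod.ext ?_ (Subtype.ext ?_)
      · simp [hσ]
      · simp [hQ, hσ]) (by
      refine LinearMap.ext fun x => ?_
      simp [hQ])
  refine ⟨_, L.trans ((LinearEquiv.refl ℝ V).prodCongr T), fun u => rfl, fun v => ?_⟩
  have h1 : Q (σ v) = 0 := Subtype.ext (by simp [hQ, hσ])
  have h2 : L (σ v) = (v, 0) := Prod.ext (hσ v) h1
  rw [LinearEquiv.trans_apply, h2]
  simp

namespace SBLDatum

variable {H : Type*} {E : Fin 4 → Type*}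
  [NormedAddCommGroup H] [InnerProductSpace ℝ H] [FiniteDimensional ℝ H]
  [MeasurableSpace H] [BorelSpace H]
  [∀ i, NormedAddCommGroup (E i)] [∀ i, InnerProductSpace ℝ (E i)]
  [∀ i, FiniteDimensional ℝ (E i)] [∀ i, MeasurableSpace (E i)] [∀ i, BorelSpace (E i)]
  {D : SBLDatum H E}

omit [MeasurableSpace H] [BorelSpace H] [∀ i, MeasurableSpace (E i)] [∀ i, BorelSpace (E i)] in
theorem exists_schwartzMap_eq_integrand (hD : D.module.Spans {1, 2, 3})
    (f : ∀ i : Fin 3, 𝓢(E i.succ, ℂ)) : ∃ F : 𝓢(H, ℂ), ∀ x, F x = D.integrand f x := by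
  refine exists_schwartzMap_eq_prod (A := fun i : Fin 3 => D.proj i.succ) (fun x hx => ?_) f
  refine eq_zero_of_spans hD fun i hi => ?_
  simp only [Finset.mem_insert, Finset.mem_singleton] at hi
  rcases hi with rfl | rfl | rfl
  exacts [hx 0, hx 1, hx 2]

/-- Besides the definition of the form, two consequences are recorded: the Fourier transform of φ,
for the Loomis–Whitney case, and the pairing with bounded continuous g, since the approximating
kernels are only of this type. -/
theorem exists_isFiberDensity (hD : D.module.Spans {1, 2, 3})
    (f : ∀ i : Fin 3, 𝓢(E i.succ, ℂ)) : ∃ φ : 𝓢(E 0, ℂ), D.IsFiberDensity f φ ∧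
      (∀ F : 𝓢(H, ℂ), (∀ x, F x = D.integrand f x) →
        ∀ ξ, 𝓕 φ ξ = 𝓕 F ((D.proj 0).adjoint ξ)) ∧
      ∀ g : E 0 → ℂ, Continuous g → (∃ B : ℝ, ∀ v, ‖g v‖ ≤ B) →
        ∫ x, D.integrand f x * g (D.proj 0 x) = ∫ u, φ u * g u := by
  obtain ⟨F, hF⟩ := exists_schwartzMap_eq_integrand hD f
  obtain ⟨σ, hσ⟩ := (D.proj 0).exists_rightInverse_of_surjective
    (LinearMap.range_eq_top.2 (D.surj 0))
  obtain ⟨n, S, hS, -⟩ := (D.proj 0).exists_linearEquiv_prod σ (LinearMap.congr_fun hσ)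
  obtain ⟨c, hc⟩ := exists_isVolumeScaling S
  obtain ⟨φ, -, hφF, hφ⟩ := F.exists_fiberIntegral hc hS
  simp only [hF] at hφ
  refine ⟨φ, ⟨?_, fun g => hφ g g.continuous ?_⟩, fun F' hF' ξ => ?_, hφ⟩
  · exact F.integrable.congr (ae_of_all _ hF)
  · exact ⟨_, fun v => g.norm_le_seminorm ℝ v⟩
  · rw [hφF, show F = F' from SchwartzMap.ext fun x => (hF x).trans (hF' x).symm]

end SBLDatum

/-! ### Approximation of Calderón-Zygmund kernels by bounded integrable functions -/

section Approximation

variable {V : Type*} [NormedAddCommGroup V] [InnerProductSpace ℝ V] [FiniteDimensional ℝ V]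

omit [FiniteDimensional ℝ V] in
theorem ContinuousMultilinearMap.norm_le_of_orthonormalBasis {ι : Type*} [Fintype ι] {k : ℕ}
    (b : OrthonormalBasis ι ℝ V) (T : ContinuousMultilinearMap ℝ (fun _ : Fin k => V) ℂ) {C : ℝ}
    (hC : 0 ≤ C) (h : ∀ j : Fin k → ι, ‖T (fun s => b (j s))‖ ≤ C) :
    ‖T‖ ≤ (Fintype.card ι : ℝ) ^ k * C := by
  classical
  refine T.opNorm_le_bound (by positivity) fun v => ?_
  have h1 : T v = ∑ j : Fin k → ι, T (fun s => (inner ℝ (b (j s)) (v s)) • b (j s)) := by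
    rw [← T.map_sum fun s i => (inner ℝ (b i) (v s)) • b i]
    exact congrArg T (funext fun s => (b.sum_repr' (v s)).symm)
  rw [h1]
  refine (norm_sum_le _ _).trans ?_
  have h2 : ∀ j : Fin k → ι, ‖T (fun s => (inner ℝ (b (j s)) (v s)) • b (j s))‖ ≤
      C * ∏ s, ‖v s‖ := by
    intro j
    rw [T.map_smul_univ, norm_smul, mul_comm, norm_prod]
    refine mul_le_mul (h j) (Finset.prod_le_prod (fun _ _ => norm_nonneg _) fun s _ => ?_)
      (Finset.prod_nonneg fun _ _ => norm_nonneg _) hC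
    refine (norm_inner_le_norm _ _).trans ?_
    rw [b.norm_eq_one, one_mul]
  refine (Finset.sum_le_sum fun j _ => h2 j).trans ?_
  rw [Finset.sum_const, Finset.card_univ, Fintype.card_fun, Fintype.card_fin, nsmul_eq_mul,
    mul_assoc]
  push_cast
  rfl

omit [FiniteDimensional ℝ V] in
-- Expanding each argument in the basis costs d^k in passing from partial derivatives to the
-- operator norm. With d + 1 in place of d the cost is monotone in k even for d = 0.
theorem IsMikhlin.of_orthonormalBasis {l : ℕ} {m : V → ℂ} (hm : ContDiffOn ℝ l m {0}ᶜ)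
    (b : OrthonormalBasis (Fin (Module.finrank ℝ V)) ℝ V)
    (h : ∀ k ≤ l, ∀ (j : Fin k → Fin (Module.finrank ℝ V)) (ξ : V), ξ ≠ 0 →
        ‖iteratedFDeriv ℝ k m ξ (fun s => b (j s))‖ ≤ (‖ξ‖ ^ k)⁻¹) :
    IsMikhlin l ((Module.finrank ℝ V + 1 : ℝ) ^ l) m where
  contDiffOn := hm
  norm_iteratedFDeriv_le k hk ξ hξ := by
    refine (ContinuousMultilinearMap.norm_le_of_orthonormalBasis b _ (by positivity)
      fun j => h k hk j ξ hξ).trans ?_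
    refine mul_le_mul_of_nonneg_right ?_ (by positivity)
    rw [Fintype.card_fin]
    calc (Module.finrank ℝ V : ℝ) ^ k ≤ (Module.finrank ℝ V + 1 : ℝ) ^ k := by
          gcongr; linarith
      _ ≤ _ := pow_le_pow_right₀ (by linarith [Nat.cast_nonneg (α := ℝ) (Module.finrank ℝ V)]) hk

variable [MeasurableSpace V] [BorelSpace V]

/-- A bounded integrable continuous kernel whose convolution operator is bounded on `L^p` with
constant `C`. -/
structure IsConvBounded (p : ℝ) (C : ℝ≥0) (k : V → ℂ) : Prop where
  continuous : Continuous k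
  integrable : Integrable k
  bounded : ∃ B : ℝ, ∀ x, ‖k x‖ ≤ B
  lintegral_le : ∀ f : V → ℂ, Continuous f → Integrable f → (∃ B : ℝ, ∀ x, ‖f x‖ ≤ B) →
    ∫⁻ x, ‖kernelConv k f x‖ₑ ^ p ≤ C * ∫⁻ x, ‖f x‖ₑ ^ p

/-- The Fourier transform of `K` is the function `m`. -/
def HasFourierMultiplier (K : 𝓢'(V, ℂ)) (m : V → ℂ) : Prop :=
  ∀ φ : 𝓢(V, ℂ), (𝓕 K) φ = ∫ ξ, φ ξ * m ξ

/-- K φ is 𝓕 K applied to 𝓕⁻ φ, and 𝓕⁻ φ is the reflection of 𝓕 φ; this is the origin of the sign in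
m(-ξ). -/
theorem HasFourierMultiplier.apply_eq {K : 𝓢'(V, ℂ)} {m : V → ℂ} (h : HasFourierMultiplier K m)
    (φ : 𝓢(V, ℂ)) : K φ = ∫ ξ, 𝓕 φ ξ * m (-ξ) := by
  have h1 : K φ = (𝓕 K) (𝓕⁻ φ) := by
    rw [TemperedDistribution.fourier_apply, FourierTransform.fourier_fourierInv_eq]
  rw [h1, h, ← integral_neg_eq_self]
  refine integral_congr_ae (ae_of_all _ fun ξ => ?_)
  simp only
  rw [fourierInv_coe, fourier_coe, Real.fourierInv_eq_fourier_neg, neg_neg]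

omit [FiniteDimensional ℝ V] [BorelSpace V] in
theorem volume_univ_of_subsingleton [FiniteDimensional ℝ V] [BorelSpace V] [Subsingleton V] :
    (volume : Measure V) Set.univ = 1 := by
  rw [← (stdOrthonormalBasis ℝ V).volume_parallelepiped]
  congr 1
  refine (Set.eq_univ_of_forall fun x => ?_).symm
  rw [Subsingleton.elim x 0, mem_parallelepiped_iff]
  exact ⟨0, by simp, by simp⟩

theorem isConvBounded_const_of_subsingleton [Subsingleton V] {a : ℂ} (ha : ‖a‖ ≤ 1) {p : ℝ}
    (hp : 0 ≤ p) : IsConvBounded p 1 (fun _ : V => a) where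
  continuous := continuous_const
  integrable := by
    have : IsFiniteMeasure (volume : Measure V) := ⟨by
      rw [volume_univ_of_subsingleton]; exact ENNReal.one_lt_top⟩
    exact integrable_const a
  bounded := ⟨_, fun _ => ha⟩
  lintegral_le f _ _ _ := by
    rw [ENNReal.coe_one, one_mul]
    refine lintegral_mono fun x => ENNReal.rpow_le_rpow ?_ hp
    have h1 : kernelConv (fun _ : V => a) f x = a * f x := by
      unfold kernelConv
      have h2 : (fun y : V => a * f y) = fun _ => a * f x :=
        funext fun y => by rw [Subsingleton.elim y x]
      rw [h2, integral_const, Measure.real, volume_univ_of_subsingleton]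
      simp
    rw [h1, enorm_mul]
    refine mul_le_of_le_one_left (zero_le) ?_
    rw [← ofReal_norm, ← ENNReal.ofReal_one]
    exact ENNReal.ofReal_le_ofReal ha

variable (V) in
/-- Calderón-Zygmund kernels are weak limits of bounded integrable functions whose convolution
operators are uniformly bounded on `L^p`. -/
theorem exists_isConvBounded_tendsto {p : ℝ} (hp : 1 < p) : ∃ C : ℝ≥0, ∀ K : 𝓢'(V, ℂ),
    IsCZKernel (Module.finrank ℝ V + 2) K → ∃ k : ℕ → V → ℂ, (∀ N, IsConvBounded p C (k N)) ∧
      ∀ φ : 𝓢(V, ℂ), Filter.Tendsto (fun N => ∫ x, k N x * φ x) Filter.atTop (nhds (K φ)) := by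
  -- On the zero space the kernel is the number m 0 and convolution is multiplication by it. The
  -- Calderón–Zygmund argument needs positive dimension.
  rcases subsingleton_or_nontrivial V with hV | hV
  · refine ⟨1, fun K hK => ?_⟩
    obtain ⟨-, m, hm, hm1, -, -⟩ := hK
    refine ⟨fun _ _ => m 0, fun _ => isConvBounded_const_of_subsingleton (hm1 0) (by linarith),
      fun φ => ?_⟩
    have h1 : K φ = ∫ x, m 0 * φ x := by
      rw [HasFourierMultiplier.apply_eq hm]
      have h2 : ∀ ξ : V, 𝓕 φ ξ * m (-ξ) = ∫ x, m 0 * φ x := by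
        intro ξ
        rw [Subsingleton.elim (-ξ) 0, Subsingleton.elim ξ 0, fourier_coe, Real.fourier_eq',
          integral_const_mul, mul_comm]
        simp
      simp only [h2, integral_const, Measure.real, volume_univ_of_subsingleton]
      simp
    rw [h1]
    exact tendsto_const_nhds
  · let B : ℝ≥0 := (Module.finrank ℝ V + 1 : ℝ≥0) ^ (Module.finrank ℝ V + 2)
    obtain ⟨A, hA⟩ := exists_isHormanderKernel_fourier_truncMultiplier V B
    obtain ⟨C, hC⟩ := exists_lintegral_kernelConv_le (V := V) Module.finrank_pos A hp
    refine ⟨C, fun K hK => ?_⟩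
    obtain ⟨-, m, hm, -, hmd, hmb⟩ := hK
    -- The truncations approximate the reflected multiplier, since this is what K pairs with 𝓕 φ.
    have hM : IsMikhlin (Module.finrank ℝ V + 2) B (fun ξ => m (-ξ)) := by
      have h1 := (IsMikhlin.of_orthonormalBasis hmd (stdOrthonormalBasis ℝ V)
        (hmb _)).comp_smul (s := -1) (by norm_num)
      have h2 : (B : ℝ) = (Module.finrank ℝ V + 1 : ℝ) ^ (Module.finrank ℝ V + 2) := by
        simp [B]
      rw [h2]
      simpa using h1
    refine ⟨fun N => 𝓕 (truncMultiplier (fun ξ => m (-ξ)) N), fun N => ?_, fun φ => ?_⟩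
    · have h1 := hA _ hM N
      exact ⟨h1.continuous, h1.integrable, h1.bounded, hC _ h1⟩
    · rw [HasFourierMultiplier.apply_eq hm]
      simp only [mul_comm (𝓕 φ _)]
      exact tendsto_integral_fourier_truncMultiplier hM φ

end Approximation

/-! ### Convolution along a subspace -/

section KernelTranslate

variable {T W : Type*} [NormedAddCommGroup T] [InnerProductSpace ℝ T] [FiniteDimensional ℝ T]
  [MeasurableSpace T] [BorelSpace T]
  [NormedAddCommGroup W] [InnerProductSpace ℝ W] [FiniteDimensional ℝ W]

/-- The average `∫ k(t) G(z + C t) dt` of the translates of `G` along the range of `C`. -/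
noncomputable def kernelTranslate (k : T → ℂ) (C : T →ₗ[ℝ] W) (G : W → ℂ) (z : W) : ℂ :=
  ∫ t, k t * G (z + C t)

omit [FiniteDimensional ℝ W] in
theorem continuous_kernelTranslate {k : T → ℂ} (hk : Integrable k) (C : T →ₗ[ℝ] W) {G : W → ℂ}
    (hG : Continuous G) {B : ℝ} (hB : ∀ z, ‖G z‖ ≤ B) : Continuous (kernelTranslate k C G) := by
  have hC : Continuous C := C.continuous_of_finiteDimensional
  refine continuous_of_dominated (bound := fun t => ‖k t‖ * B) (fun z => ?_)
    (fun z => ae_of_all _ fun t => ?_) (hk.norm.mul_const B) (ae_of_all _ fun t => by fun_prop)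
  · exact hk.aestronglyMeasurable.mul (by fun_prop : Continuous _).aestronglyMeasurable
  · rw [norm_mul]
    exact mul_le_mul_of_nonneg_left (hB _) (norm_nonneg _)

variable [MeasurableSpace W] [BorelSpace W]

/-- Convolution along a subspace is bounded on `L^p`. -/
theorem IsConvBounded.lintegral_kernelTranslate_le {p : ℝ} {A : ℝ≥0} {k : T → ℂ}
    (hk : IsConvBounded p A k) {C : T →ₗ[ℝ] W} (hC : Function.Injective C) {G : W → ℂ}
    (hG : Continuous G) (hGi : Integrable G) (hGb : ∃ B : ℝ, ∀ z, ‖G z‖ ≤ B) :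
    ∫⁻ z, ‖kernelTranslate k C G z‖ₑ ^ p ≤ A * ∫⁻ z, ‖G z‖ₑ ^ p := by
  obtain ⟨B, hB⟩ := hGb
  -- The sign turns the translation z + C t into s - t in the coordinate along the range of C, so
  -- that each slice is a genuine convolution.
  obtain ⟨P, hP⟩ := (-C).exists_leftInverse_of_injective
    (LinearMap.ker_eq_bot.2 fun x y hxy => hC (neg_injective hxy))
  obtain ⟨n, S, -, hS⟩ := P.exists_linearEquiv_prod (-C) (LinearMap.congr_fun hP)
  obtain ⟨c, hc⟩ := exists_isVolumeScaling S
  have hSc : Continuous S.symm := S.symm.toContinuousLinearEquiv.continuous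
  have hkey : ∀ s a, kernelTranslate k C G (S.symm (s, a)) =
      kernelConv k (fun s => G (S.symm (s, a))) s := by
    intro s a
    unfold kernelTranslate kernelConv
    refine Eq.trans ?_
      (integral_sub_left_eq_self (fun y => k (s - y) * G (S.symm (y, a))) volume s)
    refine integral_congr_ae (ae_of_all _ fun t => ?_)
    have h1 : S.symm (s, a) + C t = S.symm (s - t, a) := by
      refine S.injective ?_
      have h2 : S (C t) = -(t, 0) := by
        rw [← hS, LinearMap.neg_apply, map_neg, neg_neg]
      rw [map_add, S.apply_symm_apply, S.apply_symm_apply, h2]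
      simp [sub_eq_add_neg]
    simp only
    rw [h1, sub_sub_cancel]
  have hlin : ∀ q : W → ℝ≥0∞, Continuous q → ∫⁻ z, q z = c * ∫⁻ a, ∫⁻ s, q (S.symm (s, a)) := by
    intro q hq
    have h1 := hc.lintegral_comp (fun w => q (S.symm w))
    simp only [LinearEquiv.symm_apply_apply] at h1
    rw [h1, Measure.volume_eq_prod, lintegral_prod_symm (fun w => q (S.symm w)) (hq.comp hSc).measurable.aemeasurable]
  have hT : Continuous (kernelTranslate k C G) := continuous_kernelTranslate hk.integrable C hG hB
  rw [hlin _ (by exact (ENNReal.continuous_rpow_const).comp hT.enorm),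
    hlin _ (by exact (ENNReal.continuous_rpow_const).comp hG.enorm), mul_left_comm]
  refine mul_le_mul_right ?_ _
  rw [← lintegral_const_mul']
  swap
  · exact ENNReal.coe_ne_top
  have hint : Integrable (fun w : T × EuclideanSpace ℝ (Fin n) => G (S.symm w)) := by
    refine hc.integrable_comp_iff.1 ?_
    simpa using hGi
  rw [Measure.volume_eq_prod] at hint
  -- By Fubini only almost every slice of G is known to be integrable.
  refine lintegral_mono_ae ?_
  filter_upwards [hint.prod_left_ae] with a ha
  simp only [hkey]
  exact hk.lintegral_le _ (hG.comp (hSc.comp (by fun_prop))) ha ⟨B, fun s => hB _⟩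

omit [FiniteDimensional ℝ W] [MeasurableSpace W] [BorelSpace W] in
/-- A form whose integrand is, in suitable coordinates `(t, x)`, the product of `a(x)` and
`G(ℓ x + C t)` is dominated by an integral that involves `kernelTranslate`. -/
theorem IsVolumeScaling.enorm_integral_mul_le {H X : Type*} [NormedAddCommGroup H]
    [InnerProductSpace ℝ H] [MeasurableSpace H] [BorelSpace H] [FiniteDimensional ℝ H]
    [NormedAddCommGroup X] [NormedSpace ℝ X] [FiniteDimensional ℝ X] [MeasureSpace X]
    [BorelSpace X] [(volume : Measure X).IsAddHaarMeasure] {S : H ≃ₗ[ℝ] T × X} {c : ℝ≥0}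
    (hS : IsVolumeScaling S c) {F : H → ℂ} (hF : Integrable F) {k : T → ℂ} (hk : Continuous k)
    (hkb : ∃ B : ℝ, ∀ t, ‖k t‖ ≤ B) {P : H →ₗ[ℝ] T} (hP : ∀ x, (S x).1 = P x) {a : X → ℂ}
    {G : W → ℂ} {l : X → W} {C : T →ₗ[ℝ] W}
    (h : ∀ t x, F (S.symm (t, x)) = a x * G (l x + C t)) :
    ‖∫ x, F x * k (P x)‖ₑ ≤ c * ∫⁻ x, ‖a x‖ₑ * ‖kernelTranslate k C G (l x)‖ₑ := by
  obtain ⟨B, hB⟩ := hkb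
  have h1 : Integrable (fun w : T × X => F (S.symm w)) := by
    refine hS.integrable_comp_iff.1 ?_
    simpa using hF
  have h2 : Integrable (fun w : T × X => F (S.symm w) * k w.1) :=
    h1.mul_bdd (c := B) (hk.comp continuous_fst).aestronglyMeasurable
      (ae_of_all _ fun w => hB w.1)
  have h3 := hS.integral_comp (fun w => F (S.symm w) * k w.1)
  simp only [LinearEquiv.symm_apply_apply, hP] at h3
  rw [Measure.volume_eq_prod] at h2
  rw [h3, Measure.volume_eq_prod, integral_prod_symm _ h2, enorm_smul]
  have h4 : ‖(c : ℝ)‖ₑ = c := by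
    rw [Real.enorm_eq_ofReal c.coe_nonneg, ENNReal.ofReal_coe_nnreal]
  rw [h4]
  refine mul_le_mul_right ((enorm_integral_le_lintegral_enorm _).trans
    (lintegral_mono fun x => ?_)) _
  simp only [h]
  rw [← enorm_mul, kernelTranslate, ← integral_const_mul]
  refine le_of_eq (congrArg _ (integral_congr_ae (ae_of_all _ fun t => ?_)))
  simp only
  ring

end KernelTranslate

/-! ### Reduction to kernels that are functions -/

namespace SBLDatum

variable {H : Type*} {E : Fin 4 → Type*}
  [NormedAddCommGroup H] [InnerProductSpace ℝ H] [FiniteDimensional ℝ H]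
  [MeasurableSpace H] [BorelSpace H]
  [∀ i, NormedAddCommGroup (E i)] [∀ i, InnerProductSpace ℝ (E i)]
  [∀ i, FiniteDimensional ℝ (E i)] [∀ i, MeasurableSpace (E i)] [∀ i, BorelSpace (E i)]
  {D : SBLDatum H E}

/-- It suffices to bound the form for kernels that are functions. -/
theorem isPBounded_of_isConvBounded (hD : D.module.Spans {1, 2, 3}) {p : Fin 3 → ℝ≥0∞} {q : ℝ}
    (hq : 1 < q) (h : ∀ A : ℝ≥0, ∃ C : ℝ≥0, ∀ k : E 0 → ℂ, IsConvBounded q A k →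
      ∀ f : ∀ i : Fin 3, 𝓢(E i.succ, ℂ), ‖∫ x, D.integrand f x * k (D.proj 0 x)‖ₑ ≤
        C * ∏ i : Fin 3, eLpNorm (f i) (p i) volume) : D.IsPBounded p := by
  obtain ⟨A, hA⟩ := exists_isConvBounded_tendsto (E 0) hq
  obtain ⟨C, hC⟩ := h A
  refine ⟨Module.finrank ℝ (E 0) + 2, C, fun K hK f => ?_⟩
  obtain ⟨φ, hφ, -, hφk⟩ := exists_isFiberDensity hD f
  obtain ⟨k, hk, hkK⟩ := hA K hK
  refine ⟨K φ, ⟨φ, hφ, rfl⟩, ?_⟩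
  refine le_of_tendsto ((hkK φ).enorm) (Filter.Eventually.of_forall fun N => ?_)
  have h1 := hφk (k N) (hk N).continuous (hk N).bounded
  simp only [mul_comm (k N _)]
  rw [← h1]
  exact hC _ (hk N) f

end SBLDatum

/-! ### Data of Hölder type -/

theorem Fin.prod_eq_of_ne {M : Type*} [CommMonoid M] {i j k : Fin 3} (hij : i ≠ j) (hjk : j ≠ k)
    (hik : i ≠ k) (f : Fin 3 → M) : ∏ s, f s = f i * f j * f k := by
  have huniv : (Finset.univ : Finset (Fin 3)) = {i, j, k} := by
    revert hij hjk hik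
    revert i j k
    decide
  rw [huniv, Finset.prod_insert (by simp [hij, hik]), Finset.prod_insert (by simp [hjk]),
    Finset.prod_singleton, mul_assoc]

/-- Two coordinate systems with the same first component identify the complementary coordinates with
each other, through the common subspace where the first component vanishes. -/
theorem LinearEquiv.exists_linearEquiv_of_fst_eq {H T X W : Type*} [AddCommGroup H] [Module ℝ H]
    [AddCommGroup T] [Module ℝ T] [AddCommGroup X] [Module ℝ X] [AddCommGroup W] [Module ℝ W]
    (S : H ≃ₗ[ℝ] T × X) (R : H ≃ₗ[ℝ] T × W) (h : ∀ x, (S x).1 = (R x).1) :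
    ∃ Q : X ≃ₗ[ℝ] W, ∀ x, R (S.symm (0, x)) = (0, Q x) := by
  have h1 : ∀ x, (R (S.symm (0, x))).1 = 0 := fun x => by rw [← h, S.apply_symm_apply]
  have h2 : ∀ w, (S (R.symm (0, w))).1 = 0 := fun w => by rw [h, R.apply_symm_apply]
  have h1' : ∀ x, (0, (R (S.symm (0, x))).2) = R (S.symm (0, x)) := fun x =>
    Prod.ext (h1 x).symm rfl
  have h2' : ∀ w, (0, (S (R.symm (0, w))).2) = S (R.symm (0, w)) := fun w =>
    Prod.ext (h2 w).symm rfl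
  let L : X →ₗ[ℝ] W := LinearMap.snd ℝ T W ∘ₗ R.toLinearMap ∘ₗ S.symm.toLinearMap ∘ₗ
    LinearMap.inr ℝ T X
  let L' : W →ₗ[ℝ] X := LinearMap.snd ℝ T X ∘ₗ S.toLinearMap ∘ₗ R.symm.toLinearMap ∘ₗ
    LinearMap.inr ℝ T W
  have hL : ∀ x, L x = (R (S.symm (0, x))).2 := fun x => rfl
  have hL' : ∀ x, L' x = (S (R.symm (0, x))).2 := fun x => rfl
  refine ⟨LinearEquiv.ofLinearMap L L' (LinearMap.ext fun w => ?_) (LinearMap.ext fun x => ?_),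
    fun x => (h1' x).symm⟩
  · rw [LinearMap.comp_apply, hL, hL', h2', S.symm_apply_apply, R.apply_symm_apply,
      LinearMap.id_apply]
  · rw [LinearMap.comp_apply, hL, hL', h1', R.symm_apply_apply, S.apply_symm_apply,
      LinearMap.id_apply]

theorem eLpNorm_eq_lintegral_rpow_of_one_le {X : Type*} [MeasurableSpace X] {μ : Measure X}
    {p : ℝ≥0∞} (h1 : 1 ≤ p) (ht : p < ∞) (f : X → ℂ) :
    eLpNorm f p μ = (∫⁻ x, ‖f x‖ₑ ^ p.toReal ∂μ) ^ (1 / p.toReal) :=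
  eLpNorm_eq_lintegral_rpow_enorm_toReal (zero_lt_one.trans_le h1).ne' ht.ne

section Tensor

variable {X Y Z : Type*}
  [NormedAddCommGroup X] [InnerProductSpace ℝ X] [FiniteDimensional ℝ X]
  [MeasurableSpace X] [BorelSpace X]
  [NormedAddCommGroup Y] [InnerProductSpace ℝ Y] [FiniteDimensional ℝ Y]
  [MeasurableSpace Y] [BorelSpace Y]
  [NormedAddCommGroup Z] [InnerProductSpace ℝ Z] [FiniteDimensional ℝ Z]
  [MeasurableSpace Z] [BorelSpace Z]

theorem IsVolumeScaling.integrable_tensor {Q : X ≃ₗ[ℝ] Y × Z} {c : ℝ≥0}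
    (hQ : IsVolumeScaling Q c) (g : 𝓢(Y, ℂ)) (h : 𝓢(Z, ℂ)) :
    Integrable (fun x => g (Q x).1 * h (Q x).2) := by
  refine (hQ.integrable_comp_iff (f := fun w => g w.1 * h w.2)).2 ?_
  rw [Measure.volume_eq_prod]
  exact g.integrable.mul_prod h.integrable

omit [FiniteDimensional ℝ Y] in
theorem SchwartzMap.measurable_enorm_rpow (g : 𝓢(Y, ℂ)) (q : ℝ) :
    Measurable (fun y => ‖g y‖ₑ ^ q) :=
  (g.continuous.enorm.measurable).pow_const q

theorem IsVolumeScaling.lintegral_tensor_rpow {Q : X ≃ₗ[ℝ] Y × Z} {c : ℝ≥0}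
    (hQ : IsVolumeScaling Q c) (g : 𝓢(Y, ℂ)) (h : 𝓢(Z, ℂ)) {q : ℝ} (hq : 0 ≤ q) :
    ∫⁻ x, ‖g (Q x).1 * h (Q x).2‖ₑ ^ q = c * ((∫⁻ y, ‖g y‖ₑ ^ q) * ∫⁻ z, ‖h z‖ₑ ^ q) := by
  rw [hQ.lintegral_comp (fun w => ‖g w.1 * h w.2‖ₑ ^ q), Measure.volume_eq_prod,
    ← lintegral_prod_mul (g.measurable_enorm_rpow q).aemeasurable
      (h.measurable_enorm_rpow q).aemeasurable]
  simp only [enorm_mul, ENNReal.mul_rpow_of_nonneg _ _ hq]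

end Tensor

namespace SBLDatum

variable {H : Type*} {E : Fin 4 → Type*}
  [NormedAddCommGroup H] [InnerProductSpace ℝ H] [FiniteDimensional ℝ H]
  [∀ i, NormedAddCommGroup (E i)] [∀ i, InnerProductSpace ℝ (E i)]
  [∀ i, FiniteDimensional ℝ (E i)] {D : SBLDatum H E}

theorem exists_linearEquiv_pair {a b : Fin 4} (hab : a ≠ b) (hS : D.module.Spans {a, b})
    (hI : D.module.Indep {a, b}) :
    ∃ S : H ≃ₗ[ℝ] E a × E b, ∀ x, S x = (D.proj a x, D.proj b x) := by
  refine ⟨LinearEquiv.ofBijective ((D.proj a).prod (D.proj b)) ⟨?_, fun w => ?_⟩, fun x => rfl⟩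
  · rw [injective_iff_map_eq_zero]
    intro x hx
    obtain ⟨h1, h2⟩ := Prod.ext_iff.1 hx
    refine eq_zero_of_spans hS fun i hi => ?_
    simp only [Finset.mem_insert, Finset.mem_singleton] at hi
    rcases hi with rfl | rfl
    exacts [h1, h2]
  · obtain ⟨x, hx⟩ := exists_proj_eq_of_indep hI
      (Function.update (Function.update 0 b w.2) a w.1)
    refine ⟨x, Prod.ext ?_ ?_⟩
    · exact (hx a (by simp)).trans (Function.update_self ..)
    · exact (hx b (by simp)).trans
        ((Function.update_of_ne hab.symm ..).trans (Function.update_self ..))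

theorem exists_linearEquiv_triple {a b c : Fin 4} (hab : a ≠ b) (hbc : b ≠ c) (hac : a ≠ c)
    (hS : D.module.Spans {a, b, c}) (hI : D.module.Indep {a, b, c}) :
    ∃ S : H ≃ₗ[ℝ] (E a × E b) × E c, ∀ x, S x = ((D.proj a x, D.proj b x), D.proj c x) := by
  refine ⟨LinearEquiv.ofBijective (((D.proj a).prod (D.proj b)).prod (D.proj c))
    ⟨?_, fun w => ?_⟩, fun x => rfl⟩
  · rw [injective_iff_map_eq_zero]
    intro x hx
    obtain ⟨h12, h3⟩ := Prod.ext_iff.1 hx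
    obtain ⟨h1, h2⟩ := Prod.ext_iff.1 h12
    refine eq_zero_of_spans hS fun i hi => ?_
    simp only [Finset.mem_insert, Finset.mem_singleton] at hi
    rcases hi with rfl | rfl | rfl
    exacts [h1, h2, h3]
  · obtain ⟨x, hx⟩ := exists_proj_eq_of_indep hI
      (Function.update (Function.update (Function.update 0 c w.2) b w.1.2) a w.1.1)
    refine ⟨x, Prod.ext (Prod.ext ?_ ?_) ?_⟩
    · exact (hx a (by simp)).trans (Function.update_self ..)
    · exact (hx b (by simp)).trans
        ((Function.update_of_ne hab.symm ..).trans (Function.update_self ..))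
    · exact (hx c (by simp)).trans ((Function.update_of_ne hac.symm ..).trans
        ((Function.update_of_ne hbc.symm ..).trans (Function.update_self ..)))

theorem eq_zero_of_proj_eq_zero (hD : D.module.Spans {1, 2, 3}) {i j k : Fin 3} (hij : i ≠ j)
    (hjk : j ≠ k) (hik : i ≠ k) {x : H} (hi : D.proj i.succ x = 0) (hj : D.proj j.succ x = 0)
    (hk : D.proj k.succ x = 0) : x = 0 := by
  refine eq_zero_of_spans hD fun a ha => ?_
  have h1 : a = i.succ ∨ a = j.succ ∨ a = k.succ := by
    clear hi hj hk
    revert a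
    revert hij hjk hik
    revert i j k
    decide
  rcases h1 with rfl | rfl | rfl <;> assumption

variable [MeasurableSpace H] [BorelSpace H] [∀ i, MeasurableSpace (E i)] [∀ i, BorelSpace (E i)]

/-- Data of bilinear Hölder type are bounded. -/
theorem isPBounded_of_bilinearHolderType {p : Fin 3 → ℝ≥0∞} (hp_one : ∀ i, 1 ≤ p i)
    (hp_top : ∀ i, p i < ∞) (h : D.module.BilinearHolderType p) : D.IsPBounded p := by
  obtain ⟨hD, i, j, k, hij, hjk, hik, hpjk, hpki, hS2, hI2, hS3, hI3⟩ := h.spans_indep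
  have hpjk' : p j = p k := inv_injective hpjk
  have hsum : (p i).toReal⁻¹ + (p k).toReal⁻¹ = 1 := by
    rw [← ENNReal.toReal_inv, ← ENNReal.toReal_inv, ← ENNReal.toReal_add, hpki,
      add_tsub_cancel_of_le (ENNReal.inv_le_one.2 (hp_one i)), ENNReal.toReal_one]
    · exact ENNReal.inv_ne_top.2 (zero_lt_one.trans_le (hp_one i)).ne'
    · exact ENNReal.inv_ne_top.2 (zero_lt_one.trans_le (hp_one k)).ne'
  have hpos : ∀ i, 0 < (p i).toReal := fun i =>
    ENNReal.toReal_pos (zero_lt_one.trans_le (hp_one i)).ne' (hp_top i).ne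
  have hconj : (p i).toReal.HolderConjugate (p k).toReal := by
    refine Real.holderConjugate_iff.2 ⟨?_, hsum⟩
    have h1 := inv_pos.2 (hpos k)
    refine (inv_lt_one₀ (hpos i)).1 ?_
    linarith
  have h0 : ∀ a : Fin 3, (0 : Fin 4) ≠ a.succ := fun a => (Fin.succ_ne_zero a).symm
  obtain ⟨S, hS⟩ := exists_linearEquiv_pair (h0 i) hS2 hI2
  obtain ⟨R', hR'⟩ := exists_linearEquiv_triple (h0 j) (fun h => hjk (Fin.succ_injective _ h))
    (h0 k) hS3 hI3
  let R := R'.trans (LinearEquiv.prodAssoc ℝ (E 0) (E j.succ) (E k.succ))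
  have hR : ∀ x, R x = (D.proj 0 x, D.proj j.succ x, D.proj k.succ x) := fun x => by
    simp [R, hR']
  -- On the kernel of Π₀ both Π_i and (Π_j, Π_k) are coordinates; Q is the change between them. The
  -- map C below measures the shift off this kernel: (Π_j, Π_k) = Q(x + C t) at the point with Π₀ =
  -- t, Π_i = x.
  obtain ⟨Q, hQ⟩ := S.exists_linearEquiv_of_fst_eq R fun x => by rw [hS, hR]
  let C : E 0 →ₗ[ℝ] E i.succ := Q.symm.toLinearMap ∘ₗ LinearMap.snd ℝ _ _ ∘ₗ R.toLinearMap ∘ₗ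
    S.symm.toLinearMap ∘ₗ LinearMap.inl ℝ _ _
  have hC : ∀ t, Q (C t) = (R (S.symm (t, 0))).2 := fun t => Q.apply_symm_apply _
  have hQC : ∀ t x, Q (x + C t) = (R (S.symm (t, x))).2 := by
    intro t x
    have h1 : S.symm (t, x) = S.symm (0, x) + S.symm (t, 0) := by
      rw [← map_add]; simp
    rw [map_add, hC, h1, map_add, Prod.snd_add, hQ]
  -- If C t = 0, then Π₁, Π₂, Π₃ all vanish at the point with coordinates (t, 0), so that point is
  -- zero.
  have hCinj : Function.Injective C := by
    rw [injective_iff_map_eq_zero]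
    intro t ht
    have h1 := hC t
    rw [ht, map_zero, hR] at h1
    have h2 : S.symm (t, 0) = 0 := by
      refine eq_zero_of_proj_eq_zero hD hij hjk hik ?_ (Prod.ext_iff.1 h1).1.symm
        (Prod.ext_iff.1 h1).2.symm
      have h3 := congrArg Prod.snd (hS (S.symm (t, 0)))
      rw [S.apply_symm_apply] at h3
      exact h3.symm
    have h4 := (S.symm.map_eq_zero_iff).1 h2
    exact congrArg Prod.fst h4
  obtain ⟨c, hc⟩ := exists_isVolumeScaling S
  obtain ⟨d, hd⟩ := exists_isVolumeScaling Q
  set q := (p k).toReal with hq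
  -- The singular integral acts on f_j ⊗ f_k in L^q of H_i, where q is the common value of p_j and
  -- p_k; it exceeds 1 because the conjugate exponent p_i is finite.
  refine isPBounded_of_isConvBounded hD hconj.symm.lt fun A =>
    ⟨c * (A * d) ^ (1 / q), fun κ hκ f => ?_⟩
  let G : E i.succ → ℂ := fun x => f j (Q x).1 * f k (Q x).2
  have hQc : Continuous Q := Q.toContinuousLinearEquiv.continuous
  have hGc : Continuous G := ((f j).continuous.comp (continuous_fst.comp hQc)).mul
    ((f k).continuous.comp (continuous_snd.comp hQc))
  have hGb : ∃ B : ℝ, ∀ x, ‖G x‖ ≤ B := ⟨_, fun x => by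
    rw [norm_mul]
    exact mul_le_mul ((f j).norm_le_seminorm ℝ _) ((f k).norm_le_seminorm ℝ _) (norm_nonneg _)
      ((norm_nonneg _).trans ((f j).norm_le_seminorm ℝ 0))⟩
  have hT := hκ.lintegral_kernelTranslate_le hCinj hGc (hd.integrable_tensor (f j) (f k)) hGb
  rw [hd.lintegral_tensor_rpow _ _ (hpos k).le] at hT
  obtain ⟨F, hF⟩ := exists_schwartzMap_eq_integrand hD f
  have hFi : Integrable (D.integrand f) := F.integrable.congr (ae_of_all _ hF)
  have hmain := hc.enorm_integral_mul_le (W := E i.succ) hFi hκ.continuous hκ.bounded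
    (P := D.proj 0) (fun x => by rw [hS]) (a := f i) (G := G) (l := id) (C := C) (by
      intro t x
      have h1 : x = D.proj i.succ (S.symm (t, x)) := by
        have h2 := congrArg Prod.snd (hS (S.symm (t, x)))
        rwa [S.apply_symm_apply] at h2
      simp only [integrand, id, G, hQC, hR]
      rw [Fin.prod_eq_of_ne hij hjk hik, ← h1, mul_assoc])
  refine hmain.trans ?_
  simp only [id]
  have hTc : Continuous (kernelTranslate κ C G) := by
    obtain ⟨B, hB⟩ := hGb
    exact continuous_kernelTranslate hκ.integrable C hGc hB
  have hH := ENNReal.lintegral_mul_le_Lp_mul_Lq (volume : Measure (E i.succ)) hconj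
    (f i).continuous.enorm.measurable.aemeasurable hTc.enorm.measurable.aemeasurable
  simp only [Pi.mul_apply] at hH
  refine (mul_le_mul_right hH _).trans ?_
  rw [Fin.prod_eq_of_ne hij hjk hik, eLpNorm_eq_lintegral_rpow_of_one_le (hp_one i) (hp_top i),
    eLpNorm_eq_lintegral_rpow_of_one_le (hp_one j) (hp_top j),
    eLpNorm_eq_lintegral_rpow_of_one_le (hp_one k) (hp_top k), hpjk', ← hq]
  have hq0 : 0 ≤ 1 / q := one_div_nonneg.2 (hpos k).le
  refine (mul_le_mul_right (mul_le_mul_right (ENNReal.rpow_le_rpow hT hq0) _) _).trans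
    (le_of_eq ?_)
  rw [← mul_assoc, ENNReal.mul_rpow_of_nonneg _ _ hq0, ENNReal.mul_rpow_of_nonneg _ _ hq0,
    ENNReal.mul_rpow_of_nonneg _ _ hq0, ENNReal.coe_mul, ENNReal.coe_rpow_of_nonneg _ hq0,
    ENNReal.coe_mul, ENNReal.mul_rpow_of_nonneg _ _ hq0, ← hq]
  ring

end SBLDatum

/-! ### Data of Young type -/

section Young

variable {X Y Z : Type*}
  [NormedAddCommGroup X] [InnerProductSpace ℝ X] [FiniteDimensional ℝ X]
  [MeasurableSpace X] [BorelSpace X]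
  [NormedAddCommGroup Y] [InnerProductSpace ℝ Y] [FiniteDimensional ℝ Y]
  [MeasurableSpace Y] [BorelSpace Y]
  [NormedAddCommGroup Z] [InnerProductSpace ℝ Z] [FiniteDimensional ℝ Z]
  [MeasurableSpace Z] [BorelSpace Z]

/-- For fixed x the inner integral is independent of A x by translation invariance, so only B has to
be invertible. -/
theorem IsVolumeScaling.lintegral_prod_comp_add {A : X →ₗ[ℝ] Z} {B : Y ≃ₗ[ℝ] Z} {c : ℝ≥0}
    (hB : IsVolumeScaling B c) {f : X → ℝ≥0∞} (hf : Measurable f) {h : Z → ℝ≥0∞}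
    (hh : Measurable h) : ∫⁻ w : X × Y, f w.1 * h (A w.1 + B w.2) =
      c * ((∫⁻ x, f x) * ∫⁻ z, h z) := by
  have hA : Measurable A := A.continuous_of_finiteDimensional.measurable
  have hBm : Measurable B := B.toContinuousLinearEquiv.continuous.measurable
  have hm : Measurable (fun w : X × Y => h (A w.1 + B w.2)) :=
    hh.comp ((hA.comp measurable_fst).add (hBm.comp measurable_snd))
  rw [Measure.volume_eq_prod, lintegral_prod (fun w : X × Y => f w.1 * h (A w.1 + B w.2))
    ((hf.comp measurable_fst).mul hm).aemeasurable]
  have h1 : ∀ x, ∫⁻ y, f x * h (A x + B y) = f x * (c * ∫⁻ z, h z) := by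
    intro x
    have hx : Measurable (fun y => h (A x + B y)) := hm.comp measurable_prodMk_left
    rw [lintegral_const_mul _ hx,
      hB.lintegral_comp (fun z => h (A x + z)), lintegral_add_left_eq_self]
  simp only [h1]
  rw [lintegral_mul_const _ hf]
  ring

/-- Young's inequality in trilinear form. -/
theorem exists_lintegral_mul_le_of_young (A : X →ₗ[ℝ] Z) (B : Y ≃ₗ[ℝ] Z) {p q r : ℝ} (hp : 1 ≤ p)
    (hq : 1 ≤ q) (hr : 1 ≤ r) (hpqr : p⁻¹ + q⁻¹ + r⁻¹ = 2)
    (hA : p = 1 ∨ ∃ A' : X ≃ₗ[ℝ] Z, ∀ x, A' x = A x) :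
    ∃ C : ℝ≥0, ∀ (f : X → ℝ≥0∞) (g : Y → ℝ≥0∞) (h : Z → ℝ≥0∞), Measurable f → Measurable g →
      Measurable h → ∫⁻ w : X × Y, f w.1 * g w.2 * h (A w.1 + B w.2) ≤
        C * ((∫⁻ x, f x ^ p) ^ (1 / p) * (∫⁻ y, g y ^ q) ^ (1 / q) *
          (∫⁻ z, h z ^ r) ^ (1 / r)) := by
  obtain ⟨b, hb⟩ := exists_isVolumeScaling B
  -- The pair g, h factors only if A is invertible. For p = 1 it enters Hölder's inequality with
  -- exponent zero, so nothing is required.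
  have h3 : ∃ a : ℝ≥0, ∀ (g : Y → ℝ≥0∞) (h : Z → ℝ≥0∞), Measurable g → Measurable h →
      (∫⁻ w : X × Y, g w.2 * h (A w.1 + B w.2)) ^ (1 - p⁻¹) ≤
        (a * ((∫⁻ y, g y) * ∫⁻ z, h z)) ^ (1 - p⁻¹) := by
    rcases hA with rfl | ⟨A', hA'⟩
    · exact ⟨0, fun g h _ _ => by simp⟩
    · obtain ⟨a, ha⟩ := exists_isVolumeScaling A'
      refine ⟨a, fun g h hg hh => le_of_eq ?_⟩
      rw [← ha.lintegral_prod_comp_add (A := B.toLinearMap) hg hh, Measure.volume_eq_prod,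
        ← lintegral_prod_swap, ← Measure.volume_eq_prod]
      congr 1
      refine lintegral_congr fun w => ?_
      simp only [Prod.fst_swap, Prod.snd_swap, LinearEquiv.coe_coe, hA', add_comm]
  obtain ⟨a, ha⟩ := h3
  have hp' : p⁻¹ ≤ 1 := inv_le_one_of_one_le₀ hp
  have hq' : q⁻¹ ≤ 1 := inv_le_one_of_one_le₀ hq
  have hr' : r⁻¹ ≤ 1 := inv_le_one_of_one_le₀ hr
  set u := 1 - p⁻¹ with hu
  set v := 1 - q⁻¹ with hv
  set w := 1 - r⁻¹ with hw
  have hu0 : 0 ≤ u := by linarith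
  have hv0 : 0 ≤ v := by linarith
  have hw0 : 0 ≤ w := by linarith
  refine ⟨b ^ v * a ^ u, fun f g h hf hg hh => ?_⟩
  have hAm : Measurable A := A.continuous_of_finiteDimensional.measurable
  have hBm : Measurable B := B.toContinuousLinearEquiv.continuous.measurable
  have hfm : Measurable (fun x => f x ^ p) := hf.pow_const p
  have hgm : Measurable (fun y => g y ^ q) := hg.pow_const q
  have hhm : Measurable (fun z => h z ^ r) := hh.pow_const r
  have hhm' : Measurable (fun x : X × Y => h (A x.1 + B x.2) ^ r) :=
    hhm.comp ((hAm.comp measurable_fst).add (hBm.comp measurable_snd))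
  -- Hölder's inequality with the exponents 1 - 1/r, 1 - 1/q, 1 - 1/p, whose sum is one. Each factor
  -- involves two of the three functions.
  let F : Fin 3 → X × Y → ℝ≥0∞ := ![fun x => f x.1 ^ p * g x.2 ^ q,
    fun x => f x.1 ^ p * h (A x.1 + B x.2) ^ r, fun x => g x.2 ^ q * h (A x.1 + B x.2) ^ r]
  have hF : ∀ s ∈ Finset.univ, AEMeasurable (F s) volume := by
    intro s _
    fin_cases s
    · exact ((hfm.comp measurable_fst).mul (hgm.comp measurable_snd)).aemeasurable
    · exact ((hfm.comp measurable_fst).mul hhm').aemeasurable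
    · exact ((hgm.comp measurable_snd).mul hhm').aemeasurable
  have hH := ENNReal.lintegral_prod_norm_pow_le Finset.univ hF (p := ![w, v, u])
    (by simp [Fin.sum_univ_three, hu, hv, hw]; linarith) (by
      intro s _
      fin_cases s
      exacts [hw0, hv0, hu0])
  simp only [Fin.prod_univ_three] at hH
  replace hH : ∫⁻ x : X × Y, (f x.1 ^ p * g x.2 ^ q) ^ w *
      (f x.1 ^ p * h (A x.1 + B x.2) ^ r) ^ v * (g x.2 ^ q * h (A x.1 + B x.2) ^ r) ^ u ≤
      (∫⁻ x : X × Y, f x.1 ^ p * g x.2 ^ q) ^ w *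
      (∫⁻ x : X × Y, f x.1 ^ p * h (A x.1 + B x.2) ^ r) ^ v *
      (∫⁻ x : X × Y, g x.2 ^ q * h (A x.1 + B x.2) ^ r) ^ u := hH
  have hpos : ∀ {s : ℝ}, 1 ≤ s → 0 < s := fun h => zero_lt_one.trans_le h
  have key : ∀ {s y z : ℝ} (x : ℝ≥0∞), 1 ≤ s → 0 ≤ y → 0 ≤ z → y + z = s⁻¹ →
      (x ^ s) ^ y * (x ^ s) ^ z = x := by
    intro s y z x hs hy hz hyz
    rw [← ENNReal.rpow_add_of_nonneg _ _ hy hz, hyz, ENNReal.rpow_rpow_inv (hpos hs).ne']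
  have hpt : ∀ x : X × Y, (f x.1 ^ p * g x.2 ^ q) ^ w * (f x.1 ^ p * h (A x.1 + B x.2) ^ r) ^ v *
      (g x.2 ^ q * h (A x.1 + B x.2) ^ r) ^ u = f x.1 * g x.2 * h (A x.1 + B x.2) := by
    intro x
    rw [ENNReal.mul_rpow_of_nonneg _ _ hw0, ENNReal.mul_rpow_of_nonneg _ _ hv0,
      ENNReal.mul_rpow_of_nonneg _ _ hu0]
    have e1 := key (f x.1) hp hw0 hv0 (by linarith)
    have e2 := key (g x.2) hq hw0 hu0 (by linarith)
    have e3 := key (h (A x.1 + B x.2)) hr hv0 hu0 (by linarith)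
    nth_rewrite 3 [← e1]
    nth_rewrite 3 [← e2]
    nth_rewrite 3 [← e3]
    ring
  simp only [hpt] at hH
  refine hH.trans ?_
  have i1 : ∫⁻ x : X × Y, f x.1 ^ p * g x.2 ^ q = (∫⁻ x, f x ^ p) * ∫⁻ y, g y ^ q := by
    rw [Measure.volume_eq_prod, lintegral_prod_mul hfm.aemeasurable hgm.aemeasurable]
  rw [i1, hb.lintegral_prod_comp_add (A := A) hfm hhm]
  refine (mul_le_mul_right (ha _ _ hgm hhm) _).trans (le_of_eq ?_)
  rw [one_div, one_div, one_div, show p⁻¹ = w + v by linarith, show q⁻¹ = w + u by linarith,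
    show r⁻¹ = v + u by linarith, ENNReal.rpow_add_of_nonneg _ _ hw0 hv0,
    ENNReal.rpow_add_of_nonneg _ _ hw0 hu0, ENNReal.rpow_add_of_nonneg _ _ hv0 hu0]
  simp only [ENNReal.mul_rpow_of_nonneg _ _ hw0, ENNReal.mul_rpow_of_nonneg _ _ hv0,
    ENNReal.mul_rpow_of_nonneg _ _ hu0, ENNReal.coe_mul, ENNReal.coe_rpow_of_nonneg _ hv0,
    ENNReal.coe_rpow_of_nonneg _ hu0]
  ring

end Young

namespace SBLDatum

variable {H : Type*} {E : Fin 4 → Type*}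
  [NormedAddCommGroup H] [InnerProductSpace ℝ H] [FiniteDimensional ℝ H]
  [∀ i, NormedAddCommGroup (E i)] [∀ i, InnerProductSpace ℝ (E i)]
  [∀ i, FiniteDimensional ℝ (E i)] {D : SBLDatum H E}
  [MeasurableSpace H] [BorelSpace H] [∀ i, MeasurableSpace (E i)] [∀ i, BorelSpace (E i)]

/-- Data of Young type are bounded. -/
theorem isPBounded_of_youngType {p : Fin 3 → ℝ≥0∞} (hp_one : ∀ i, 1 ≤ p i)
    (hp_top : ∀ i, p i < ∞) (h : D.module.YoungType p) : D.IsPBounded p := by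
  obtain ⟨hD, i, hi, hpi⟩ := h.spans_indep
  have hone : ∀ i, 1 ≤ (p i).toReal := fun i => by
    have := ENNReal.toReal_mono (hp_top i).ne (hp_one i)
    rwa [ENNReal.toReal_one] at this
  have hsum' : (p 0).toReal⁻¹ + (p 1).toReal⁻¹ + (p 2).toReal⁻¹ = 2 := by
    have hne : ∀ i, (p i)⁻¹ ≠ ∞ := fun i =>
      ENNReal.inv_ne_top.2 (zero_lt_one.trans_le (hp_one i)).ne'
    have h1 := congrArg ENNReal.toReal h.1
    rwa [ENNReal.toReal_add (ENNReal.add_ne_top.2 ⟨hne 0, hne 1⟩) (hne 2),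
      ENNReal.toReal_add (hne 0) (hne 1), ENNReal.toReal_inv, ENNReal.toReal_inv,
      ENNReal.toReal_inv, ENNReal.toReal_ofNat] at h1
  -- The singular integral will act on f_k, which requires p_k > 1. If both exponents other than p_i
  -- were 1, then 1/p_i would be zero, so a suitable order of the two exists.
  have hjk : ∃ j k : Fin 3, i ≠ j ∧ j ≠ k ∧ i ≠ k ∧ (p k).toReal ≠ 1 ∧
      (p i).toReal⁻¹ + (p j).toReal⁻¹ + (p k).toReal⁻¹ = 2 := by
    have h1 : ∀ i : Fin 3, ∃ j k, i ≠ j ∧ j ≠ k ∧ i ≠ k := by decide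
    obtain ⟨j, k, hij, hjk, hik⟩ := h1 i
    have h2 : (p i).toReal⁻¹ + (p j).toReal⁻¹ + (p k).toReal⁻¹ = 2 := by
      have e : ∀ {j k : Fin 3}, i ≠ j → j ≠ k → i ≠ k → ∀ u : Fin 3 → ℝ,
          u i + u j + u k = u 0 + u 1 + u 2 := by
        intro j k hij hjk hik u
        have := Fin.prod_eq_of_ne (M := Multiplicative ℝ) hij hjk hik
          (fun s => Multiplicative.ofAdd (u s))
        rw [Fin.prod_univ_three] at this
        exact (Multiplicative.ofAdd.injective this).symm
      rw [← hsum']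
      exact e hij hjk hik fun s => (p s).toReal⁻¹
    by_cases hk : (p k).toReal = 1
    · refine ⟨k, j, hik, hjk.symm, hij, fun hj => ?_, by linarith⟩
      rw [hj, hk] at h2
      have := inv_pos.2 (zero_lt_one.trans_le (hone i))
      linarith [inv_one (G := ℝ)]
    · exact ⟨j, k, hij, hjk, hik, hk, h2⟩
  obtain ⟨j, k, hij, hjk, hik, hpk, hsum⟩ := hjk
  have h0 : ∀ a : Fin 3, (0 : Fin 4) ≠ a.succ := fun a => (Fin.succ_ne_zero a).symm
  have hs : ∀ {a b : Fin 3}, a ≠ b → a.succ ≠ b.succ := fun hab h =>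
    hab (Fin.succ_injective _ h)
  obtain ⟨S₁, hS₁⟩ := exists_linearEquiv_triple (h0 i) (hs hij) (h0 j) (hi j hij.symm).1
    (hi j hij.symm).2
  obtain ⟨R₁, hR₁⟩ := exists_linearEquiv_triple (h0 i) (hs hik) (h0 k) (hi k hik.symm).1
    (hi k hik.symm).2
  -- On the common kernel of Π₀ and Π_i both Π_j and Π_k are coordinates. In the coordinates (t, x,
  -- y) of S this makes Π_k equal to A x + B y + C t with B invertible.
  obtain ⟨B, hB⟩ := S₁.exists_linearEquiv_of_fst_eq R₁ fun x => by rw [hS₁, hR₁]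
  let S := S₁.trans (LinearEquiv.prodAssoc ℝ (E 0) (E i.succ) (E j.succ))
  have hS : ∀ x, S x = (D.proj 0 x, D.proj i.succ x, D.proj j.succ x) := fun x => by
    simp [S, hS₁]
  have hSs : ∀ t x y, D.proj 0 (S.symm (t, x, y)) = t ∧ D.proj i.succ (S.symm (t, x, y)) = x ∧
      D.proj j.succ (S.symm (t, x, y)) = y := by
    intro t x y
    have h1 := hS (S.symm (t, x, y))
    rw [S.apply_symm_apply] at h1
    simp only [Prod.ext_iff] at h1
    exact ⟨h1.1.symm, h1.2.1.symm, h1.2.2.symm⟩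
  let L : E 0 × E i.succ × E j.succ →ₗ[ℝ] E k.succ := D.proj k.succ ∘ₗ S.symm.toLinearMap
  let C : E 0 →ₗ[ℝ] E k.succ := L ∘ₗ LinearMap.inl ℝ _ _
  let A : E i.succ →ₗ[ℝ] E k.succ := L ∘ₗ LinearMap.inr ℝ _ _ ∘ₗ LinearMap.inl ℝ _ _
  have hL : ∀ t x y, D.proj k.succ (S.symm (t, x, y)) = A x + B y + C t := by
    intro t x y
    have h1 : D.proj k.succ (S.symm (0, 0, y)) = B y := by
      have h2 : S.symm (0, 0, y) = S₁.symm (0, y) := rfl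
      have h3 := hR₁ (S₁.symm (0, y))
      rw [hB] at h3
      rw [h2]
      exact (congrArg Prod.snd h3).symm
    have h4 : S.symm (t, x, y) = S.symm (0, x, 0) + S.symm (0, 0, y) + S.symm (t, 0, 0) := by
      rw [← map_add, ← map_add]; simp
    rw [h4, map_add, map_add, h1]
    rfl
  have hCinj : Function.Injective C := by
    rw [injective_iff_map_eq_zero]
    intro t ht
    have h1 : S.symm (t, 0, 0) = 0 :=
      eq_zero_of_proj_eq_zero hD hij hjk hik (hSs t 0 0).2.1 (hSs t 0 0).2.2 ht
    exact congrArg Prod.fst ((S.symm.map_eq_zero_iff).1 h1)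
  -- If every pair gives coordinates, the argument for B with the roles of i and j exchanged shows
  -- that A is invertible as well.
  have hA : (p i).toReal = 1 ∨ ∃ A' : E i.succ ≃ₗ[ℝ] E k.succ, ∀ x, A' x = A x := by
    rcases hpi with hpi | hall
    · exact Or.inl (by rw [hpi, ENNReal.toReal_one])
    · obtain ⟨S₂, hS₂⟩ := exists_linearEquiv_triple (h0 j) (hs hij.symm) (h0 i) (hall j i hij).1
        (hall j i hij).2
      obtain ⟨R₂, hR₂⟩ := exists_linearEquiv_triple (h0 j) (hs hjk) (h0 k) (hall j k hjk.symm).1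
        (hall j k hjk.symm).2
      obtain ⟨A', hA'⟩ := S₂.exists_linearEquiv_of_fst_eq R₂ fun x => by rw [hS₂, hR₂]
      refine Or.inr ⟨A', fun x => ?_⟩
      have h1 : S₂.symm (0, x) = S.symm (0, x, 0) := by
        refine S₂.injective ?_
        rw [S₂.apply_symm_apply, hS₂, (hSs 0 x 0).1, (hSs 0 x 0).2.1, (hSs 0 x 0).2.2]
        rfl
      have h2 := hA' x
      rw [hR₂, h1] at h2
      exact (congrArg Prod.snd h2).symm
  obtain ⟨c, hc⟩ := exists_isVolumeScaling S
  obtain ⟨Y, hY⟩ := exists_lintegral_mul_le_of_young A B (hone i) (hone j) (hone k) hsum hA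
  set q := (p k).toReal with hq
  refine isPBounded_of_isConvBounded hD (lt_of_le_of_ne (hone k) hpk.symm) fun a =>
    ⟨c * Y * a ^ (1 / q), fun κ hκ f => ?_⟩
  have hT := hκ.lintegral_kernelTranslate_le hCinj (f k).continuous (f k).integrable
    ⟨_, (f k).norm_le_seminorm ℝ⟩
  obtain ⟨F, hF⟩ := exists_schwartzMap_eq_integrand hD f
  have hFi : Integrable (D.integrand f) := F.integrable.congr (ae_of_all _ hF)
  have hmain := hc.enorm_integral_mul_le (W := E k.succ) hFi hκ.continuous hκ.bounded
    (P := D.proj 0) (fun x => by rw [hS]) (a := fun w => f i w.1 * f j w.2) (G := f k)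
    (l := fun w => A w.1 + B w.2) (C := C) (by
      rintro t ⟨x, y⟩
      simp only [integrand]
      rw [Fin.prod_eq_of_ne hij hjk hik, hL, (hSs t x y).2.1, (hSs t x y).2.2])
  refine hmain.trans ?_
  have hTc : Continuous (kernelTranslate κ C (f k)) :=
    continuous_kernelTranslate hκ.integrable C (f k).continuous ((f k).norm_le_seminorm ℝ)
  have hH := hY (fun x => ‖f i x‖ₑ) (fun y => ‖f j y‖ₑ) (fun z => ‖kernelTranslate κ C (f k) z‖ₑ)
    (f i).continuous.enorm.measurable (f j).continuous.enorm.measurable hTc.enorm.measurable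
  simp only [enorm_mul]
  refine (mul_le_mul_right hH _).trans ?_
  rw [Fin.prod_eq_of_ne hij hjk hik, eLpNorm_eq_lintegral_rpow_of_one_le (hp_one i) (hp_top i),
    eLpNorm_eq_lintegral_rpow_of_one_le (hp_one j) (hp_top j),
    eLpNorm_eq_lintegral_rpow_of_one_le (hp_one k) (hp_top k), ← hq]
  have hq0 : 0 ≤ 1 / q := one_div_nonneg.2 (zero_le_one.trans (hone k))
  refine (mul_le_mul_right (mul_le_mul_right (mul_le_mul_right
    (ENNReal.rpow_le_rpow hT hq0) _) _) _).trans (le_of_eq ?_)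
  rw [ENNReal.mul_rpow_of_nonneg _ _ hq0, ENNReal.coe_mul, ENNReal.coe_mul,
    ENNReal.coe_rpow_of_nonneg _ hq0]
  ring

end SBLDatum

/-! ### Data of Loomis-Whitney type -/

section LoomisWhitney

/-- Cauchy–Schwarz twice: for fixed x, first in (y, z), where the square of g h splits into separate
integrals over z and y; then in x. -/
theorem lintegral_mul_mul_le_of_loomisWhitney {X Y Z : Type*} [MeasurableSpace X]
    [MeasurableSpace Y] [MeasurableSpace Z] {μ : Measure X} {ν : Measure Y} {ρ : Measure Z}
    [SFinite μ] [SFinite ν] [SFinite ρ] {f : Y × Z → ℝ≥0∞} {g : X × Z → ℝ≥0∞} {h : X × Y → ℝ≥0∞}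
    (hf : Measurable f) (hg : Measurable g) (hh : Measurable h) :
    ∫⁻ w : X × Y × Z, f (w.2.1, w.2.2) * g (w.1, w.2.2) * h (w.1, w.2.1) ∂(μ.prod (ν.prod ρ)) ≤
      (∫⁻ w, f w ^ (2 : ℝ) ∂(ν.prod ρ)) ^ (1 / 2 : ℝ) *
        (∫⁻ w, g w ^ (2 : ℝ) ∂(μ.prod ρ)) ^ (1 / 2 : ℝ) *
        (∫⁻ w, h w ^ (2 : ℝ) ∂(μ.prod ν)) ^ (1 / 2 : ℝ) := by
  have hg2 : Measurable (fun w => g w ^ (2 : ℝ)) := hg.pow_const _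
  have hh2 : Measurable (fun w => h w ^ (2 : ℝ)) := hh.pow_const _
  have hgx : ∀ x, Measurable (fun z => g (x, z)) := fun x => hg.comp measurable_prodMk_left
  have hhx : ∀ x, Measurable (fun y => h (x, y)) := fun x => hh.comp measurable_prodMk_left
  have hhalf : (0 : ℝ) ≤ 1 / 2 := by norm_num
  have hm : Measurable (fun w : X × Y × Z => f (w.2.1, w.2.2) * g (w.1, w.2.2) *
      h (w.1, w.2.1)) := by fun_prop
  rw [lintegral_prod _ hm.aemeasurable]
  simp only
  have h1 : ∀ x, ∫⁻ w : Y × Z, f (w.1, w.2) * g (x, w.2) * h (x, w.1) ∂(ν.prod ρ) ≤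
      (∫⁻ w, f w ^ (2 : ℝ) ∂(ν.prod ρ)) ^ (1 / 2 : ℝ) *
        ((∫⁻ z, g (x, z) ^ (2 : ℝ) ∂ρ) ^ (1 / 2 : ℝ) *
          (∫⁻ y, h (x, y) ^ (2 : ℝ) ∂ν) ^ (1 / 2 : ℝ)) := by
    intro x
    have hgh : Measurable (fun w : Y × Z => h (x, w.1) * g (x, w.2)) := by fun_prop
    have h2 := ENNReal.lintegral_mul_le_Lp_mul_Lq (ν.prod ρ) Real.HolderConjugate.two_two
      hf.aemeasurable hgh.aemeasurable
    have h3 : ∫⁻ w : Y × Z, (h (x, w.1) * g (x, w.2)) ^ (2 : ℝ) ∂(ν.prod ρ) =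
        (∫⁻ y, h (x, y) ^ (2 : ℝ) ∂ν) * ∫⁻ z, g (x, z) ^ (2 : ℝ) ∂ρ := by
      rw [← lintegral_prod_mul ((hhx x).pow_const _).aemeasurable
        ((hgx x).pow_const _).aemeasurable]
      simp only [ENNReal.mul_rpow_of_nonneg _ _ (zero_le_two : (0 : ℝ) ≤ 2)]
    rw [h3, ENNReal.mul_rpow_of_nonneg _ _ hhalf] at h2
    refine le_trans (le_of_eq (lintegral_congr fun w => ?_)) (h2.trans (le_of_eq ?_))
    · simp only [Pi.mul_apply]
      ring
    · ring
  refine (lintegral_mono h1).trans ?_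
  have hgm : Measurable (fun x => (∫⁻ z, g (x, z) ^ (2 : ℝ) ∂ρ) ^ (1 / 2 : ℝ)) :=
    hg2.lintegral_prod_right'.pow_const _
  have hhm : Measurable (fun x => (∫⁻ y, h (x, y) ^ (2 : ℝ) ∂ν) ^ (1 / 2 : ℝ)) :=
    hh2.lintegral_prod_right'.pow_const _
  have hghm : Measurable (fun x => (∫⁻ z, g (x, z) ^ (2 : ℝ) ∂ρ) ^ (1 / 2 : ℝ) *
      (∫⁻ y, h (x, y) ^ (2 : ℝ) ∂ν) ^ (1 / 2 : ℝ)) := hgm.mul hhm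
  rw [lintegral_const_mul _ hghm, mul_assoc]
  refine mul_le_mul_right ?_ _
  have h2 := ENNReal.lintegral_mul_le_Lp_mul_Lq μ Real.HolderConjugate.two_two
    hgm.aemeasurable hhm.aemeasurable
  have h3 : ∀ t : ℝ≥0∞, (t ^ (1 / 2 : ℝ)) ^ (2 : ℝ) = t := fun t => by
    rw [← ENNReal.rpow_mul]; norm_num
  simp only [h3, Pi.mul_apply] at h2
  rwa [lintegral_prod _ hg2.aemeasurable, lintegral_prod _ hh2.aemeasurable]

variable {X : Fin 3 → Type*} [∀ i, NormedAddCommGroup (X i)] [∀ i, InnerProductSpace ℝ (X i)]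
  [∀ i, FiniteDimensional ℝ (X i)] [∀ i, MeasurableSpace (X i)] [∀ i, BorelSpace (X i)]

variable (X) in
theorem exists_isVolumeScaling_withLp :
    ∃ c, IsVolumeScaling (WithLp.linearEquiv 2 ℝ (∀ i, X i)) c := by
  have : (volume : Measure (∀ i, X i)).IsAddHaarMeasure := by
    rw [volume_pi]
    infer_instance
  exact exists_isVolumeScaling _

/-- The Fourier transform of a tensor product. -/
theorem SchwartzMap.fourier_eq_prod {c : ℝ≥0}
    (hc : IsVolumeScaling (WithLp.linearEquiv 2 ℝ (∀ i, X i)) c) (g : ∀ i, 𝓢(X i, ℂ))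
    {Φ : 𝓢(PiLp 2 X, ℂ)} (hΦ : ∀ u, Φ u = ∏ i, g i (u i)) (w : PiLp 2 X) :
    𝓕 Φ w = (c : ℝ) • ∏ i, 𝓕 (g i) (w i) := by
  rw [fourier_coe, Real.fourier_eq']
  simp only [fourier_coe, Real.fourier_eq']
  rw [← integral_fintype_prod_volume_eq_prod, ← hc.integral_comp]
  refine integral_congr_ae (ae_of_all _ fun u => ?_)
  simp only [smul_eq_mul]
  rw [hΦ, PiLp.inner_apply, Finset.prod_mul_distrib, ← Complex.exp_sum]
  congr 2
  rw [← Finset.sum_mul, ← Complex.ofReal_sum, Finset.mul_sum]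
  rfl

end LoomisWhitney

theorem SchwartzMap.fourier_fourier_apply {V : Type*} [NormedAddCommGroup V]
    [InnerProductSpace ℝ V] [FiniteDimensional ℝ V] [MeasurableSpace V] [BorelSpace V]
    (φ : 𝓢(V, ℂ)) (x : V) : 𝓕 (𝓕 φ) x = φ (-x) := by
  rw [fourier_coe, ← neg_neg x, ← Real.fourierInv_eq_fourier_neg, ← fourierInv_coe,
    FourierTransform.fourierInv_fourier_eq, neg_neg]

theorem SchwartzMap.lintegral_enorm_fourierInv_sq {V : Type*} [NormedAddCommGroup V]
    [InnerProductSpace ℝ V] [FiniteDimensional ℝ V] [MeasurableSpace V] [BorelSpace V]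
    (f : 𝓢(V, ℂ)) : ∫⁻ x, ‖𝓕⁻ f x‖ₑ ^ (2 : ℝ) = ∫⁻ x, ‖f x‖ₑ ^ (2 : ℝ) := by
  have h := _root_.lintegral_enorm_fourierInv_sq f.integrable (f.memLp 2)
  simpa only [ENNReal.rpow_two, fourierInv_coe] using h

namespace SBLDatum

variable {H : Type*} {E : Fin 4 → Type*}
  [NormedAddCommGroup H] [InnerProductSpace ℝ H] [FiniteDimensional ℝ H]
  [∀ i, NormedAddCommGroup (E i)] [∀ i, InnerProductSpace ℝ (E i)]
  [∀ i, FiniteDimensional ℝ (E i)] {D : SBLDatum H E}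

/-- Coordinates on `H₁ × H₂ × H₃`, the first of which is the sum of the adjoints of the `Π_i`. -/
theorem exists_linearEquiv_adjoint (hD : D.module.Spans {1, 2, 3}) :
    ∃ (n : ℕ) (S : PiLp 2 (fun a : Fin 3 => E a.succ) ≃ₗ[ℝ] H × EuclideanSpace ℝ (Fin n))
      (J : H →ₗ[ℝ] PiLp 2 (fun a : Fin 3 => E a.succ)),
      (∀ u, (S u).1 = J.adjoint u) ∧ ∀ x a, J x a = D.proj a.succ x := by
  let J : H →ₗ[ℝ] PiLp 2 (fun a : Fin 3 => E a.succ) :=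
    (WithLp.linearEquiv 2 ℝ (∀ a : Fin 3, E a.succ)).symm.toLinearMap ∘ₗ
      LinearMap.pi fun a : Fin 3 => D.proj a.succ
  have hJ : ∀ x a, J x a = D.proj a.succ x := fun x a => rfl
  have hinj : Function.Injective J := by
    rw [injective_iff_map_eq_zero]
    intro x hx
    have h1 : ∀ a : Fin 3, D.proj a.succ x = 0 := fun a => by rw [← hJ, hx]; rfl
    exact eq_zero_of_proj_eq_zero hD (i := 0) (j := 1) (k := 2) (by decide) (by decide)
      (by decide) (h1 0) (h1 1) (h1 2)
  -- J^* J is injective because J is, hence onto by finite dimension; so J^* is onto.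
  have hbij : Function.Surjective (J.adjoint ∘ₗ J) := by
    refine LinearMap.surjective_of_injective ((injective_iff_map_eq_zero _).2 fun x hx => ?_)
    refine hinj ?_
    rw [map_zero, ← inner_self_eq_zero (𝕜 := ℝ), ← LinearMap.adjoint_inner_left]
    rw [LinearMap.comp_apply] at hx
    rw [hx, inner_zero_left]
  have hsurj : Function.Surjective J.adjoint := fun x => by
    obtain ⟨y, hy⟩ := hbij x
    exact ⟨J y, hy⟩
  obtain ⟨σ, hσ⟩ := J.adjoint.exists_rightInverse_of_surjective (LinearMap.range_eq_top.2 hsurj)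
  obtain ⟨n, S, hS, -⟩ := J.adjoint.exists_linearEquiv_prod σ (LinearMap.congr_fun hσ)
  exact ⟨n, S, J, hS, hJ⟩

/-- Coordinates on the space of relations given by the component `0` and the coordinates along the
fibres of the sum of the adjoints of the `Π_i`. -/
theorem exists_linearEquiv_relationSpace {N : Type*} [AddCommGroup N] [Module ℝ N]
    {S : PiLp 2 (fun a : Fin 3 => E a.succ) ≃ₗ[ℝ] H × N}
    {J : H →ₗ[ℝ] PiLp 2 (fun a : Fin 3 => E a.succ)} (hS : ∀ u, (S u).1 = J.adjoint u)
    (hJ : ∀ x a, J x a = D.proj a.succ x) :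
    ∃ θ : (E 0 × N) ≃ₗ[ℝ] D.relationSpace, ∀ ξ n (a : Fin 3),
      (θ (ξ, n) : ∀ i, E i) a.succ = S.symm (-(D.proj 0).adjoint ξ, n) a := by
  have hsum : ∀ (u : PiLp 2 (fun a : Fin 3 => E a.succ)) x,
      inner ℝ (S u).1 x = ∑ a, inner ℝ (u a) (D.proj a.succ x) := fun u x => by
    rw [hS, LinearMap.adjoint_inner_left, PiLp.inner_apply]
    simp only [hJ]
  -- The triples whose images under Π₁^*, Π₂^*, Π₃^* add up to -Π₀^* ξ, with n running along the
  -- fibre; together with ξ as component 0 they form relations.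
  let T : E 0 × N →ₗ[ℝ] PiLp 2 (fun a : Fin 3 => E a.succ) :=
    S.symm.toLinearMap ∘ₗ (-(D.proj 0).adjoint).prodMap LinearMap.id
  have hT : ∀ w, T w = S.symm (-(D.proj 0).adjoint w.1, w.2) := fun w => rfl
  let L : ∀ i, E 0 × N →ₗ[ℝ] E i := Fin.cases (LinearMap.fst ℝ (E 0) N) fun a =>
    LinearMap.proj (φ := fun a : Fin 3 => E a.succ) a ∘ₗ
      (WithLp.linearEquiv 2 ℝ (∀ a : Fin 3, E a.succ)).toLinearMap ∘ₗ T
  have hL0 : ∀ w, L 0 w = w.1 := fun w => rfl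
  have hLs : ∀ w (a : Fin 3), L a.succ w = T w a := fun w a => rfl
  let Θ : E 0 × N →ₗ[ℝ] D.relationSpace := (LinearMap.pi L).codRestrict _ fun w x => by
    simp only [LinearMap.pi_apply]
    rw [Fin.sum_univ_succ, hL0]
    simp only [hLs]
    rw [← hsum, hT, S.apply_symm_apply, inner_neg_left, LinearMap.adjoint_inner_left,
      add_neg_cancel]
  have hΘ : ∀ w i, (Θ w : ∀ i, E i) i = L i w := fun w i => rfl
  refine ⟨LinearEquiv.ofBijective Θ ⟨?_, fun e => ?_⟩, fun ξ n a => rfl⟩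
  · rw [injective_iff_map_eq_zero]
    intro w hw
    have h1 : ∀ i, L i w = 0 := fun i => by rw [← hΘ, hw]; rfl
    have h2 : T w = 0 := by
      ext a
      exact h1 a.succ
    rw [hT, LinearEquiv.map_eq_zero_iff] at h2
    exact Prod.ext (h1 0) (Prod.ext_iff.1 h2).2
  · let u : PiLp 2 (fun a : Fin 3 => E a.succ) := WithLp.toLp 2 fun a => (e : ∀ i, E i) a.succ
    have h1 : (S u).1 = -(D.proj 0).adjoint ((e : ∀ i, E i) 0) := by
      refine ext_inner_right ℝ fun x => ?_
      have h2 := e.2 x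
      rw [Fin.sum_univ_succ] at h2
      rw [hsum, inner_neg_left, LinearMap.adjoint_inner_left]
      exact eq_neg_of_add_eq_zero_right h2
    have h3 : T ((e : ∀ i, E i) 0, (S u).2) = u := by
      rw [hT, ← h1]
      exact S.symm_apply_apply u
    refine ⟨((e : ∀ i, E i) 0, (S u).2), Subtype.ext (funext fun i => ?_)⟩
    rw [hΘ]
    refine Fin.cases rfl (fun a => ?_) i
    rw [hLs, h3]

variable [MeasurableSpace H] [BorelSpace H] [∀ i, MeasurableSpace (E i)] [∀ i, BorelSpace (E i)]

/-- The Fourier transform of the integrand is an integral over the fibres of the sum of the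
adjoints of the `Π_i`. -/
theorem exists_enorm_fourier_integrand_le {n : ℕ}
    {S : PiLp 2 (fun a : Fin 3 => E a.succ) ≃ₗ[ℝ] H × EuclideanSpace ℝ (Fin n)}
    {J : H →ₗ[ℝ] PiLp 2 (fun a : Fin 3 => E a.succ)} (hS : ∀ u, (S u).1 = J.adjoint u)
    (hJ : ∀ x a, J x a = D.proj a.succ x) : ∃ C : ℝ≥0, ∀ (f : ∀ i : Fin 3, 𝓢(E i.succ, ℂ))
      (F : 𝓢(H, ℂ)), (∀ x, F x = D.integrand f x) → ∀ η,
        ‖𝓕 F η‖ₑ ≤ C * ∫⁻ v, ∏ a, ‖𝓕⁻ (f a) (S.symm (-η, v) a)‖ₑ := by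
  obtain ⟨c, hc⟩ := exists_isVolumeScaling S
  obtain ⟨κ, hκ⟩ := exists_isVolumeScaling_withLp (fun a : Fin 3 => E a.succ)
  have hκ0 : (κ : ℝ) ≠ 0 := NNReal.coe_ne_zero.2 hκ.1
  refine ⟨κ⁻¹ * c, fun f F hF η => ?_⟩
  obtain ⟨Φ, hΦ⟩ := exists_schwartzMap_eq_prod
    (V := PiLp 2 (fun a : Fin 3 => E a.succ))
    (A := fun a => LinearMap.proj (φ := fun a : Fin 3 => E a.succ) a ∘ₗ
      (WithLp.linearEquiv 2 ℝ (∀ a : Fin 3, E a.succ)).toLinearMap)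
    (fun u hu => by ext a; exact hu a) (fun a => 𝓕⁻ (f a))
  obtain ⟨φ, hφ, hφF, -⟩ := Φ.exists_fiberIntegral hc hS
  -- F is the restriction along J of the tensor product of the 𝓕(𝓕⁻ f_a), and restricting a Fourier
  -- transform along J gives the transform of the fibre integral over J^*.
  have h1 : F = (κ : ℝ)⁻¹ • 𝓕 φ := by
    ext x
    rw [hF, _root_.smul_apply, hφF, LinearMap.adjoint_adjoint,
      SchwartzMap.fourier_eq_prod hκ (fun a => 𝓕⁻ (f a)) hΦ, smul_smul, inv_mul_cancel₀ hκ0,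
      one_smul]
    simp only [FourierTransform.fourier_fourierInv_eq, hJ, integrand]
  have h2 : 𝓕 F η = (κ : ℝ)⁻¹ • φ (-η) := by
    rw [h1, FourierTransform.fourier_smul, _root_.smul_apply,
      SchwartzMap.fourier_fourier_apply]
  rw [h2, hφ, enorm_smul, enorm_smul, ← NNReal.coe_inv, Real.enorm_eq_ofReal κ⁻¹.coe_nonneg,
    Real.enorm_eq_ofReal c.coe_nonneg, ENNReal.ofReal_coe_nnreal, ENNReal.ofReal_coe_nnreal,
    ENNReal.coe_mul, mul_assoc]
  gcongr
  refine (enorm_integral_le_lintegral_enorm _).trans (le_of_eq (lintegral_congr fun v => ?_))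
  rw [hΦ, Fin.prod_univ_three, Fin.prod_univ_three, enorm_mul, enorm_mul]
  rfl

/-- Data of Loomis-Whitney type are bounded. -/
theorem isPBounded_of_loomisWhitneyType {p : Fin 3 → ℝ≥0∞} (h : D.module.LoomisWhitneyType p) :
    D.IsPBounded p := by
  obtain ⟨hD, hJ, hS, hI⟩ := h.relations
  obtain ⟨n, R, A₁, A₂, A₃, hR⟩ := exists_coordinates_relationSpace hJ hS hI
  obtain ⟨k, S, J, hSJ, hJD⟩ := exists_linearEquiv_adjoint hD
  obtain ⟨θ, hθ⟩ := exists_linearEquiv_relationSpace hSJ hJD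
  obtain ⟨C, hC⟩ := exists_enorm_fourier_integrand_le hSJ hJD
  obtain ⟨d, hd⟩ := exists_isVolumeScaling (θ.trans R.symm)
  obtain ⟨a₁, ha₁⟩ := exists_isVolumeScaling A₁
  obtain ⟨a₂, ha₂⟩ := exists_isVolumeScaling A₂
  obtain ⟨a₃, ha₃⟩ := exists_isVolumeScaling A₃
  have hhalf : (0 : ℝ) ≤ 1 / 2 := by norm_num
  -- Only the bound |m| ≤ 1 is used, so no derivatives are needed and l = 0.
  refine ⟨0, C * d * a₁ ^ (1 / 2 : ℝ) * a₂ ^ (1 / 2 : ℝ) * a₃ ^ (1 / 2 : ℝ), fun K hK f => ?_⟩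
  obtain ⟨-, m, hm, hm1, -⟩ := hK
  obtain ⟨φ, hφ, hφF, -⟩ := exists_isFiberDensity hD f
  obtain ⟨F, hF⟩ := exists_schwartzMap_eq_integrand hD f
  refine ⟨K φ, ⟨φ, hφ, rfl⟩, ?_⟩
  let G : ∀ a : Fin 3, E a.succ → ℝ≥0∞ := fun a x => ‖𝓕⁻ (f a) x‖ₑ
  have hG : ∀ a, Continuous (G a) := fun a => (𝓕⁻ (f a)).continuous.enorm
  have hG₁ : Continuous fun w => G 0 (A₁ w) :=
    (hG 0).comp A₁.toLinearMap.continuous_of_finiteDimensional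
  have hG₂ : Continuous fun w => G 1 (A₂ w) :=
    (hG 1).comp A₂.toLinearMap.continuous_of_finiteDimensional
  have hG₃ : Continuous fun w => G 2 (A₃ w) :=
    (hG 2).comp A₃.toLinearMap.continuous_of_finiteDimensional
  let W : (EuclideanSpace ℝ (Fin (n 0)) × EuclideanSpace ℝ (Fin (n 1)) ×
    EuclideanSpace ℝ (Fin (n 2))) → ℝ≥0∞ := fun w =>
      G 0 (A₁ (w.2.1, w.2.2)) * G 1 (A₂ (w.1, w.2.2)) * G 2 (A₃ (w.1, w.2.1))
  -- Integrating the fibre bound at Π₀^* ξ over ξ sweeps out the whole space of relations, on which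
  -- each factor depends on only two of the three coordinates.
  have h1 : ‖K φ‖ₑ ≤ C * ∫⁻ w : E 0 × EuclideanSpace ℝ (Fin k), W ((θ.trans R.symm) w) := by
    have hW : ∀ ξ v, W ((θ.trans R.symm) (ξ, v)) =
        ∏ a, ‖𝓕⁻ (f a) (S.symm (-(D.proj 0).adjoint ξ, v) a)‖ₑ := by
      intro ξ v
      obtain ⟨e1, e2, e3⟩ := hR (R.symm (θ (ξ, v))).1 (R.symm (θ (ξ, v))).2.1
        (R.symm (θ (ξ, v))).2.2
      simp only [Prod.mk.eta, R.apply_symm_apply] at e1 e2 e3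
      simp only [W, G, LinearEquiv.trans_apply, Prod.mk.eta, Fin.prod_univ_three, ← hθ]
      rw [← e1, ← e2, ← e3]
      rfl
    have hWm : Measurable fun w : E 0 × EuclideanSpace ℝ (Fin k) => W ((θ.trans R.symm) w) := by
      have hθc : Continuous (θ.trans R.symm) :=
        (θ.trans R.symm).toLinearMap.continuous_of_finiteDimensional
      have hWm : Measurable W :=
        ((hG₁.measurable.comp (measurable_snd.fst.prodMk measurable_snd.snd)).mul
          (hG₂.measurable.comp (measurable_fst.prodMk measurable_snd.snd))).mul
          (hG₃.measurable.comp (measurable_fst.prodMk measurable_snd.fst))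
      exact hWm.comp hθc.measurable
    rw [Measure.volume_eq_prod, lintegral_prod _ hWm.aemeasurable]
    have hm' : HasFourierMultiplier K m := hm
    rw [hm'.apply_eq]
    refine (enorm_integral_le_lintegral_enorm _).trans ?_
    rw [← lintegral_const_mul' _ _ ENNReal.coe_ne_top]
    refine lintegral_mono fun ξ => ?_
    simp only [hW]
    rw [enorm_mul, hφF F hF]
    refine (mul_le_of_le_one_right' ?_).trans (hC f F hF _)
    rw [← ofReal_norm]
    exact ENNReal.ofReal_le_one.2 (hm1 _)
  rw [hd.lintegral_comp] at h1
  -- Plancherel returns from 𝓕⁻ f_a to f_a, which is why the exponents must all be 2.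
  have hp : ∀ a, eLpNorm (f a) (p a) volume = (∫⁻ x, G a x ^ (2 : ℝ)) ^ (1 / 2 : ℝ) := fun a => by
    rw [h.1 a, eLpNorm_eq_lintegral_rpow_of_one_le one_le_two ENNReal.ofNat_lt_top,
      ENNReal.toReal_ofNat, SchwartzMap.lintegral_enorm_fourierInv_sq]
  have h2 := lintegral_mul_mul_le_of_loomisWhitney (μ := volume) (ν := volume) (ρ := volume)
    hG₁.measurable hG₂.measurable hG₃.measurable
  simp only [← Measure.volume_eq_prod] at h2
  rw [ha₁.lintegral_comp (fun x => G 0 x ^ (2 : ℝ)), ha₂.lintegral_comp (fun x => G 1 x ^ (2 : ℝ)),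
    ha₃.lintegral_comp (fun x => G 2 x ^ (2 : ℝ))] at h2
  refine (h1.trans (mul_le_mul_right (mul_le_mul_right h2 _) _)).trans (le_of_eq ?_)
  have hp₁ : _ = (∫⁻ x : E 1, G 0 x ^ (2 : ℝ)) ^ (1 / 2 : ℝ) := hp 0
  have hp₂ : _ = (∫⁻ x : E 2, G 1 x ^ (2 : ℝ)) ^ (1 / 2 : ℝ) := hp 1
  have hp₃ : _ = (∫⁻ x : E 3, G 2 x ^ (2 : ℝ)) ^ (1 / 2 : ℝ) := hp 2
  rw [Fin.prod_univ_three, hp₁, hp₂, hp₃]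
  simp only [ENNReal.mul_rpow_of_nonneg _ _ hhalf, ENNReal.coe_mul,
    ENNReal.coe_rpow_of_nonneg _ hhalf]
  ring

end SBLDatum

/-! ### The three cases combined -/

theorem theorem1p9 {H : Type*} {E : Fin 4 → Type*}
    [NormedAddCommGroup H] [InnerProductSpace ℝ H] [FiniteDimensional ℝ H]
    [MeasurableSpace H] [BorelSpace H]
    [∀ i, NormedAddCommGroup (E i)] [∀ i, InnerProductSpace ℝ (E i)]
    [∀ i, FiniteDimensional ℝ (E i)] [∀ i, MeasurableSpace (E i)] [∀ i, BorelSpace (E i)]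
    (D : SBLDatum H E) (p : Fin 3 → ℝ≥0∞)
    (hp_one : ∀ i, 1 ≤ p i) (hp_top : ∀ i, p i < ∞)
    (hcase : D.module.BilinearHolderType p ∨ D.module.YoungType p ∨
      D.module.LoomisWhitneyType p) :
    D.IsPBounded p := by
  rcases hcase with h | h | h
  · exact SBLDatum.isPBounded_of_bilinearHolderType hp_one hp_top h
  · exact SBLDatum.isPBounded_of_youngType hp_one hp_top h
  · exact SBLDatum.isPBounded_of_loomisWhitneyType h
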